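/- **Theorem (the basic diagram).** Let $K/k$ be a Galois extension of number fields, $\Sigma=\mathrm{Gal}(K/k)$, and let $G$ be a finite abelian group with a fixed left $\Sigma$-module structure (by group automorphisms). *Galois groups.* Let $K^c$ be an algebraic closure of $K$, $\Omega_K=\mathrm{Gal}(K^c/K)$, let $K^t\subset K^c$ be the maximal extension of $K$ that is tamely ramified at all finite primes (the compositum of all finite tamely ramified extensions), and $\Omega_K^t=\mathrm{Gal}(K^t/K)$. The group $\mathrm{Gal}(K^t/k)$ acts on $G$ through $\Sigma$; homomorphisms and crossed homomorphisms from $\Omega_K^t$ and $\mathrm{Gal}(K^t/k)$ to the discrete group $G$ are continuous. For each $\gamma\in\Sigma$ fix a lift $\overline\gamma\in\mathrm{Gal}(K^t/k)$, with $\overline 1=1$. *Top row.* $\Sigma$ acts on the right on $\mathrm{Hom}(\Omega_K^t,G)$ by $(h\cdot\gamma)(\omega)=\gamma^{-1}\cdot h(\overline\gamma\,\omega\,\overline\gamma^{-1})$, and $\mathrm{Hom}(\Omega_K^t,G)^\Sigma$ is the group of invariants. The map $\mathrm{res}:H^1(\mathrm{Gal}(K^t/k),G)\to\mathrm{Hom}(\Omega_K^t,G)^\Sigma$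 is restriction, and $tr:\mathrm{Hom}(\Omega_K^t,G)^\Sigma\to H^2(\Sigma,G)$ sends $h$ to the class of the $2$-cocycle $(\gamma,\delta)\mapsto h(\overline\gamma\,\overline\delta\,\overline{\gamma\delta}^{-1})$. *Class group.* $\mathrm{Cl}(\mathcal O_KG)$ is the locally free class group: its elements are the stable isomorphism classes $[X]$ (where $X\sim X'$ if $X\oplus(\mathcal O_KG)^n\simeq X'\oplus(\mathcal O_KG)^n$ for some $n\ge1$) of $\mathcal O_KG$-modules $X$ that are finitely generated and projective over $\mathcal O_K$ and satisfy $\mathcal O_{K_v}\otimes_{\mathcal O_K}X\simeq\mathcal O_{K_v}G$ over $\mathcal O_{K_v}G$ for all finite primes $v$ of $K$; the product is $[X][X']=[X'']$ whenever $X\oplus X'\simeq\mathcal O_KG\oplus X''$. The group $\Sigma$ acts on the ring $\mathcal O_KG$ through its actions on $\mathcal O_K$ and on $G$. A semilinear isomorphism $\varphi:X\to X'$ with grading $\gamma\in\Sigma$ is a group isomorphism such that $\varphi(\beta x)=(\gamma\cdot\beta)\varphi(x)$ for all $\beta\in\mathcal O_KG$ and $x\in X$. The group $\Sigma$ acts on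 $\mathrm{Cl}(\mathcal O_KG)$ by $\gamma\cdot[X]=[Y]$ if there is a semilinear isomorphism $X\to Y$ with grading $\gamma$. *Bottom row.* For $[X]\in\mathrm{Cl}(\mathcal O_KG)^\Sigma$ choose, for every $\gamma\in\Sigma$, a semilinear automorphism $\varphi_\gamma$ of $X$ with grading $\gamma$, and let $d_X:\Sigma\times\Sigma\to(\mathcal O_KG)^\times$ be determined by $d_X(\gamma,\delta)\cdot x=\varphi_\gamma\varphi_\delta\varphi_{\gamma\delta}^{-1}(x)$ for all $x\in X$. Then $\xi:\mathrm{Cl}(\mathcal O_KG)^\Sigma\to H^2(\Sigma,(\mathcal O_KG)^\times)$ is $\xi([X])=[d_X]$. *Vertical maps.* $i^*:H^2(\Sigma,G)\to H^2(\Sigma,(\mathcal O_KG)^\times)$ is induced by the inclusion $G\to(\mathcal O_KG)^\times$. For $h\in\mathrm{Hom}(\Omega_K^t,G)$, inflated to $\Omega_K$ by $\omega\mapsto h(\omega|_{K^t})$, let $K^h=(K^c)^{\ker h}$ and let $\mathcal O_h$ be the set of maps $a:G\to\mathcal O_{K^h}$ with $a(h(\omega)s)=\omega(a(s))$ for all $\omega\in\Omega_K$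 and $s\in G$, on which $G$ acts by $(s\cdot a)(t)=a(ts)$; put $\mathrm{gal}(h)=[\mathcal O_h]\in\mathrm{Cl}(\mathcal O_KG)$. Then: 1. All maps are well defined. For every $h\in\mathrm{Hom}(\Omega_K^t,G)$ the $\mathcal O_KG$-module $\mathcal O_h$ is finitely generated and projective over $\mathcal O_K$ and locally free of rank one over $\mathcal O_KG$, and if $h$ is $\Sigma$-invariant then $\mathrm{gal}(h)\in\mathrm{Cl}(\mathcal O_KG)^\Sigma$. If $[X]\in\mathrm{Cl}(\mathcal O_KG)^\Sigma$, then semilinear automorphisms of $X$ of every grading $\gamma\in\Sigma$ exist, for every choice of them $d_X$ exists, is unique and is a $2$-cocycle, and its class $\xi([X])$ depends neither on the choice nor on the representative $X$. 2. The diagram $$\begin{array}{ccccc} H^1(\mathrm{Gal}(K^t/k),G)&\xrightarrow{\ \mathrm{res}\ }&\mathrm{Hom}(\Omega_K^t,G)^\Sigma&\xrightarrow{\ tr\ }&H^2(\Sigma,G)\\ &&\Big\downarrow{\scriptstyle\mathrm{gal}}&&\Big\downarrow{\scriptstyle i^*}\\ &&\mathrm{Cl}(\mathcal O_KG)^\Sigma&\xrightarrow{\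 \xi\ }&H^2(\Sigma,(\mathcal O_KG)^\times) \end{array}$$ commutes, i.e. $i^*(tr(h))=\xi(\mathrm{gal}(h))$ for all $h\in\mathrm{Hom}(\Omega_K^t,G)^\Sigma$. 3. The top row is exact, and the maps $\mathrm{res}$, $tr$, $i^*$ and $\xi$ (all maps except possibly $\mathrm{gal}$) are group homomorphisms. -/

import Mathlib

open scoped NumberField

set_option linter.unusedSectionVars false

namespace BasicDiagram

section Cohomology

variable (Γ M N : Type*) [Group Γ] [CommGroup M] [MulDistribMulAction Γ M]
  [CommGroup N] [MulDistribMulAction Γ N]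

/-- The group of multiplicative `2`-cocycles of `Γ` with values in `M`. -/
def Z2 : Subgroup (Γ × Γ → M) where
  carrier := {f | groupCohomology.IsMulCocycle₂ f}
  one_mem' := by intro g h j; simp
  mul_mem' := by
    intro a b ha hb g h j
    have h1 := ha g h j
    have h2 := hb g h j
    simp only [Pi.mul_apply, smul_mul']
    rw [mul_mul_mul_comm, h1, h2, mul_mul_mul_comm]
  inv_mem' := by
    intro a ha g h j
    have h1 := ha g h j
    simp only [Pi.inv_apply, smul_inv']
    rw [← mul_inv, h1, mul_inv]

/-- The group of multiplicative `2`-coboundaries of `Γ` with values in `M`. -/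
def B2 : Subgroup (Γ × Γ → M) where
  carrier := {f | groupCohomology.IsMulCoboundary₂ f}
  one_mem' := ⟨1, by simp⟩
  mul_mem' := by
    rintro a b ⟨x, hx⟩ ⟨y, hy⟩
    refine ⟨x * y, fun g h => ?_⟩
    simp only [Pi.mul_apply, ← hx, ← hy, smul_mul']
    rw [mul_div_mul_comm, mul_mul_mul_comm]
  inv_mem' := by
    rintro a ⟨x, hx⟩
    refine ⟨x⁻¹, fun g h => ?_⟩
    simp only [Pi.inv_apply, ← hx, smul_inv', div_eq_mul_inv, mul_inv]

/-- The cohomology group `H²(Γ, M)` of a (discrete) group `Γ`, written multiplicatively. -/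
abbrev H2 : Type _ := Z2 Γ M ⧸ (B2 Γ M).subgroupOf (Z2 Γ M)

variable {Γ M N}

/-- The class in `H²(Γ, M)` of a `2`-cocycle. -/
def H2.mk (f : Γ × Γ → M) (hf : groupCohomology.IsMulCocycle₂ f) : H2 Γ M :=
  QuotientGroup.mk (⟨f, hf⟩ : Z2 Γ M)

/-- The map `H²(Γ, M) → H²(Γ, N)` induced by a `Γ`-equivariant homomorphism `M → N`. -/
def H2.map (φ : M →* N) (hφ : ∀ (γ : Γ) (m : M), φ (γ • m) = γ • φ m) : H2 Γ M → H2 Γ N :=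
  Quotient.lift
    (fun c : Z2 Γ M => H2.mk (fun p => φ (c.1 p)) (fun g h j => by
      rw [← hφ, ← map_mul, ← map_mul, c.2 g h j]))
    (by
      intro a b hab
      have hab' := QuotientGroup.leftRel_apply.1 hab
      apply QuotientGroup.eq.2
      obtain ⟨x, hx⟩ := Subgroup.mem_subgroupOf.1 hab'
      refine Subgroup.mem_subgroupOf.2 ⟨fun g => φ (x g), fun g h => ?_⟩
      simp only [← hφ, ← map_div, ← map_mul, hx]
      simp)

end Cohomology

section Tame

/-- An algebraic extension `L/K` of a number field `K`, with `L/K` finite in all uses below, is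
tamely ramified if at every nonzero prime `P` of `𝓞 L` the ramification index of `P` over `K` is
not divisible by the residue characteristic. -/
def IsTame (K L : Type*) [Field K] [Field L] [Algebra K L] : Prop :=
  ∀ P : Ideal (𝓞 L), P.IsPrime → P ≠ ⊥ → ¬ ringChar (𝓞 L ⧸ P) ∣ P.ramificationIdx (𝓞 K)

/-- The maximal tamely ramified extension `Kᵗ` of `K` inside the algebraic closure of `K`: the
compositum of all finite tamely ramified extensions of `K`. -/
noncomputable def tameClosure (K : Type*) [Field K] : IntermediateField K (AlgebraicClosure K) :=
  sSup {L | FiniteDimensional K L ∧ IsTame K L}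

/-- Tameness is invariant under isomorphisms of extensions of number fields. -/
theorem IsTame.of_ringEquiv {K L L' : Type*} [Field K] [Field L] [Field L'] [NumberField K]
    [NumberField L] [NumberField L'] [Algebra K L] [Algebra K L'] (γ : K ≃+* K) (e : L ≃+* L')
    (h : ∀ x, e (algebraMap K L x) = algebraMap K L' (γ x)) (ht : IsTame K L) : IsTame K L' := by
  intro P hP hP0
  let E : 𝓞 L ≃+* 𝓞 L' := NumberField.RingOfIntegers.mapRingEquiv e
  let Γ : 𝓞 K ≃+* 𝓞 K := NumberField.RingOfIntegers.mapRingEquiv γ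
  have hEΓ : ∀ x, E (algebraMap (𝓞 K) (𝓞 L) x) = algebraMap (𝓞 K) (𝓞 L') (Γ x) := by
    intro x
    apply NumberField.RingOfIntegers.ext
    exact h x
  let Q : Ideal (𝓞 L) := P.comap (E : 𝓞 L →+* 𝓞 L')
  have hQ : Q.IsPrime := Ideal.comap_isPrime _ P
  have hmapQ : Q.map (E : 𝓞 L →+* 𝓞 L') = P := Ideal.map_comap_of_surjective _ E.surjective P
  have hQ0 : Q ≠ ⊥ := by
    intro h0
    apply hP0
    rw [← hmapQ, h0, Ideal.map_bot]
  have hdvd := ht Q hQ hQ0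
  have hchar : ringChar (𝓞 L ⧸ Q) = ringChar (𝓞 L' ⧸ P) := by
    have f : (𝓞 L ⧸ Q) ≃+* (𝓞 L' ⧸ P) := Ideal.quotientEquiv Q P E hmapQ.symm
    have : CharP (𝓞 L' ⧸ P) (ringChar (𝓞 L ⧸ Q)) :=
      charP_of_injective_ringHom (f := (f : (𝓞 L ⧸ Q) →+* (𝓞 L' ⧸ P))) f.injective _
    exact (ringChar.eq (𝓞 L' ⧸ P) (ringChar (𝓞 L ⧸ Q))).symm
  have hunderQ : Q.under (𝓞 K) ≠ ⊥ := Ideal.under_ne_bot _ hQ0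
  have hunderP : P.under (𝓞 K) ≠ ⊥ := Ideal.under_ne_bot _ hP0
  have hunder : (Q.under (𝓞 K)).map (Γ : 𝓞 K →+* 𝓞 K) = P.under (𝓞 K) := by
    ext x
    rw [show (Q.under (𝓞 K)).map (Γ : 𝓞 K →+* 𝓞 K) =
      (Q.under (𝓞 K)).comap (Γ.symm : 𝓞 K →+* 𝓞 K) from Ideal.map_comap_of_equiv Γ]
    simp only [Q, Ideal.under_def, Ideal.mem_comap]
    change E (algebraMap (𝓞 K) (𝓞 L) (Γ.symm x)) ∈ P ↔ _
    rw [hEΓ, RingEquiv.apply_symm_apply]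
  rw [← Ideal.ramificationIdx'_eq_ramificationIdx (Q.under (𝓞 K)) Q hunderQ] at hdvd
  rw [← Ideal.ramificationIdx'_eq_ramificationIdx (P.under (𝓞 K)) P hunderP, ← hchar]
  convert hdvd using 2
  unfold Ideal.ramificationIdx'
  congr 1
  ext n
  have hmm : (P.under (𝓞 K)).map (algebraMap (𝓞 K) (𝓞 L')) =
      ((Q.under (𝓞 K)).map (algebraMap (𝓞 K) (𝓞 L))).map (E : 𝓞 L →+* 𝓞 L') := by
    rw [← hunder, Ideal.map_map, Ideal.map_map]
    congr 1
    ext x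
    exact congrArg _ (hEΓ x).symm
  have hinj : ∀ I J : Ideal (𝓞 L),
      I.map (E : 𝓞 L →+* 𝓞 L') ≤ J.map (E : 𝓞 L →+* 𝓞 L') ↔ I ≤ J := fun I J =>
    ⟨fun hIJ => by
      have := Ideal.comap_mono (f := (E : 𝓞 L →+* 𝓞 L')) hIJ
      have hb : Function.Bijective (E : 𝓞 L →+* 𝓞 L') := E.bijective
      rwa [Ideal.comap_map_of_bijective _ hb, Ideal.comap_map_of_bijective _ hb] at this, fun hIJ => Ideal.map_mono hIJ⟩
  change (P.under (𝓞 K)).map (algebraMap (𝓞 K) (𝓞 L')) ≤ P ^ n ↔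
    (Q.under (𝓞 K)).map (algebraMap (𝓞 K) (𝓞 L)) ≤ Q ^ n
  rw [← hinj, hmm, Ideal.map_pow, hmapQ]

variable {k K : Type*} [Field k] [Field K] [Algebra k K] [IsGalois k K]

/-- The preimage of an intermediate field of `Kᶜ/K` under an automorphism of `Kᶜ/k`. -/
noncomputable def comapAut (σ : Gal((AlgebraicClosure K)/k)) (L : IntermediateField K (AlgebraicClosure K)) :
    IntermediateField K (AlgebraicClosure K) where
  __ := L.toSubfield.comap (σ : AlgebraicClosure K →+* AlgebraicClosure K)
  algebraMap_mem' x := by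
    change σ (algebraMap K _ x) ∈ L
    rw [← AlgEquiv.restrictNormal_commutes σ K x]
    exact L.algebraMap_mem _

theorem mem_comapAut {σ : Gal((AlgebraicClosure K)/k)}
    {L : IntermediateField K (AlgebraicClosure K)} {x : AlgebraicClosure K} :
    x ∈ comapAut σ L ↔ σ x ∈ L := Iff.rfl

/-- An automorphism of `Kᶜ/k` identifies `comapAut σ L` with `L`. -/
noncomputable def comapAutEquiv (σ : Gal((AlgebraicClosure K)/k))
    (L : IntermediateField K (AlgebraicClosure K)) : L ≃+* comapAut σ L where
  toFun x := ⟨σ.symm x, by rw [mem_comapAut, AlgEquiv.apply_symm_apply]; exact x.2⟩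
  invFun x := ⟨σ x, x.2⟩
  left_inv x := by ext; simp
  right_inv x := by ext; simp
  map_mul' x y := by ext; simp
  map_add' x y := by ext; simp

theorem comapAutEquiv_algebraMap (σ : Gal((AlgebraicClosure K)/k))
    (L : IntermediateField K (AlgebraicClosure K)) (x : K) :
    comapAutEquiv σ L (algebraMap K L x) =
      algebraMap K (comapAut σ L) ((AlgEquiv.restrictNormal σ.symm K : K ≃+* K) x) := by
  apply Subtype.ext
  exact (AlgEquiv.restrictNormal_commutes σ.symm K x).symm

theorem comapAut_finite_tame [NumberField K] (σ : Gal((AlgebraicClosure K)/k))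
    {L : IntermediateField K (AlgebraicClosure K)} (h : FiniteDimensional K L ∧ IsTame K L) :
    FiniteDimensional K (comapAut σ L) ∧ IsTame K (comapAut σ L) := by
  have h1 := h.1
  have hfin : FiniteDimensional K (comapAut σ L) := by
    refine Module.Finite.of_equiv_equiv (AlgEquiv.restrictNormal σ.symm K : K ≃+* K)
      (comapAutEquiv σ L) ?_
    ext x
    exact congrArg _ (comapAutEquiv_algebraMap σ L x).symm
  have : NumberField L := NumberField.of_module_finite K L
  have : NumberField (comapAut σ L) := NumberField.of_module_finite K _
  exact ⟨hfin, h.2.of_ringEquiv _ _ (comapAutEquiv_algebraMap σ L)⟩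

/-- `Kᵗ` is stable under the automorphisms of `Kᶜ` over `k`. -/
theorem apply_mem_tameClosure [NumberField K] (σ : Gal((AlgebraicClosure K)/k)) {x : AlgebraicClosure K}
    (hx : x ∈ tameClosure K) : σ x ∈ tameClosure K := by
  have : tameClosure K ≤ comapAut σ (tameClosure K) := by
    refine sSup_le fun L hL y hy => ?_
    have h2 : comapAut σ.symm L ≤ tameClosure K := le_sSup (comapAut_finite_tame σ.symm hL)
    refine h2 ?_
    rw [mem_comapAut]
    exact (AlgEquiv.symm_apply_apply σ y).symm ▸ hy
  exact this hx

instance [NumberField K] : Normal K (tameClosure K) := by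
  rw [IntermediateField.normal_iff_forall_map_le']
  rintro σ _ ⟨x, hx, rfl⟩
  exact apply_mem_tameClosure σ hx

instance [NumberField K] : Normal k (tameClosure K) := by
  have : Normal k ((tameClosure K).restrictScalars k) := by
    have : Normal k (AlgebraicClosure K) := by
      have : Algebra.IsAlgebraic k (AlgebraicClosure K) := Algebra.IsAlgebraic.trans k K _
      have : IsAlgClosure k (AlgebraicClosure K) := ⟨inferInstance, inferInstance⟩
      exact normal_iff.2 fun x => ⟨(Algebra.IsAlgebraic.isAlgebraic x).isIntegral, IsAlgClosed.splits _⟩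
    rw [IntermediateField.normal_iff_forall_map_le']
    rintro σ _ ⟨x, hx, rfl⟩
    exact apply_mem_tameClosure σ hx
  exact this

end Tame
section TopRow

variable (k K : Type*) [Field k] [Field K] [NumberField K] [Algebra k K] [IsGalois k K]

/-- The quotient map `Gal(Kᵗ/k) → Gal(K/k)`. -/
noncomputable def toSigma : Gal((tameClosure K)/k) →* Gal(K/k) :=
  AlgEquiv.restrictNormalHom K

/-- The inclusion `Gal(Kᵗ/K) → Gal(Kᵗ/k)`. -/
noncomputable def inclTame : Gal((tameClosure K)/K) →* Gal((tameClosure K)/k) :=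
  AlgEquiv.restrictScalarsHom k

variable {k K}

theorem toSigma_commutes (τ : Gal((tameClosure K)/k)) (x : K) :
    algebraMap K (tameClosure K) (toSigma k K τ x) = τ (algebraMap K (tameClosure K) x) :=
  AlgEquiv.restrictNormal_commutes τ K x

theorem toSigma_surjective : Function.Surjective (toSigma k K) :=
  AlgEquiv.restrictNormalHom_surjective _

theorem toSigma_inclTame (ω : Gal((tameClosure K)/K)) : toSigma k K (inclTame k K ω) = 1 := by
  ext x
  apply (algebraMap K (tameClosure K)).injective
  rw [toSigma_commutes]
  exact ω.commutes x

/-- An element of `Gal(Kᵗ/k)` with trivial image in `Gal(K/k)`, as an element of `Gal(Kᵗ/K)`. -/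
noncomputable def toGalTame (τ : Gal((tameClosure K)/k)) (hτ : toSigma k K τ = 1) :
    Gal((tameClosure K)/K) :=
  { τ with
    commutes' := fun x => by
      have := toSigma_commutes τ x
      rw [hτ] at this
      exact this.symm }

theorem inclTame_toGalTame (τ : Gal((tameClosure K)/k)) (hτ : toSigma k K τ = 1) :
    inclTame k K (toGalTame τ hτ) = τ := rfl

theorem inclTame_injective : Function.Injective (inclTame k K) :=
  AlgEquiv.restrictScalarsHom_injective k

variable (k K) in
/-- A choice of lifts `γ̄ ∈ Gal(Kᵗ/k)` of the elements `γ ∈ Gal(K/k)`, with `1̄ = 1`. -/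
structure Lifts where
  /-- The chosen lift. -/
  lift : Gal(K/k) → Gal((tameClosure K)/k)
  toSigma_lift : ∀ γ, toSigma k K (lift γ) = γ
  lift_one : lift 1 = 1

open Classical in
instance : Nonempty (Lifts k K) := by
  choose s hs using toSigma_surjective (k := k) (K := K)
  refine ⟨⟨fun γ => if γ = 1 then 1 else s γ, fun γ => ?_, by simp⟩⟩
  by_cases h : γ = 1 <;> simp [h, hs]

variable {G : Type*} [CommGroup G] [MulDistribMulAction Gal(K/k) G]

namespace Lifts

variable (s : Lifts k K)

/-- `γ̄ ω γ̄⁻¹` for `γ ∈ Gal(K/k)` and `ω ∈ Gal(Kᵗ/K)`. -/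
noncomputable def conj (γ : Gal(K/k)) (ω : Gal((tameClosure K)/K)) : Gal((tameClosure K)/K) :=
  toGalTame (s.lift γ * inclTame k K ω * (s.lift γ)⁻¹)
    (by rw [map_mul, map_mul, toSigma_inclTame, mul_one, map_inv, mul_inv_cancel])

/-- `γ̄ δ̄ (γδ)̄⁻¹` as an element of `Gal(Kᵗ/K)`. -/
noncomputable def defect (γ δ : Gal(K/k)) : Gal((tameClosure K)/K) :=
  toGalTame (s.lift γ * s.lift δ * (s.lift (γ * δ))⁻¹)
    (by rw [map_mul, map_mul, map_inv, s.toSigma_lift, s.toSigma_lift, s.toSigma_lift,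
      mul_inv_cancel])

variable [TopologicalSpace G] [IsTopologicalGroup G]

/-- The right action of `γ ∈ Gal(K/k)` on homomorphisms `h` from `Gal(Kᵗ/K)` to `G`:
`(h · γ)(ω) = γ⁻¹ · h(γ̄ ω γ̄⁻¹)`. -/
noncomputable def homAct (h : Gal((tameClosure K)/K) →ₜ* G) (γ : Gal(K/k)) :
    Gal((tameClosure K)/K) → G :=
  fun ω => γ⁻¹ • h (s.conj γ ω)

variable (G) in
/-- The group `Hom(Gal(Kᵗ/K), G)^Σ` of `Σ`-invariant continuous homomorphisms. -/
noncomputable def invHom : Subgroup (Gal((tameClosure K)/K) →ₜ* G) where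
  carrier := {h | ∀ γ, s.homAct h γ = h}
  one_mem' := fun γ => by ext ω; simp [homAct]
  mul_mem' := by
    intro a b ha hb γ
    ext ω
    have h1 := congrFun (ha γ) ω
    have h2 := congrFun (hb γ) ω
    simp only [homAct] at h1 h2 ⊢
    simp [smul_mul', h1, h2]
  inv_mem' := by
    intro a ha γ
    ext ω
    have h1 := congrFun (ha γ) ω
    simp only [homAct] at h1
    change γ⁻¹ • (a (s.conj γ ω))⁻¹ = (a ω)⁻¹
    rw [smul_inv', h1]

theorem isMulCocycle_transgression (h : s.invHom G) :
    groupCohomology.IsMulCocycle₂ fun p : Gal(K/k) × Gal(K/k) => h.1 (s.defect p.1 p.2) := by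
  intro γ δ ε
  have h1 := congrFun (h.2 γ) (s.defect δ ε)
  simp only [homAct] at h1
  have h2 : γ • h.1 (s.defect δ ε) = h.1 (s.conj γ (s.defect δ ε)) := by
    rw [← h1, smul_inv_smul]
  change h.1 (s.defect (γ * δ) ε) * h.1 (s.defect γ δ) =
    γ • h.1 (s.defect δ ε) * h.1 (s.defect γ (δ * ε))
  rw [h2, mul_comm, ← map_mul, ← map_mul]
  congr 1
  apply inclTame_injective (k := k)
  simp only [map_mul, conj, defect, inclTame_toGalTame]
  rw [mul_assoc γ δ ε]
  group

/-- The transgression map `tr(h) = [(γ, δ) ↦ h(γ̄ δ̄ (γδ)̄⁻¹)]`. -/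
noncomputable def tr (h : s.invHom G) : H2 Gal(K/k) G :=
  H2.mk (fun p => h.1 (s.defect p.1 p.2)) (s.isMulCocycle_transgression h)

end Lifts

variable (k K G)

/-- Continuous crossed homomorphisms `f : Gal(Kᵗ/k) → G`, where `Gal(Kᵗ/k)` acts on `G` through
its quotient `Gal(K/k)`. -/
def Z1 [TopologicalSpace G] [IsTopologicalGroup G] : Subgroup (Gal((tameClosure K)/k) → G) where
  carrier := {f | Continuous f ∧ ∀ σ τ, f (σ * τ) = toSigma k K σ • f τ * f σ}
  one_mem' := ⟨continuous_const, by simp⟩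
  mul_mem' := by
    rintro a b ⟨ha, ha'⟩ ⟨hb, hb'⟩
    refine ⟨ha.mul hb, fun σ τ => ?_⟩
    simp only [Pi.mul_apply, ha', hb', smul_mul']
    exact mul_mul_mul_comm _ _ _ _
  inv_mem' := by
    rintro a ⟨ha, ha'⟩
    refine ⟨ha.inv, fun σ τ => ?_⟩
    simp only [Pi.inv_apply, ha', smul_inv', mul_inv]

/-- Principal crossed homomorphisms `σ ↦ σ · x / x`. -/
def B1 : Subgroup (Gal((tameClosure K)/k) → G) where
  carrier := {f | ∃ x : G, ∀ σ, toSigma k K σ • x / x = f σ}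
  one_mem' := ⟨1, by simp⟩
  mul_mem' := by
    rintro a b ⟨x, hx⟩ ⟨y, hy⟩
    refine ⟨x * y, fun σ => ?_⟩
    simp only [Pi.mul_apply, ← hx, ← hy, smul_mul', mul_div_mul_comm]
  inv_mem' := by
    rintro a ⟨x, hx⟩
    refine ⟨x⁻¹, fun σ => ?_⟩
    simp only [Pi.inv_apply, ← hx, smul_inv', div_eq_mul_inv, mul_inv]

/-- The continuous cohomology group `H¹(Gal(Kᵗ/k), G)`. -/
abbrev H1 [TopologicalSpace G] [IsTopologicalGroup G] : Type _ :=
  Z1 k K G ⧸ (B1 k K G).subgroupOf (Z1 k K G)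

variable {k K G}

theorem continuous_inclTame : Continuous (inclTame k K) := by
  refine continuous_of_continuousAt_one _ ?_
  rw [ContinuousAt, map_one]
  intro U hU
  rw [Filter.mem_map]
  obtain ⟨E, hE, hEU⟩ := (krullTopology_mem_nhds_one_iff k (tameClosure K) U).1 hU
  let b := Module.finBasis k E
  have hst : ∀ i, (MulAction.stabilizer Gal((tameClosure K)/K) (b i : tameClosure K) :
      Set Gal((tameClosure K)/K)) ∈ nhds 1 := fun i =>
    (stabilizer_isOpen_of_isIntegral _).mem_nhds (one_mem _)
  filter_upwards [Filter.iInter_mem.2 hst] with ω hω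
  refine hEU ((IntermediateField.mem_fixingSubgroup_iff _ _).2 fun x hx => ?_)
  have hx' : x = ∑ i, b.repr ⟨x, hx⟩ i • (b i : tameClosure K) := by
    have := congrArg E.val (b.sum_repr ⟨x, hx⟩)
    rw [map_sum] at this
    exact this.symm
  rw [hx', map_sum]
  refine Finset.sum_congr rfl fun i _ => ?_
  refine (((inclTame k K ω : (tameClosure K) →ₐ[k] (tameClosure K)).toLinearMap).map_smul
    _ _).trans (congrArg _ ?_)
  exact Set.mem_iInter.1 hω i

namespace Lifts

variable [TopologicalSpace G] [IsTopologicalGroup G] (s : Lifts k K)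

/-- The restriction to `Gal(Kᵗ/K)` of a continuous crossed homomorphism on `Gal(Kᵗ/k)`. -/
noncomputable def restrictCocycle (f : Z1 k K G) : s.invHom G :=
  ⟨{ toFun := fun ω => f.1 (inclTame k K ω)
     map_one' := by
      have := f.2.2 1 1
      simpa using this
     map_mul' := fun ω ω' => by
      rw [map_mul, f.2.2, toSigma_inclTame, one_smul, mul_comm]
     continuous_toFun := f.2.1.comp continuous_inclTame }, fun γ => by
    have hcoc := f.2.2
    have h1 : f.1 1 = 1 := by simpa using hcoc 1 1
    ext ω
    change γ⁻¹ • f.1 (s.lift γ * inclTame k K ω * (s.lift γ)⁻¹) = f.1 (inclTame k K ω)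
    have h2 := hcoc (s.lift γ) (s.lift γ)⁻¹
    rw [mul_inv_cancel, h1, s.toSigma_lift] at h2
    rw [hcoc, hcoc (s.lift γ), map_mul, toSigma_inclTame, mul_one, s.toSigma_lift, mul_left_comm,
      ← h2, mul_one, inv_smul_smul]⟩

/-- The restriction map `H¹(Gal(Kᵗ/k), G) → Hom(Gal(Kᵗ/K), G)^Σ`. -/
noncomputable def res : H1 k K G → s.invHom G :=
  Quotient.lift s.restrictCocycle (by
    intro a b hab
    obtain ⟨x, hx⟩ := Subgroup.mem_subgroupOf.1 (QuotientGroup.leftRel_apply.1 hab)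
    apply Subtype.ext
    ext ω
    have := hx (inclTame k K ω)
    rw [toSigma_inclTame, one_smul, div_self'] at this
    exact (inv_mul_eq_one.1 this.symm))

end Lifts

end TopRow

section LocGen

open IsDedekindDomain

variable {O R X X' : Type*} [CommRing O] [CommRing R] [Algebra O R]
  [AddCommGroup X] [Module O X] [Module R X] [IsScalarTower O R X]
  [AddCommGroup X'] [Module O X'] [Module R X'] [IsScalarTower O R X']

variable (R) in
/-- `x` is a basis of the `R`-module `X` after inverting some `a ∉ P`. -/
def LocGen (P : Ideal O) (x : X) : Prop :=
  ∃ a : O, a ∉ P ∧ (∀ y : X, ∃ r : R, a • y = r • x) ∧ ∀ r : R, r • x = 0 → r = 0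

variable (O R X) in
/-- Local freeness of rank one at all nonzero primes of `O`, through `LocGen`. -/
def LocGenAll : Prop := ∀ v : HeightOneSpectrum O, ∃ x : X, LocGen R v.asIdeal x

theorem exists_mul_eq_of_sub_mem [Module.Finite O R] (P : Ideal O) [P.IsMaximal] {u : R} {a : O}
    (ha : a ∉ P) (h : u - algebraMap O R a ∈ P • (⊤ : Submodule O R)) :
    ∃ (w : R) (b : O), b ∉ P ∧ w * u = algebraMap O R b := by
  let N : Submodule O R := (Ideal.span {u}).restrictScalars O
  obtain ⟨c, i, hi, hc⟩ := (inferInstance : P.IsMaximal).exists_inv ha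
  have hle : (⊤ : Submodule O (R ⧸ N)) ≤ P • ⊤ := by
    intro n _
    obtain ⟨y, rfl⟩ := N.mkQ_surjective n
    have h1 : ∀ z ∈ P • (⊤ : Submodule O R), N.mkQ z ∈ P • (⊤ : Submodule O (R ⧸ N)) := by
      intro z hz
      have : Submodule.map N.mkQ (P • (⊤ : Submodule O R)) ≤ P • ⊤ := by
        rw [Submodule.map_smul'']
        exact Submodule.smul_mono le_rfl le_top
      exact this ⟨z, hz, rfl⟩
    have hmul : ∀ (t z : R), z ∈ P • (⊤ : Submodule O R) → t * z ∈ P • (⊤ : Submodule O R) := by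
      intro t z hz
      have : Submodule.map (LinearMap.mulLeft O t) (P • (⊤ : Submodule O R)) ≤ P • ⊤ := by
        rw [Submodule.map_smul'']
        exact Submodule.smul_mono le_rfl le_top
      exact this ⟨z, hz, rfl⟩
    have hy : y = c • (y * u) - c • (y * (u - algebraMap O R a)) + i • y := by
      simp only [Algebra.smul_def]
      have : algebraMap O R c * algebraMap O R a + algebraMap O R i = 1 := by
        rw [← map_mul, ← map_add, hc, map_one]
      linear_combination (-y) * this
    rw [hy, map_add, map_sub]
    refine add_mem (sub_mem ?_ ?_) ?_
    · have : N.mkQ (c • (y * u)) = 0 := by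
        have h0 : N.mkQ (y * u) = 0 := (Submodule.Quotient.mk_eq_zero N).2
          (Ideal.mul_mem_left _ _ (Ideal.mem_span_singleton_self u))
        rw [map_smul, h0, smul_zero]
      rw [this]
      exact zero_mem _
    · exact h1 _ (Submodule.smul_mem _ _ (hmul _ _ h))
    · exact h1 _ (Submodule.smul_mem_smul hi trivial)
  obtain ⟨b, hb, hb0⟩ := Submodule.exists_sub_one_mem_and_smul_eq_zero_of_fg_of_le_smul P
    (⊤ : Submodule O (R ⧸ N)) Module.Finite.fg_top hle
  have h2 : b • (1 : R) ∈ N := by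
    rw [← Submodule.Quotient.mk_eq_zero, Submodule.Quotient.mk_smul]
    exact hb0 _ trivial
  obtain ⟨w, hw⟩ := Ideal.mem_span_singleton'.1 h2
  refine ⟨w, b, fun hbP => ?_, by rw [hw, Algebra.smul_def, mul_one]⟩
  exact (Ideal.ne_top_iff_one P).1 (Ideal.IsMaximal.ne_top inferInstance)
    (by have := P.sub_mem hbP hb; simpa using this)

theorem LocGen.of_smul_eq [IsDomain O] [Module.Finite O R] [Module.IsTorsionFree O R]
    {P : Ideal O} [P.IsPrime] {x x' : X} (hx : LocGen R P x) {w : R} {b : O} (hb : b ∉ P)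
    (hw : w • x' = b • x) (hx' : ∃ (c : O) (r : R), c ≠ 0 ∧ c • x' = r • x ∧
      ∃ (d : O) (t : R), d ≠ 0 ∧ t * r = algebraMap O R d) : LocGen R P x' := by
  obtain ⟨a, ha, hgen, hinj⟩ := hx
  obtain ⟨c, r, hc, hcr, d, t, hd, htr⟩ := hx'
  refine ⟨b * a, fun h => ((inferInstance : P.IsPrime).mem_or_mem h).elim hb ha, fun y => ?_,
    fun s hs => ?_⟩
  · obtain ⟨q, hq⟩ := hgen y
    refine ⟨q * w, ?_⟩
    rw [mul_smul, hq, smul_comm, ← hw, smul_smul]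
  · have h1 : (s * r) • x = 0 := by
      rw [mul_smul, ← hcr, smul_comm, hs, smul_zero]
    have h2 := hinj _ h1
    have h3 : d • s = 0 := by
      rw [Algebra.smul_def, ← htr]
      linear_combination t * h2
    exact (smul_eq_zero.1 h3).resolve_left hd

section Dedekind

variable [IsDedekindDomain O] [Module.Finite O R] [Module.IsTorsionFree O R]

theorem LocGenAll.exists_of_ne_zero (hX : LocGenAll O R X) {a : O} (ha : a ≠ 0) :
    ∃ x : X, ∀ v : HeightOneSpectrum O, a ∈ v.asIdeal → LocGen R v.asIdeal x := by
  classical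
  choose g hg using hX
  have hfin : {v : HeightOneSpectrum O | a ∈ v.asIdeal}.Finite := by
    have := Ideal.finite_factors (I := Ideal.span {a}) (by simpa using ha)
    refine this.subset fun v hv => ?_
    simpa [Ideal.dvd_span_singleton] using hv
  let s := hfin.toFinset
  have hcrt : ∀ v ∈ s, ∃ e : O, e - 1 ∈ v.asIdeal ∧ ∀ w ∈ s, w ≠ v → e ∈ w.asIdeal := by
    intro v hv
    obtain ⟨e, he⟩ := IsDedekindDomain.exists_forall_sub_mem_ideal (s := s)
      (fun w : HeightOneSpectrum O => w.asIdeal) (fun _ => 1) (fun w _ => w.prime)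
      (fun w _ w' _ hne h => hne (HeightOneSpectrum.ext h))
      (fun w => if w.1 = v then 1 else 0)
    refine ⟨e, ?_, fun w hw hne => ?_⟩
    · simpa using he v hv
    · simpa [hne] using he w hw
  choose! e he1 he2 using hcrt
  refine ⟨∑ w ∈ s, e w • g w, fun v hv => ?_⟩
  have hvs : v ∈ s := hfin.mem_toFinset.2 hv
  obtain ⟨a', ha', hgen, hinj⟩ := hg v
  choose q hq using hgen
  let u : R := algebraMap O R (a' * e v) + ∑ w ∈ s.erase v, e w • q (g w)
  have hu : a' • (∑ w ∈ s, e w • g w) = u • g v := by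
    rw [← Finset.add_sum_erase s _ hvs, smul_add, add_smul, algebraMap_smul, smul_smul,
      Finset.smul_sum, Finset.sum_smul]
    congr 1
    refine Finset.sum_congr rfl fun w _ => ?_
    rw [smul_comm, hq, smul_assoc]
  have hae : a' * e v ∉ v.asIdeal := by
    intro h
    refine (v.isPrime.mem_or_mem h).elim ha' fun h' => ?_
    refine (Ideal.ne_top_iff_one _).1 v.isPrime.ne_top ?_
    have := v.asIdeal.sub_mem h' (he1 v hvs)
    simpa using this
  have := v.isMaximal
  obtain ⟨w, b, hb, hwu⟩ := exists_mul_eq_of_sub_mem (R := R) v.asIdeal (u := u) hae (by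
    simp only [u, add_sub_cancel_left]
    refine Submodule.sum_mem _ fun w hw => ?_
    exact Submodule.smul_mem_smul (he2 w (Finset.mem_of_mem_erase hw) v hvs
      (Finset.ne_of_mem_erase hw).symm) trivial)
  have ha0 : a' ≠ 0 := fun h => ha' (h ▸ zero_mem _)
  have hb0 : b ≠ 0 := fun h => hb (h ▸ zero_mem _)
  have := v.isPrime
  refine LocGen.of_smul_eq (w := w * algebraMap O R a') ⟨a', ha', fun y => ⟨_, hq y⟩, hinj⟩ hb ?_
    ⟨a', u, ha0, hu, b, w, hb0, hwu⟩
  rw [mul_smul, algebraMap_smul, hu, smul_smul, hwu, algebraMap_smul]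

theorem exists_sum_eq_one {ι : Type*} (c : ι → O) (h0 : ∃ i, c i ≠ 0)
    (h : ∀ v : HeightOneSpectrum O, ∃ i, c i ∉ v.asIdeal) :
    ∃ (s : Finset ι) (b : ι → O), ∑ i ∈ s, b i * c i = 1 := by
  have htop : Ideal.span (Set.range c) = ⊤ := by
    by_contra hne
    obtain ⟨M, hM, hle⟩ := Ideal.exists_le_maximal _ hne
    obtain ⟨i, hi⟩ := h0
    have hMi : ∀ i, c i ∈ M := fun i => hle (Ideal.subset_span ⟨i, rfl⟩)
    have hM0 : M ≠ ⊥ := by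
      rintro rfl
      exact hi (by simpa using hMi i)
    obtain ⟨j, hj⟩ := h ⟨M, hM.isPrime, hM0⟩
    exact hj (hMi j)
  have h1 : (1 : O) ∈ Ideal.span (Set.range c) := by rw [htop]; trivial
  obtain ⟨f, hf⟩ := (Finsupp.mem_ideal_span_range_iff_exists_finsupp).1 h1
  exact ⟨f.support, f, hf⟩

theorem LocGenAll.exists_dual [Nonempty (HeightOneSpectrum O)] (hX : LocGenAll O R X) :
    ∃ (s : Finset (HeightOneSpectrum O)) (x : HeightOneSpectrum O → X)
      (f : HeightOneSpectrum O → X →ₗ[R] R), ∀ y, ∑ i ∈ s, f i y • x i = y := by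
  choose g a ha hgen hinj using hX
  choose q hq using hgen
  have ha0 : ∀ v, a v ≠ 0 := fun v h => ha v (h ▸ zero_mem _)
  obtain ⟨s, b, hb⟩ := exists_sum_eq_one a (by
    obtain ⟨v⟩ := (inferInstance : Nonempty (HeightOneSpectrum O))
    exact ⟨v, ha0 v⟩) (fun v => ⟨v, ha v⟩)
  have hq' : ∀ v y r, a v • y = r • g v → q v y = r := by
    intro v y r h
    rw [← sub_eq_zero]
    apply hinj v
    rw [sub_smul, ← h, hq, sub_self]
  let f : HeightOneSpectrum O → X →ₗ[R] R := fun v =>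
    { toFun := fun y => b v • q v y
      map_add' := fun y z => by
        rw [← smul_add]
        congr 1
        apply hq'
        rw [smul_add, add_smul, hq, hq]
      map_smul' := fun r y => by
        rw [RingHom.id_apply, smul_comm r]
        congr 1
        apply hq'
        rw [smul_comm, hq, smul_smul, smul_eq_mul] }
  refine ⟨s, g, f, fun y => ?_⟩
  have : ∀ v, f v y • g v = (b v * a v) • y := fun v => by
    change (b v • q v y) • g v = _
    rw [smul_assoc, ← hq, smul_smul]
  simp only [this]
  rw [← Finset.sum_smul, hb, one_smul]

theorem LocGenAll.finite [Nonempty (HeightOneSpectrum O)] (hX : LocGenAll O R X) :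
    Module.Finite R X := by
  classical
  obtain ⟨s, x, f, h⟩ := hX.exists_dual
  refine ⟨⟨s.image x, eq_top_iff.2 fun y _ => ?_⟩⟩
  rw [← h y]
  refine Submodule.sum_mem _ fun i hi => Submodule.smul_mem _ _ (Submodule.subset_span ?_)
  exact Finset.mem_coe.2 (Finset.mem_image_of_mem x hi)

theorem LocGenAll.projective [Nonempty (HeightOneSpectrum O)] (hX : LocGenAll O R X) :
    Module.Projective R X := by
  obtain ⟨s, x, f, h⟩ := hX.exists_dual
  refine Module.Projective.of_split (M := s → R) (LinearMap.pi fun i => f i)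
    (∑ i : s, (LinearMap.proj i).smulRight (x i)) ?_
  ext y
  simp only [LinearMap.comp_apply, LinearMap.sum_apply, LinearMap.smulRight_apply,
    LinearMap.proj_apply, LinearMap.pi_apply, LinearMap.id_apply]
  rw [← h y]
  conv_rhs => rw [← Finset.sum_coe_sort]
  simp [h y]

theorem exists_splitEquiv {M N : Type*} [AddCommGroup M] [Module R M] [AddCommGroup N] [Module R N]
    [Module.Projective R N] (π : M →ₗ[R] N) (hπ : Function.Surjective π) :
    Nonempty (M ≃ₗ[R] N × LinearMap.ker π) := by
  obtain ⟨s, hs⟩ := Module.projective_lifting_property π LinearMap.id hπ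
  have hs' : ∀ n, π (s n) = n := fun n => LinearMap.congr_fun hs n
  exact ⟨{
    toFun := fun m => (π m, ⟨m - s (π m), by simp [hs']⟩)
    invFun := fun p => s p.1 + p.2.1
    map_add' := fun m m' => by ext <;> simp; abel
    map_smul' := fun r m => by ext <;> simp [smul_sub]
    left_inv := fun m => by simp
    right_inv := fun p => by
      have h := p.2.2
      rw [LinearMap.mem_ker] at h
      ext <;> simp [hs', h] }⟩

theorem LocGenAll.exists_add [Nonempty (HeightOneSpectrum O)] (hX : LocGenAll O R X)
    (hX' : LocGenAll O R X') : ∃ N : Submodule R (X × X'),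
      LocGenAll O R ((X × X') ⧸ N) ∧ Nonempty ((X × X') ≃ₗ[R] R × ((X × X') ⧸ N)) := by
  obtain ⟨v₀⟩ := (inferInstance : Nonempty (HeightOneSpectrum O))
  obtain ⟨x, a, ha, hgen, hinj⟩ := hX v₀
  have ha0 : a ≠ 0 := fun h => ha (h ▸ zero_mem _)
  obtain ⟨x', hx'⟩ := hX'.exists_of_ne_zero ha0
  let N : Submodule R (X × X') := Submodule.span R {(x, x')}
  have hN : ∀ p, p ∈ N ↔ ∃ r : R, r • (x, x') = p := fun p => Submodule.mem_span_singleton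
  have hQ : LocGenAll O R ((X × X') ⧸ N) := by
    intro v
    have hv := v.isPrime
    by_cases hav : a ∈ v.asIdeal
    · obtain ⟨b, hb, hgen', hinj'⟩ := hx' v hav
      obtain ⟨z, c, hc, hgenz, hinjz⟩ := hX v
      refine ⟨N.mkQ (z, 0), c * b, fun h => (hv.mem_or_mem h).elim hc hb, fun y => ?_,
        fun r hr => ?_⟩
      · obtain ⟨⟨y, y'⟩, rfl⟩ := N.mkQ_surjective y
        obtain ⟨r, hr⟩ := hgen' y'
        obtain ⟨t, ht⟩ := hgenz (b • y - r • x)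
        refine ⟨t, ?_⟩
        refine (Submodule.Quotient.eq N).2 ((hN _).2 ⟨algebraMap O R c * r, ?_⟩)
        ext
        · simp only [Prod.smul_fst, Prod.fst_sub, mul_smul, algebraMap_smul]
          rw [← ht, smul_sub]; abel
        · simp only [Prod.smul_snd, Prod.snd_sub, mul_smul, algebraMap_smul, ← hr, smul_zero,
            sub_zero]
      · obtain ⟨s, hs⟩ := (hN _).1 ((Submodule.Quotient.mk_eq_zero N).1 hr)
        have h2 : s = 0 := hinj' s (by simpa using congrArg Prod.snd hs)
        refine hinjz r ?_
        have h1 := congrArg Prod.fst hs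
        rw [h2] at h1
        simpa using h1.symm
    · obtain ⟨z, c, hc, hgenz, hinjz⟩ := hX' v
      refine ⟨N.mkQ (0, z), c * a, fun h => (hv.mem_or_mem h).elim hc hav, fun y => ?_,
        fun r hr => ?_⟩
      · obtain ⟨⟨y, y'⟩, rfl⟩ := N.mkQ_surjective y
        obtain ⟨r, hr⟩ := hgen y
        obtain ⟨t, ht⟩ := hgenz (a • y' - r • x')
        refine ⟨t, ?_⟩
        refine (Submodule.Quotient.eq N).2 ((hN _).2 ⟨algebraMap O R c * r, ?_⟩)
        ext
        · simp only [Prod.smul_fst, Prod.fst_sub, mul_smul, algebraMap_smul, ← hr, smul_zero,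
            sub_zero]
        · simp only [Prod.smul_snd, Prod.snd_sub, mul_smul, algebraMap_smul]
          rw [← ht, smul_sub]; abel
      · obtain ⟨s, hs⟩ := (hN _).1 ((Submodule.Quotient.mk_eq_zero N).1 hr)
        have h2 : s = 0 := hinj s (by simpa using congrArg Prod.fst hs)
        refine hinjz r ?_
        have h1 := congrArg Prod.snd hs
        rw [h2] at h1
        simpa using h1.symm
  have := hQ.projective
  obtain ⟨e⟩ := exists_splitEquiv N.mkQ N.mkQ_surjective
  have hker : LinearMap.ker N.mkQ = LinearMap.range (LinearMap.toSpanSingleton R _ (x, x')) := by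
    rw [Submodule.ker_mkQ, LinearMap.range_toSpanSingleton]
  have hinj2 : Function.Injective (LinearMap.toSpanSingleton R (X × X') (x, x')) := by
    rw [injective_iff_map_eq_zero]
    intro r hr
    exact hinj r (by simpa using congrArg Prod.fst hr)
  exact ⟨N, hQ, ⟨e.trans (((LinearEquiv.refl R _).prodCongr ((LinearEquiv.ofEq _ _ hker).trans
    (LinearEquiv.ofInjective _ hinj2).symm)).trans (LinearEquiv.prodComm R _ _))⟩⟩

theorem LocGenAll.exists_compl [Nonempty (HeightOneSpectrum O)] (hX : LocGenAll O R X) :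
    ∃ Y : Submodule R (R × R), LocGenAll O R Y ∧ Nonempty ((X × Y) ≃ₗ[R] R × R) := by
  obtain ⟨v₀⟩ := (inferInstance : Nonempty (HeightOneSpectrum O))
  obtain ⟨x, a, ha, hgen, hinj⟩ := hX v₀
  have ha0 : a ≠ 0 := fun h => ha (h ▸ zero_mem _)
  obtain ⟨x', hx'⟩ := hX.exists_of_ne_zero ha0
  let π : R × R →ₗ[R] X :=
    (LinearMap.toSpanSingleton R X x).coprod (LinearMap.toSpanSingleton R X x')
  have hπ' : ∀ r s, π (r, s) = r • x + s • x' := fun r s => by simp [π]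
  have hloc : ∀ v : HeightOneSpectrum O, ∃ b : O, b ∉ v.asIdeal ∧ ∀ y, ∃ p, π p = b • y := by
    intro v
    by_cases hav : a ∈ v.asIdeal
    · obtain ⟨b, hb, hgen', -⟩ := hx' v hav
      refine ⟨b, hb, fun y => ?_⟩
      obtain ⟨r, hr⟩ := hgen' y
      exact ⟨(0, r), by rw [hπ', hr, zero_smul, zero_add]⟩
    · refine ⟨a, hav, fun y => ?_⟩
      obtain ⟨r, hr⟩ := hgen y
      exact ⟨(r, 0), by rw [hπ', hr, zero_smul, add_zero]⟩
  have hsurj : Function.Surjective π := by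
    choose b hb hby using hloc
    obtain ⟨s, c, hc⟩ := exists_sum_eq_one b ⟨v₀, fun h => hb v₀ (h ▸ zero_mem _)⟩
      (fun v => ⟨v, hb v⟩)
    intro y
    choose p hp using fun v => hby v y
    refine ⟨∑ v ∈ s, algebraMap O R (c v) • p v, ?_⟩
    rw [map_sum]
    have hcp : ∀ v, π (algebraMap O R (c v) • p v) = (c v * b v) • y := fun v => by
      rw [map_smul, hp, algebraMap_smul, smul_smul]
    simp only [hcp]
    rw [← Finset.sum_smul, hc, one_smul]
  have hproj := hX.projective
  obtain ⟨e⟩ := exists_splitEquiv π hsurj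
  refine ⟨LinearMap.ker π, fun v => ?_, ⟨e.symm⟩⟩
  have hker : ∀ p : LinearMap.ker π, p.1.1 • x + p.1.2 • x' = 0 := fun p => by
    rw [← hπ']; exact p.2
  have hdom : ∀ (c : O) (r : R), c ≠ 0 → r * algebraMap O R c = 0 → r = 0 := fun c r hc h => by
    rw [mul_comm, ← Algebra.smul_def] at h
    exact (smul_eq_zero.1 h).resolve_left hc
  by_cases hav : a ∈ v.asIdeal
  · obtain ⟨b, hb, hgen', hinj'⟩ := hx' v hav
    have hb0 : b ≠ 0 := fun h => hb (h ▸ zero_mem _)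
    obtain ⟨t, ht⟩ := hgen' x
    refine ⟨⟨(algebraMap O R b, -t), by
      rw [LinearMap.mem_ker, hπ', neg_smul, algebraMap_smul, ht, add_neg_cancel]⟩, b, hb,
      fun y => ⟨y.1.1, ?_⟩, fun r hr => ?_⟩
    · have h1 : algebraMap O R b * y.1.2 + y.1.1 * t = 0 := by
        apply hinj'
        have := congrArg (fun z => b • z) (hker y)
        simp only [smul_add, smul_zero] at this
        rw [add_smul, mul_smul, mul_smul, ← ht, algebraMap_smul, smul_comm _ b x, add_comm]
        exact this
      ext
      · simp [Algebra.smul_def, mul_comm]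
      · change b • y.1.2 = y.1.1 * -t
        rw [Algebra.smul_def]
        linear_combination h1
    · have := congrArg (fun p => p.1.1) hr
      exact hdom b r hb0 (by simpa using this)
  · obtain ⟨t, ht⟩ := hgen x'
    refine ⟨⟨(-t, algebraMap O R a), by
      rw [LinearMap.mem_ker, hπ', neg_smul, algebraMap_smul, ht, neg_add_cancel]⟩, a, hav,
      fun y => ⟨y.1.2, ?_⟩, fun r hr => ?_⟩
    · have h1 : algebraMap O R a * y.1.1 + y.1.2 * t = 0 := by
        apply hinj
        have := congrArg (fun z => a • z) (hker y)
        simp only [smul_add, smul_zero] at this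
        rw [add_smul, mul_smul, mul_smul, ← ht, algebraMap_smul, smul_comm _ a x']
        exact this
      ext
      · change a • y.1.1 = y.1.2 * -t
        rw [Algebra.smul_def]
        linear_combination h1
      · simp [Algebra.smul_def, mul_comm]
    · have := congrArg (fun p => p.1.2) hr
      exact hdom a r ha0 (by simpa using this)

end Dedekind

end LocGen

section GroupRing

open IsDedekindDomain TensorProduct

/-- The group ring `𝓞_K G`. -/
def GroupRing (K G : Type*) [Field K] : Type _ := MonoidAlgebra (𝓞 K) G

variable (K G : Type*) [Field K] [CommGroup G]

namespace GroupRing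

noncomputable instance : CommRing (GroupRing K G) :=
  inferInstanceAs (CommRing (MonoidAlgebra (𝓞 K) G))

noncomputable instance : Algebra (𝓞 K) (GroupRing K G) :=
  inferInstanceAs (Algebra (𝓞 K) (MonoidAlgebra (𝓞 K) G))

instance : Module.Free (𝓞 K) (GroupRing K G) :=
  inferInstanceAs (Module.Free (𝓞 K) (MonoidAlgebra (𝓞 K) G))

instance [Finite G] : Module.Finite (𝓞 K) (GroupRing K G) :=
  inferInstanceAs (Module.Finite (𝓞 K) (MonoidAlgebra (𝓞 K) G))

instance : Module.IsTorsionFree (𝓞 K) (GroupRing K G) :=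
  inferInstanceAs (Module.IsTorsionFree (𝓞 K) (MonoidAlgebra (𝓞 K) G))

variable {K G} in
/-- The group ring element `a g`, for `a ∈ 𝓞_K` and `g ∈ G`. -/
noncomputable def single (g : G) (a : 𝓞 K) : GroupRing K G := MonoidAlgebra.single g a

variable {K G} in
theorem single_mul_single (g h : G) (a b : 𝓞 K) :
    (single g a * single h b : GroupRing K G) = single (g * h) (a * b) :=
  MonoidAlgebra.single_mul_single _ _ _ _

variable {K G} in
theorem single_eq_smul (g : G) (a : 𝓞 K) :
    (single g a : GroupRing K G) = a • (single g 1 : GroupRing K G) := by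
  have h : algebraMap (𝓞 K) (GroupRing K G) a = single 1 a := rfl
  rw [Algebra.smul_def, h, single_mul_single, one_mul, mul_one]

variable {K G} in
theorem induction {p : GroupRing K G → Prop} (r : GroupRing K G) (h0 : p 0)
    (hadd : ∀ r r', p r → p r' → p (r + r')) (hs : ∀ g a, p (single g a)) : p r :=
  MonoidAlgebra.induction_linear r h0 hadd hs

/-- The natural inclusion `G → (𝓞_K G)ˣ`. -/
noncomputable def ofUnits : G →* (GroupRing K G)ˣ := (MonoidAlgebra.of (𝓞 K) G).toHomUnits

variable {k : Type*} [Field k] [Algebra k K] [MulDistribMulAction Gal(K/k) G]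

/-- The ring endomorphism `∑ aₛ s ↦ ∑ γ(aₛ) γ(s)` of `𝓞_K G`, for `γ ∈ Gal(K/k)`. -/
noncomputable def sigmaHom (γ : Gal(K/k)) : GroupRing K G →+* GroupRing K G :=
  (MonoidAlgebra.mapDomainRingHom (𝓞 K) (MulDistribMulAction.toMonoidHom G γ)).comp
    (MonoidAlgebra.mapRingHom G (MulSemiringAction.toRingHom Gal(K/k) (𝓞 K) γ))

variable {K G}

theorem sigmaHom_single (γ : Gal(K/k)) (g : G) (a : 𝓞 K) :
    sigmaHom K G γ (single g a) = single (γ • g) (γ • a) := by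
  change MonoidAlgebra.mapDomain _ (MonoidAlgebra.map _ (MonoidAlgebra.single g a)) = _
  rw [MonoidAlgebra.map_single, MonoidAlgebra.mapDomain_single]
  rfl

theorem hom_ext {S : Type*} [Semiring S] {f g : GroupRing K G →+* S}
    (h : ∀ s a, f (single s a) = g (single s a)) : f = g :=
  MonoidAlgebra.ringHom_ext' (RingHom.ext fun a => h 1 a) (MonoidHom.ext fun s => h s 1)

/-- The `Σ`-ring structure on `𝓞_K G`, for `Σ = Gal(K/k)`. -/
noncomputable instance : MulSemiringAction Gal(K/k) (GroupRing K G) where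
  smul γ r := sigmaHom K G γ r
  one_smul r := by
    change sigmaHom K G 1 r = r
    have : sigmaHom K G (1 : Gal(K/k)) = RingHom.id _ := hom_ext fun s a => by
      rw [sigmaHom_single, one_smul, one_smul]; rfl
    rw [this]; rfl
  mul_smul γ δ r := by
    change sigmaHom K G (γ * δ) r = sigmaHom K G γ (sigmaHom K G δ r)
    have : sigmaHom K G (γ * δ) = (sigmaHom K G γ).comp (sigmaHom K G δ) := hom_ext fun s a => by
      rw [sigmaHom_single, RingHom.comp_apply, sigmaHom_single, sigmaHom_single, mul_smul, mul_smul]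
    rw [this]; rfl
  smul_zero γ := map_zero (sigmaHom K G γ)
  smul_add γ := map_add (sigmaHom K G γ)
  smul_one γ := map_one (sigmaHom K G γ)
  smul_mul γ := map_mul (sigmaHom K G γ)

theorem smul_single (γ : Gal(K/k)) (g : G) (a : 𝓞 K) :
    γ • (single g a : GroupRing K G) = single (γ • g) (γ • a) := sigmaHom_single γ g a

theorem smul_algebraMap (γ : Gal(K/k)) (a : 𝓞 K) :
    γ • algebraMap (𝓞 K) (GroupRing K G) a = algebraMap (𝓞 K) (GroupRing K G) (γ • a) := by
  have h : ∀ b : 𝓞 K, algebraMap (𝓞 K) (GroupRing K G) b = single 1 b := fun b => rfl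
  rw [h, h, smul_single, smul_one]

/-- The induced action of `Gal(K/k)` on `(𝓞_K G)ˣ`. -/
noncomputable instance : MulDistribMulAction Gal(K/k) (GroupRing K G)ˣ :=
  Units.mulDistribMulActionRight

theorem ofUnits_smul (γ : Gal(K/k)) (g : G) :
    ofUnits K G (γ • g) = γ • ofUnits K G g := by
  apply Units.ext
  change (single (γ • g) 1 : GroupRing K G) = γ • single g 1
  rw [smul_single, smul_one]

end GroupRing

variable (X : Type*) [AddCommGroup X] [Module (𝓞 K) X] [Module (GroupRing K G) X]
  [IsScalarTower (𝓞 K) (GroupRing K G) X]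

variable {K G} in
/-- The action of `g ∈ G` on an `𝓞_K G`-module, as an `𝓞_K`-linear map. -/
noncomputable def actionMap (g : G) : X →ₗ[𝓞 K] X :=
  Algebra.lsmul (𝓞 K) (𝓞 K) X (GroupRing.single g 1 : GroupRing K G)

/-- An `𝓞_K G`-module `X` is locally free of rank one if for every finite prime `v` of `K`, the
modules `𝓞_{K_v} ⊗ X` and `𝓞_{K_v} G` over `𝓞_{K_v} G` are isomorphic; that is, there is an
`𝓞_{K_v}`-linear isomorphism between them which commutes with the action of `G`. -/
def IsLocallyFree [NumberField K] : Prop :=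
  ∀ v : HeightOneSpectrum (𝓞 K), ∃ e : (v.adicCompletionIntegers K ⊗[𝓞 K] X)
      ≃ₗ[v.adicCompletionIntegers K] MonoidAlgebra (v.adicCompletionIntegers K) G,
    ∀ (g : G) (t : v.adicCompletionIntegers K ⊗[𝓞 K] X),
      e ((actionMap X g).lTensor (v.adicCompletionIntegers K) t) =
        MonoidAlgebra.single g 1 * e t

section Equivalence

variable {K} [NumberField K]

theorem isUnit_algebraMap_of_notMem (v : HeightOneSpectrum (𝓞 K)) {a : 𝓞 K} (ha : a ∉ v.asIdeal) :
    IsUnit (algebraMap (𝓞 K) (v.adicCompletionIntegers K) a) := by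
  rw [HeightOneSpectrum.adicCompletionIntegers.isUnit_iff_valued_eq_one]
  exact (HeightOneSpectrum.valuedAdicCompletion_eq_valuation v a).trans
    ((HeightOneSpectrum.valuation_eq_one_iff_notMem v).2 ha)

theorem exists_sub_mem_maximalIdeal (v : HeightOneSpectrum (𝓞 K)) (c : v.adicCompletionIntegers K) :
    ∃ a : 𝓞 K, c - algebraMap (𝓞 K) (v.adicCompletionIntegers K) a ∈
      IsLocalRing.maximalIdeal (v.adicCompletionIntegers K) := by
  have hval : ∀ z : v.adicCompletionIntegers K, z ∈ IsLocalRing.maximalIdeal _ ↔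
      Valued.v (z : v.adicCompletion K) < 1 := fun z => by
    rw [IsLocalRing.mem_maximalIdeal, mem_nonunits_iff,
      HeightOneSpectrum.adicCompletionIntegers.isUnit_iff_valued_eq_one]
    exact ⟨fun h => lt_of_le_of_ne z.2 h, fun h => h.ne⟩
  have hopen : IsOpen {y : v.adicCompletion K | Valued.v (y - c) < 1} := by
    have h1 := (Valued.isOpen_ball (v.adicCompletion K) 1).preimage
      (continuous_id.sub (continuous_const (y := (c : v.adicCompletion K))))
    simpa [Valuation.restrict_lt_one_iff] using h1
  obtain ⟨x, hx⟩ := (HeightOneSpectrum.denseRange_algebraMap (K := K) v).exists_mem_open hopen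
    ⟨c, by simp⟩
  change Valued.v (algebraMap K (v.adicCompletion K) x - c) < 1 at hx
  have hvx : ∀ y : K, Valued.v (algebraMap K (v.adicCompletion K) y) = v.valuation K y :=
    fun y => HeightOneSpectrum.valuedAdicCompletion_eq_valuation' v y
  have hx1 : v.valuation K x ≤ 1 := by
    rw [← hvx, ← sub_add_cancel (algebraMap K (v.adicCompletion K) x) c]
    exact (Valuation.map_add _ _ _).trans (max_le hx.le c.2)
  obtain ⟨a, ha⟩ := v.exists_valuation_sub_lt_of_integer hx1 1
  refine ⟨a, (hval _).2 ?_⟩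
  have h2 : (((c - algebraMap (𝓞 K) (v.adicCompletionIntegers K) a :
      v.adicCompletionIntegers K)) : v.adicCompletion K) =
      -((algebraMap K (v.adicCompletion K) x - c) +
        algebraMap K (v.adicCompletion K) (algebraMap (𝓞 K) K a - x)) := by
    rw [map_sub]
    change (c : v.adicCompletion K) - algebraMap K (v.adicCompletion K) (algebraMap (𝓞 K) K a) = _
    ring
  rw [h2, Valuation.map_neg]
  refine (Valuation.map_add _ _ _).trans_lt (max_lt hx ?_)
  rw [hvx]
  simpa using ha

theorem mem_of_algebraMap_mem_maximalIdeal (v : HeightOneSpectrum (𝓞 K)) {a : 𝓞 K}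
    (ha : algebraMap (𝓞 K) (v.adicCompletionIntegers K) a ∈ IsLocalRing.maximalIdeal _) :
    a ∈ v.asIdeal := by
  by_contra h
  exact (IsLocalRing.mem_maximalIdeal _).1 ha (isUnit_algebraMap_of_notMem v h)

variable {G X}

theorem exists_equiv_of_isUnit {A : Type*} [CommRing A] [Algebra (𝓞 K) A] {x : X} {a : 𝓞 K}
    (ha : IsUnit (algebraMap (𝓞 K) A a)) (hgen : ∀ y : X, ∃ r : GroupRing K G, a • y = r • x)
    (hinj : ∀ r : GroupRing K G, r • x = 0 → r = 0) :
    ∃ e : (A ⊗[𝓞 K] X) ≃ₗ[A] MonoidAlgebra A G, ∀ (g : G) (t : A ⊗[𝓞 K] X),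
      e ((actionMap X g).lTensor A t) = MonoidAlgebra.single g 1 * e t := by
  choose q hq using hgen
  have hq' : ∀ y r, a • y = r • x → q y = r := fun y r h => by
    rw [← sub_eq_zero]
    apply hinj
    rw [sub_smul, ← h, hq, sub_self]
  let f : GroupRing K G →ₗ[𝓞 K] X := (LinearMap.toSpanSingleton (GroupRing K G) X x).restrictScalars _
  let g : X →ₗ[𝓞 K] GroupRing K G :=
    { toFun := q
      map_add' := fun y z => hq' _ _ (by rw [smul_add, add_smul, hq, hq])
      map_smul' := fun b y => hq' _ _ (by rw [smul_comm, hq, smul_assoc]; rfl) }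
  have hgf : g ∘ₗ f = a • LinearMap.id := by
    ext r
    exact hq' _ _ (by change a • (r • x) = (a • r) • x; rw [smul_assoc])
  have hfg : f ∘ₗ g = a • LinearMap.id := by
    ext y
    exact (hq y).symm
  obtain ⟨u, hu⟩ := ha
  let F : A ⊗[𝓞 K] GroupRing K G ≃ₗ[A] A ⊗[𝓞 K] X :=
    LinearEquiv.ofBijective (f.baseChange A) (by
      have h1 : ∀ t, g.lTensor A (f.lTensor A t) = u • t := fun t => by
        rw [← LinearMap.comp_apply, ← LinearMap.lTensor_comp, hgf, LinearMap.lTensor_smul,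
          LinearMap.smul_apply, LinearMap.lTensor_id, LinearMap.id_apply, Units.smul_def, hu,
          algebraMap_smul]
      have h2 : ∀ t, f.lTensor A (g.lTensor A t) = u • t := fun t => by
        rw [← LinearMap.comp_apply, ← LinearMap.lTensor_comp, hfg, LinearMap.lTensor_smul,
          LinearMap.smul_apply, LinearMap.lTensor_id, LinearMap.id_apply, Units.smul_def, hu,
          algebraMap_smul]
      constructor
      · intro t t' htt
        have := congrArg (g.lTensor A) htt
        change g.lTensor A (f.lTensor A t) = g.lTensor A (f.lTensor A t') at this
        rw [h1, h1] at this
        exact smul_left_cancel u this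
      · intro t
        refine ⟨u⁻¹ • g.lTensor A t, ?_⟩
        rw [Units.smul_def, map_smul]
        change (↑u⁻¹ : A) • f.lTensor A (g.lTensor A t) = t
        rw [h2, ← Units.smul_def, inv_smul_smul])
  let E : A ⊗[𝓞 K] GroupRing K G ≃ₐ[A] MonoidAlgebra A G :=
    MonoidAlgebra.scalarTensorEquiv (𝓞 K) A
  refine ⟨F.symm.trans E.toLinearEquiv, fun s t => ?_⟩
  obtain ⟨t, rfl⟩ := F.surjective t
  have h3 : (actionMap X s).lTensor A (F t) = F ((1 : A) ⊗ₜ GroupRing.single s 1 * t) := by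
    induction t with
    | zero => simp
    | add t t' h h' => rw [map_add, map_add, h, h', mul_add, map_add]
    | tmul c r =>
      rw [Algebra.TensorProduct.tmul_mul_tmul, one_mul]
      exact congrArg (fun y => c ⊗ₜ[𝓞 K] y)
        (mul_smul (GroupRing.single s 1 : GroupRing K G) r x).symm
  rw [h3]
  simp only [LinearEquiv.trans_apply, LinearEquiv.symm_apply_apply]
  change E _ = _ * E t
  rw [map_mul]
  congr 1
  change MonoidAlgebra.scalarTensorEquiv (𝓞 K) A ((1 : A) ⊗ₜ MonoidAlgebra.single s 1) = _
  rw [MonoidAlgebra.scalarTensorEquiv_tmul]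
  simp

theorem LocGen.of_equiv [Finite G] [Module.Finite (𝓞 K) X] [Module.Projective (𝓞 K) X]
    {A : Type*} [CommRing A] [IsLocalRing A] [Algebra (𝓞 K) A] {P : Ideal (𝓞 K)} (hPtop : P ≠ ⊤)
    (hAinj : Function.Injective (algebraMap (𝓞 K) A))
    (hdense : ∀ c : A, ∃ a : 𝓞 K, c - algebraMap (𝓞 K) A a ∈ IsLocalRing.maximalIdeal A)
    (hP : ∀ a : 𝓞 K, algebraMap (𝓞 K) A a ∈ IsLocalRing.maximalIdeal A → a ∈ P)
    (e : (A ⊗[𝓞 K] X) ≃ₗ[A] MonoidAlgebra A G) (he : ∀ (g : G) (t : A ⊗[𝓞 K] X),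
      e ((actionMap X g).lTensor A t) = MonoidAlgebra.single g 1 * e t) :
    ∃ x : X, LocGen (GroupRing K G) P x := by
  let m := IsLocalRing.maximalIdeal A
  let ι : GroupRing K G →+* MonoidAlgebra A G := MonoidAlgebra.mapRingHom G (algebraMap (𝓞 K) A)
  have hι : ∀ s b, ι (GroupRing.single s b) = MonoidAlgebra.single s (algebraMap (𝓞 K) A b) :=
    fun s b => MonoidAlgebra.map_single _ _ _
  -- `e` is linear over `𝓞_K G`
  have heR : ∀ (r : GroupRing K G) (y : X), e (1 ⊗ₜ (r • y)) = ι r * e (1 ⊗ₜ y) := by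
    intro r y
    refine GroupRing.induction (p := fun r => e (1 ⊗ₜ (r • y)) = ι r * e (1 ⊗ₜ y)) r ?_
      (fun r r' h h' => ?_) fun s b => ?_
    · rw [zero_smul, TensorProduct.tmul_zero, map_zero, map_zero, zero_mul]
    · rw [add_smul, TensorProduct.tmul_add, map_add, map_add, add_mul, ← h, ← h']
    · have h2 := he s (1 ⊗ₜ y)
      rw [LinearMap.lTensor_tmul] at h2
      have h3 : (1 : A) ⊗ₜ[𝓞 K] (b • actionMap (K := K) X s y) =
          algebraMap (𝓞 K) A b • ((1 : A) ⊗ₜ[𝓞 K] actionMap (K := K) X s y) := by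
        rw [TensorProduct.smul_tmul', ← TensorProduct.smul_tmul, Algebra.smul_def, smul_eq_mul]
      rw [hι, GroupRing.single_eq_smul, smul_assoc]
      change e ((1 : A) ⊗ₜ[𝓞 K] (b • actionMap (K := K) X s y)) = _
      rw [h3, map_smul, h2, ← smul_mul_assoc, MonoidAlgebra.smul_single, smul_eq_mul, mul_one]
  have hιinj : Function.Injective ι := MonoidAlgebra.map_injective (algebraMap (𝓞 K) A : 𝓞 K →+ A) hAinj
  -- approximation of tensors
  have happ : ∀ t : A ⊗[𝓞 K] X, ∃ x : X, t - 1 ⊗ₜ x ∈ m • (⊤ : Submodule A (A ⊗[𝓞 K] X)) := by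
    intro t
    induction t with
    | zero => exact ⟨0, by simp⟩
    | add t t' h h' =>
      obtain ⟨x, hx⟩ := h
      obtain ⟨x', hx'⟩ := h'
      refine ⟨x + x', ?_⟩
      rw [TensorProduct.tmul_add, add_sub_add_comm]
      exact add_mem hx hx'
    | tmul c y =>
      obtain ⟨b, hb⟩ := hdense c
      refine ⟨b • y, ?_⟩
      have : c ⊗ₜ[𝓞 K] y - (1 : A) ⊗ₜ[𝓞 K] (b • y) =
          (c - algebraMap (𝓞 K) A b) • ((1 : A) ⊗ₜ[𝓞 K] y) := by
        rw [TensorProduct.smul_tmul', smul_eq_mul, mul_one, TensorProduct.sub_tmul,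
          ← TensorProduct.smul_tmul, Algebra.smul_def, mul_one]
      rw [this]
      exact Submodule.smul_mem_smul hb trivial
  have hemap : ∀ t ∈ m • (⊤ : Submodule A (A ⊗[𝓞 K] X)),
      e t ∈ m • (⊤ : Submodule A (MonoidAlgebra A G)) := by
    intro t ht
    have : Submodule.map e.toLinearMap (m • ⊤) ≤ m • (⊤ : Submodule A (MonoidAlgebra A G)) := by
      rw [Submodule.map_smul'']
      exact Submodule.smul_mono le_rfl le_top
    exact this ⟨t, ht, rfl⟩
  have hesymm : ∀ t ∈ m • (⊤ : Submodule A (MonoidAlgebra A G)),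
      e.symm t ∈ m • (⊤ : Submodule A (A ⊗[𝓞 K] X)) := by
    intro t ht
    have : Submodule.map e.symm.toLinearMap (m • ⊤) ≤ m • (⊤ : Submodule A (A ⊗[𝓞 K] X)) := by
      rw [Submodule.map_smul'']
      exact Submodule.smul_mono le_rfl le_top
    exact this ⟨t, ht, rfl⟩
  have hmid : ∀ (z t : MonoidAlgebra A G), t ∈ m • (⊤ : Submodule A (MonoidAlgebra A G)) →
      z * t ∈ m • (⊤ : Submodule A (MonoidAlgebra A G)) := by
    intro z t ht
    have : Submodule.map (LinearMap.mulLeft A z) (m • ⊤) ≤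
        m • (⊤ : Submodule A (MonoidAlgebra A G)) := by
      rw [Submodule.map_smul'']
      exact Submodule.smul_mono le_rfl le_top
    exact this ⟨t, ht, rfl⟩
  obtain ⟨x, hx⟩ := happ (e.symm 1)
  set u := e (1 ⊗ₜ x) with hudef
  have hu1 : u - algebraMap A _ 1 ∈ m • (⊤ : Submodule A (MonoidAlgebra A G)) := by
    have := hemap _ hx
    rw [map_sub, e.apply_symm_apply] at this
    rw [map_one, ← neg_sub]
    exact neg_mem this
  obtain ⟨w, b, hb, hwu⟩ := exists_mul_eq_of_sub_mem m
    (fun h1 => (Ideal.ne_top_iff_one m).1 (IsLocalRing.maximalIdeal.isMaximal A).ne_top h1) hu1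
  obtain ⟨b', hb'⟩ : IsUnit b := by
    by_contra hnu
    exact hb hnu
  have hu : (algebraMap A (MonoidAlgebra A G) ↑b'⁻¹ * w) * u = 1 := by
    rw [mul_assoc, hwu, ← hb', ← map_mul, Units.inv_mul, map_one]
  -- `ι` has dense image
  have hιapp : ∀ z : MonoidAlgebra A G, ∃ r : GroupRing K G,
      z - ι r ∈ m • (⊤ : Submodule A (MonoidAlgebra A G)) := by
    intro z
    induction z using MonoidAlgebra.induction_linear with
    | zero => exact ⟨0, by simp⟩
    | add z z' h h' =>
      obtain ⟨x, hx⟩ := h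
      obtain ⟨x', hx'⟩ := h'
      refine ⟨x + x', ?_⟩
      rw [map_add, add_sub_add_comm]
      exact add_mem hx hx'
    | single s c =>
      obtain ⟨b, hb⟩ := hdense c
      refine ⟨GroupRing.single s b, ?_⟩
      rw [hι, ← MonoidAlgebra.single_sub, ← mul_one (c - _), ← smul_eq_mul,
        ← MonoidAlgebra.smul_single]
      exact Submodule.smul_mem_smul hb trivial
  let N : Submodule (𝓞 K) X := (Submodule.span (GroupRing K G) {x}).restrictScalars (𝓞 K)
  have hle : (⊤ : Submodule (𝓞 K) (X ⧸ N)) ≤ P • ⊤ := by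
    intro n _
    obtain ⟨y, rfl⟩ := N.mkQ_surjective n
    obtain ⟨r, hr⟩ := hιapp (e (1 ⊗ₜ y) * (algebraMap A (MonoidAlgebra A G) ↑b'⁻¹ * w))
    have h1 : e (1 ⊗ₜ (y - r • x)) ∈ m • (⊤ : Submodule A (MonoidAlgebra A G)) := by
      have := hmid u _ hr
      rw [mul_sub, mul_comm u (_ * _), mul_assoc, hu, mul_one, mul_comm u] at this
      rwa [TensorProduct.tmul_sub, map_sub, heR]
    have h2 := hesymm _ h1
    rw [e.symm_apply_apply] at h2
    -- detect membership in `v X` through linear forms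
    have h3 : ∀ f : X →ₗ[𝓞 K] 𝓞 K, f (y - r • x) ∈ P := by
      intro f
      apply hP
      let F : A ⊗[𝓞 K] X →ₗ[A] A := (Algebra.TensorProduct.rid (𝓞 K) A A).toLinearMap ∘ₗ f.baseChange A
      have hF : ∀ t ∈ m • (⊤ : Submodule A (A ⊗[𝓞 K] X)), F t ∈ m := by
        intro t ht
        have : Submodule.map F (m • ⊤) ≤ m • (⊤ : Submodule A A) := by
          rw [Submodule.map_smul'']
          exact Submodule.smul_mono le_rfl le_top
        have := this ⟨t, ht, rfl⟩
        simpa using this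
      have := hF _ h2
      have hF1 : F ((1 : A) ⊗ₜ (y - r • x)) = algebraMap (𝓞 K) A (f (y - r • x)) := by
        change Algebra.TensorProduct.rid (𝓞 K) A A ((1 : A) ⊗ₜ f (y - r • x)) = _
        rw [Algebra.TensorProduct.rid_tmul, Algebra.smul_def, mul_one]
      rwa [hF1] at this
    obtain ⟨s, hs⟩ := (Module.projective_def' (R := 𝓞 K) (P := X)).1 inferInstance
    have h4 : y - r • x ∈ P • (⊤ : Submodule (𝓞 K) X) := by
      have h5 := LinearMap.congr_fun hs (y - r • x)
      rw [LinearMap.comp_apply, Finsupp.linearCombination_apply, LinearMap.id_apply] at h5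
      rw [← h5]
      refine Submodule.sum_mem _ fun i _ => Submodule.smul_mem_smul ?_ trivial
      exact h3 (Finsupp.lapply i ∘ₗ s)
    have h6 : N.mkQ y = N.mkQ (y - r • x) := by
      rw [map_sub, eq_comm, sub_eq_self]
      exact (Submodule.Quotient.mk_eq_zero N).2
        (Submodule.smul_mem (Submodule.span (GroupRing K G) {x}) r
          (Submodule.mem_span_singleton_self x))
    rw [h6]
    have : Submodule.map N.mkQ (P • (⊤ : Submodule (𝓞 K) X)) ≤ P • ⊤ := by
      rw [Submodule.map_smul'']
      exact Submodule.smul_mono le_rfl le_top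
    exact this ⟨_, h4, rfl⟩
  obtain ⟨c, hc, hc0⟩ := Submodule.exists_sub_one_mem_and_smul_eq_zero_of_fg_of_le_smul P
    (⊤ : Submodule (𝓞 K) (X ⧸ N)) Module.Finite.fg_top hle
  refine ⟨x, c, fun hcv => ?_, fun y => ?_, fun r hr => ?_⟩
  · exact (Ideal.ne_top_iff_one _).1 hPtop
      (by have := P.sub_mem hcv hc; simpa using this)
  · have h2 : c • y ∈ N := by
      rw [← Submodule.Quotient.mk_eq_zero, Submodule.Quotient.mk_smul]
      exact hc0 _ trivial
    obtain ⟨r, hr⟩ := Submodule.mem_span_singleton.1 h2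
    exact ⟨r, hr.symm⟩
  · apply hιinj
    have h1 := heR r x
    rw [hr, TensorProduct.tmul_zero, map_zero] at h1
    rw [map_zero, ← mul_one (ι r), ← hu, mul_left_comm, ← h1, mul_zero]

variable [Finite G]

theorem LocGenAll.isLocallyFree (h : LocGenAll (𝓞 K) (GroupRing K G) X) : IsLocallyFree K G X := by
  intro v
  obtain ⟨x, a, ha, hgen, hinj⟩ := h v
  exact exists_equiv_of_isUnit (isUnit_algebraMap_of_notMem v ha) hgen hinj

theorem IsLocallyFree.locGenAll [Module.Finite (𝓞 K) X] [Module.Projective (𝓞 K) X]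
    (h : IsLocallyFree K G X) : LocGenAll (𝓞 K) (GroupRing K G) X := by
  intro v
  obtain ⟨e, he⟩ := h v
  exact LocGen.of_equiv v.isPrime.ne_top (FaithfulSMul.algebraMap_injective _ _)
    (exists_sub_mem_maximalIdeal v) (fun _ => mem_of_algebraMap_mem_maximalIdeal v) e he

end Equivalence

end GroupRing

section Stable

variable {R M M' N N' P : Type*} [CommRing R] [AddCommGroup M] [Module R M] [AddCommGroup M']
  [Module R M'] [AddCommGroup N] [Module R N] [AddCommGroup P] [Module R P]

variable (R M M') in
/-- Two `R`-modules `M` and `M'` are stably isomorphic if `M ⊕ Rⁿ ≅ M' ⊕ Rⁿ` for some `n ≥ 1`. -/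
def StablyIso : Prop :=
  ∃ n : ℕ, 0 < n ∧ Nonempty ((M × (Fin n → R)) ≃ₗ[R] (M' × (Fin n → R)))

theorem nonempty_finAdd (n m : ℕ) :
    Nonempty ((Fin (n + m) → R) ≃ₗ[R] (Fin n → R) × (Fin m → R)) :=
  ⟨(LinearEquiv.funCongrLeft R R finSumFinEquiv).trans
    (LinearEquiv.sumArrowLequivProdArrow (Fin n) (Fin m) R R)⟩

theorem nonempty_prodRight : Nonempty (((M × N) × P) ≃ₗ[R] ((M × P) × N)) :=
  ⟨(LinearEquiv.prodAssoc R M N P).trans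
    (((LinearEquiv.refl R M).prodCongr (LinearEquiv.prodComm R N P)).trans
      (LinearEquiv.prodAssoc R M P N).symm)⟩

theorem StablyIso.of_equiv (e : M ≃ₗ[R] M') : StablyIso R M M' :=
  ⟨1, one_pos, ⟨e.prodCongr (LinearEquiv.refl R _)⟩⟩

theorem StablyIso.symm (h : StablyIso R M M') : StablyIso R M' M := by
  obtain ⟨n, hn, ⟨e⟩⟩ := h
  exact ⟨n, hn, ⟨e.symm⟩⟩

theorem StablyIso.trans (h : StablyIso R M M') (h' : StablyIso R M' N) : StablyIso R M N := by
  obtain ⟨n, hn, ⟨e⟩⟩ := h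
  obtain ⟨m, hm, ⟨e'⟩⟩ := h'
  obtain ⟨f⟩ := nonempty_finAdd (R := R) n m
  have e1 := ((LinearEquiv.refl R M).prodCongr f).trans (LinearEquiv.prodAssoc R M _ _).symm
  have e3 := ((LinearEquiv.refl R N).prodCongr f).trans (LinearEquiv.prodAssoc R N _ _).symm
  obtain ⟨p⟩ := nonempty_prodRight (R := R) (M := M') (N := Fin n → R) (P := Fin m → R)
  obtain ⟨p'⟩ := nonempty_prodRight (R := R) (M := N) (N := Fin m → R) (P := Fin n → R)
  exact ⟨n + m, by omega, ⟨e1.trans ((e.prodCongr (LinearEquiv.refl R _)).trans (p.trans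
    ((e'.prodCongr (LinearEquiv.refl R _)).trans (p'.trans e3.symm))))⟩⟩

theorem StablyIso.prod_right (h : StablyIso R M M') : StablyIso R (M × N) (M' × N) := by
  obtain ⟨n, hn, ⟨e⟩⟩ := h
  obtain ⟨p⟩ := nonempty_prodRight (R := R) (M := M) (N := N) (P := Fin n → R)
  obtain ⟨p'⟩ := nonempty_prodRight (R := R) (M := M') (N := N) (P := Fin n → R)
  exact ⟨n, hn, ⟨p.trans ((e.prodCongr (LinearEquiv.refl R _)).trans p'.symm)⟩⟩

theorem StablyIso.prod_left (h : StablyIso R M M') : StablyIso R (N × M) (N × M') :=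
  (StablyIso.of_equiv (LinearEquiv.prodComm R N M)).trans
    (h.prod_right.trans (StablyIso.of_equiv (LinearEquiv.prodComm R M' N)))

theorem nonempty_finSucc (n : ℕ) :
    Nonempty ((M × (Fin (n + 1) → R)) ≃ₗ[R] ((R × M) × (Fin n → R))) := by
  obtain ⟨f⟩ := nonempty_finAdd (R := R) n 1
  have g : (Fin (n + 1) → R) ≃ₗ[R] (Fin n → R) × R :=
    f.trans ((LinearEquiv.refl R _).prodCongr (LinearEquiv.funUnique (Fin 1) R R))
  obtain ⟨p⟩ := nonempty_prodRight (R := R) (M := M) (N := Fin n → R) (P := R)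
  exact ⟨((LinearEquiv.refl R M).prodCongr g).trans ((LinearEquiv.prodAssoc R M _ _).symm.trans
    (p.trans ((LinearEquiv.prodComm R M R).prodCongr (LinearEquiv.refl R _))))⟩

theorem StablyIso.cancel (h : StablyIso R (R × M) (R × M')) : StablyIso R M M' := by
  obtain ⟨n, hn, ⟨e⟩⟩ := h
  obtain ⟨c1⟩ := nonempty_finSucc (R := R) (M := M) n
  obtain ⟨c2⟩ := nonempty_finSucc (R := R) (M := M') n
  exact ⟨n + 1, by omega, ⟨c1.trans (e.trans c2.symm)⟩⟩

end Stable

section ClassGroup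

universe u v

open IsDedekindDomain

variable (K : Type u) (G : Type v) [Field K] [NumberField K] [CommGroup G]

/-- The locally free `𝓞_K G`-lattices of rank one: the `𝓞_K G`-modules which are finitely generated
and projective over `𝓞_K`, and locally free of rank one over `𝓞_K G`. -/
structure LFLattice where
  carrier : Type (max u v)
  [addCommGroup : AddCommGroup carrier]
  [moduleInt : Module (𝓞 K) carrier]
  [module : Module (GroupRing K G) carrier]
  [isScalarTower : IsScalarTower (𝓞 K) (GroupRing K G) carrier]
  finite : Module.Finite (𝓞 K) carrier
  projective : Module.Projective (𝓞 K) carrier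
  isLocallyFree : IsLocallyFree K G carrier

attribute [instance] LFLattice.addCommGroup LFLattice.moduleInt LFLattice.module
  LFLattice.isScalarTower LFLattice.finite LFLattice.projective

namespace LFLattice

variable {K G}

instance : CoeSort (LFLattice K G) (Type (max u v)) := ⟨LFLattice.carrier⟩

variable (K G) in
/-- Stable isomorphism of locally free lattices. -/
instance setoid : Setoid (LFLattice K G) where
  r X X' := StablyIso (GroupRing K G) X X'
  iseqv := ⟨fun X => StablyIso.of_equiv (LinearEquiv.refl _ X), fun h => h.symm,
    fun h h' => h.trans h'⟩

variable [Finite G]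

theorem locGenAll (X : LFLattice K G) : LocGenAll (𝓞 K) (GroupRing K G) X :=
  X.isLocallyFree.locGenAll

instance : Nonempty (HeightOneSpectrum (𝓞 K)) := by
  obtain ⟨M, hM⟩ := Ideal.exists_maximal (𝓞 K)
  exact ⟨⟨M, hM.isPrime, fun h => NumberField.RingOfIntegers.not_isField K
    (Ring.isField_iff_maximal_bot.2 (h ▸ hM))⟩⟩

/-- A module satisfying the elementary local criterion is a locally free lattice. -/
def ofLocGenAll (X : Type (max u v)) [AddCommGroup X] [Module (𝓞 K) X] [Module (GroupRing K G) X]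
    [IsScalarTower (𝓞 K) (GroupRing K G) X] (h : LocGenAll (𝓞 K) (GroupRing K G) X) :
    LFLattice K G where
  carrier := X
  finite := by
    have := h.finite
    exact Module.Finite.trans (GroupRing K G) X
  projective := by
    have := h.projective
    obtain ⟨i, hi⟩ := (Module.projective_def' (R := GroupRing K G) (P := X)).1 this
    exact Module.Projective.of_split (i.restrictScalars (𝓞 K))
      ((Finsupp.linearCombination (GroupRing K G) (id : X → X)).restrictScalars (𝓞 K))
      (LinearMap.ext fun y => LinearMap.congr_fun hi y)
  isLocallyFree := h.isLocallyFree

/-- The lattice `𝓞_K G`. -/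
noncomputable def unit : LFLattice K G := ofLocGenAll (GroupRing K G) fun v =>
  ⟨1, 1, fun h => v.isPrime.ne_top ((Ideal.eq_top_iff_one _).2 h),
    fun y => ⟨y, by rw [one_smul, smul_eq_mul, mul_one]⟩, fun r hr => by simpa using hr⟩

/-- The relation `X ⊕ X' ≅ 𝓞_K G ⊕ X''`. -/
def IsSum (X X' X'' : LFLattice K G) : Prop :=
  Nonempty ((X × X') ≃ₗ[GroupRing K G] (GroupRing K G × X''))

theorem exists_isSum (X X' : LFLattice K G) : ∃ X'', IsSum X X' X'' := by
  obtain ⟨N, hN, he⟩ := X.locGenAll.exists_add X'.locGenAll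
  exact ⟨ofLocGenAll _ hN, he⟩

theorem IsSum.congr {X X' Y Y' A B : LFLattice K G} (h : X ≈ Y) (h' : X' ≈ Y') (hA : IsSum X X' A)
    (hB : IsSum Y Y' B) : A ≈ B := by
  obtain ⟨e⟩ := hA
  obtain ⟨e'⟩ := hB
  have h1 : StablyIso (GroupRing K G) (X × X') (Y × Y') :=
    (StablyIso.prod_right h).trans (StablyIso.prod_left h')
  exact ((StablyIso.of_equiv e.symm).trans (h1.trans (StablyIso.of_equiv e'))).cancel

end LFLattice

/-- The locally free class group `Cl(𝓞_K G)`, whose elements are the stable isomorphism classes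
`[X]` of locally free `𝓞_K G`-lattices of rank one. -/
def ClassGp : Type _ := Quotient (LFLattice.setoid K G)

namespace ClassGp

variable {K G}

/-- The class `[X]` of a locally free lattice `X`. -/
def mk (X : LFLattice K G) : ClassGp K G := Quotient.mk _ X

theorem mk_eq_mk {X Y : LFLattice K G} :
    mk X = mk Y ↔ StablyIso (GroupRing K G) X Y := Quotient.eq

variable [Finite G]

/-- The product `[X][X'] = [X'']`, where `X ⊕ X' ≅ 𝓞_K G ⊕ X''`. -/
noncomputable instance : Mul (ClassGp K G) where
  mul := Quotient.lift₂ (fun X X' => mk (LFLattice.exists_isSum X X').choose)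
    fun X X' Y Y' h h' => Quotient.sound
      (LFLattice.IsSum.congr h h' (LFLattice.exists_isSum X X').choose_spec
        (LFLattice.exists_isSum Y Y').choose_spec)

theorem mk_mul_mk {X X' X'' : LFLattice K G} (h : LFLattice.IsSum X X' X'') :
    mk X * mk X' = mk X'' :=
  Quotient.sound (LFLattice.IsSum.congr (Setoid.refl X) (Setoid.refl X')
    (LFLattice.exists_isSum X X').choose_spec h)

noncomputable instance : One (ClassGp K G) := ⟨mk LFLattice.unit⟩

theorem mul_comm' (a b : ClassGp K G) : a * b = b * a := by
  obtain ⟨X, rfl⟩ := Quotient.exists_rep a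
  obtain ⟨Y, rfl⟩ := Quotient.exists_rep b
  obtain ⟨A, ⟨e⟩⟩ := LFLattice.exists_isSum X Y
  exact (mk_mul_mk ⟨e⟩).trans (mk_mul_mk ⟨(LinearEquiv.prodComm _ _ _).trans e⟩).symm

theorem one_mul' (a : ClassGp K G) : 1 * a = a := by
  obtain ⟨X, rfl⟩ := Quotient.exists_rep a
  exact mk_mul_mk (X := LFLattice.unit) (X' := X) ⟨LinearEquiv.refl _ _⟩

theorem exists_mul_eq_one (a : ClassGp K G) : ∃ b : ClassGp K G, b * a = 1 := by
  obtain ⟨X, rfl⟩ := Quotient.exists_rep a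
  obtain ⟨Y, hY, ⟨e⟩⟩ := X.locGenAll.exists_compl
  refine ⟨mk (LFLattice.ofLocGenAll Y hY), ?_⟩
  exact mk_mul_mk (X := LFLattice.ofLocGenAll Y hY) (X' := X) (X'' := LFLattice.unit)
    ⟨(LinearEquiv.prodComm _ _ _).trans e⟩

theorem mul_assoc' (a b c : ClassGp K G) : a * b * c = a * (b * c) := by
  obtain ⟨X, rfl⟩ := Quotient.exists_rep a
  obtain ⟨Y, rfl⟩ := Quotient.exists_rep b
  obtain ⟨Z, rfl⟩ := Quotient.exists_rep c
  obtain ⟨A, hA⟩ := LFLattice.exists_isSum X Y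
  obtain ⟨B, hB⟩ := LFLattice.exists_isSum A Z
  obtain ⟨C, hC⟩ := LFLattice.exists_isSum Y Z
  obtain ⟨D, hD⟩ := LFLattice.exists_isSum X C
  change mk X * mk Y * mk Z = mk X * (mk Y * mk Z)
  rw [mk_mul_mk hA, mk_mul_mk hB, mk_mul_mk hC, mk_mul_mk hD, mk_eq_mk]
  obtain ⟨eA⟩ := hA
  obtain ⟨eB⟩ := hB
  obtain ⟨eC⟩ := hC
  obtain ⟨eD⟩ := hD
  let R := GroupRing K G
  have e1 : ((X × Y) × Z) ≃ₗ[R] R × (R × B) :=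
    (eA.prodCongr (LinearEquiv.refl R Z)).trans ((LinearEquiv.prodAssoc R R A Z).trans
      ((LinearEquiv.refl R R).prodCongr eB))
  obtain ⟨p⟩ := nonempty_prodRight (R := R) (M := X) (N := R) (P := C)
  have e2 : (X × (Y × Z)) ≃ₗ[R] R × (R × D) :=
    ((LinearEquiv.refl R X).prodCongr eC).trans ((LinearEquiv.prodAssoc R X R C).symm.trans
      (p.trans ((eD.prodCongr (LinearEquiv.refl R R)).trans (LinearEquiv.prodComm R _ _))))
  exact ((StablyIso.of_equiv
    (e1.symm.trans ((LinearEquiv.prodAssoc R X Y Z).trans e2))).cancel).cancel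

noncomputable instance : CommGroup (ClassGp K G) where
  mul_assoc := mul_assoc'
  one_mul := one_mul'
  mul_one a := (mul_comm' a 1).trans (one_mul' a)
  inv a := (exists_mul_eq_one a).choose
  inv_mul_cancel a := (exists_mul_eq_one a).choose_spec
  mul_comm := mul_comm'

end ClassGp

end ClassGroup

section Semilinear

open IsDedekindDomain

variable {k K : Type*} (G : Type*) [Field k] [Field K] [Algebra k K] [CommGroup G]
  [MulDistribMulAction Gal(K/k) G]
  {X X' X'' Y Y' : Type*} [AddCommGroup X] [Module (GroupRing K G) X]
  [AddCommGroup X'] [Module (GroupRing K G) X'] [AddCommGroup X''] [Module (GroupRing K G) X'']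
  [AddCommGroup Y] [Module (GroupRing K G) Y] [AddCommGroup Y'] [Module (GroupRing K G) Y']

/-- The group isomorphism `φ : X → X'` of `𝓞_K G`-modules is a semilinear isomorphism having
`γ ∈ Gal(K/k)` as a grading. -/
def IsSemilinear (γ : Gal(K/k)) (φ : X ≃+ X') : Prop :=
  ∀ (β : GroupRing K G) (x : X), φ (β • x) = (γ • β) • φ x

/-- The `𝓞_K G`-module `X_γ`: the group `X` on which `β ∈ 𝓞_K G` acts as `γ⁻¹ · β`. -/
def Twist (_ : Gal(K/k)) (X : Type*) : Type _ := X

namespace Twist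

variable (γ : Gal(K/k))

instance : AddCommGroup (Twist γ X) := inferInstanceAs (AddCommGroup X)

instance [Module (𝓞 K) X] : Module (𝓞 K) (Twist γ X) :=
  Module.compHom X (MulSemiringAction.toRingHom Gal(K/k) (𝓞 K) γ⁻¹)

noncomputable instance : Module (GroupRing K G) (Twist γ X) :=
  Module.compHom X (MulSemiringAction.toRingHom Gal(K/k) (GroupRing K G) γ⁻¹)

/-- The identity map `X → X_γ`. -/
def of (X : Type*) [AddCommGroup X] : X ≃+ Twist γ X := AddEquiv.refl X

theorem isSemilinear_of : IsSemilinear G γ (of γ X) := fun β x => by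
  change β • x = (γ⁻¹ • γ • β) • x
  rw [inv_smul_smul]

instance [Module (𝓞 K) X] [IsScalarTower (𝓞 K) (GroupRing K G) X] :
    IsScalarTower (𝓞 K) (GroupRing K G) (Twist γ X) where
  smul_assoc a β x := by
    change (γ⁻¹ • (a • β)) • (show X from x) = (γ⁻¹ • a) • ((γ⁻¹ • β) • (show X from x))
    rw [Algebra.smul_def, smul_mul', GroupRing.smul_algebraMap, mul_smul, algebraMap_smul]

end Twist

variable {G}

namespace IsSemilinear

variable {γ δ : Gal(K/k)}

theorem trans {φ : X ≃+ X'} {ψ : X' ≃+ X''} (hφ : IsSemilinear G γ φ)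
    (hψ : IsSemilinear G δ ψ) : IsSemilinear G (δ * γ) (φ.trans ψ) := fun β x => by
  rw [AddEquiv.trans_apply, hφ, hψ, mul_smul]; rfl

theorem symm {φ : X ≃+ X'} (hφ : IsSemilinear G γ φ) : IsSemilinear G γ⁻¹ φ.symm := fun β x => by
  apply φ.injective
  rw [hφ, smul_inv_smul, AddEquiv.apply_symm_apply, AddEquiv.apply_symm_apply]

theorem prodCongr {φ : X ≃+ X'} {ψ : Y ≃+ Y'} (hφ : IsSemilinear G γ φ)
    (hψ : IsSemilinear G γ ψ) : IsSemilinear G γ (φ.prodCongr ψ) := fun β x =>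
  Prod.ext (hφ β x.1) (hψ β x.2)

/-- A semilinear isomorphism having the grading `1` is an `𝓞_K G`-isomorphism. -/
def toLinearEquiv {φ : X ≃+ X'} (hφ : IsSemilinear G (1 : Gal(K/k)) φ) :
    X ≃ₗ[GroupRing K G] X' :=
  { φ with
    map_smul' := fun β x => by
      have := hφ β x
      rw [one_smul] at this
      exact this }

theorem of_linearEquiv (e : X ≃ₗ[GroupRing K G] X') :
    IsSemilinear G (1 : Gal(K/k)) e.toAddEquiv := fun β x => by
  rw [one_smul]
  exact e.map_smul β x

theorem nonempty_linearEquiv {φ : X ≃+ Y} {ψ : X' ≃+ Y'} (hφ : IsSemilinear G γ φ)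
    (hψ : IsSemilinear G γ ψ) (e : X ≃ₗ[GroupRing K G] X') :
    Nonempty (Y ≃ₗ[GroupRing K G] Y') := by
  have h := (hφ.symm.trans (of_linearEquiv (k := k) e)).trans hψ
  rw [one_mul, mul_inv_cancel] at h
  exact ⟨h.toLinearEquiv⟩

theorem groupRing : IsSemilinear G γ
    (MulSemiringAction.toRingEquiv Gal(K/k) (GroupRing K G) γ).toAddEquiv :=
  fun β x => smul_mul' γ β x

theorem pi {ι : Type*} {φ : X ≃+ Y} (hφ : IsSemilinear G γ φ) :
    IsSemilinear G γ (AddEquiv.arrowCongr (Equiv.refl ι) φ) := fun β x =>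
  funext fun i => hφ β (x i)

theorem stablyIso {φ : X ≃+ Y} {ψ : X' ≃+ Y'} (hφ : IsSemilinear G γ φ)
    (hψ : IsSemilinear G γ ψ) (h : StablyIso (GroupRing K G) X X') :
    StablyIso (GroupRing K G) Y Y' := by
  obtain ⟨n, hn, ⟨e⟩⟩ := h
  exact ⟨n, hn, nonempty_linearEquiv (hφ.prodCongr groupRing.pi) (hψ.prodCongr groupRing.pi) e⟩

theorem locGenAll [Module (𝓞 K) X] [IsScalarTower (𝓞 K) (GroupRing K G) X] [Module (𝓞 K) Y]
    [IsScalarTower (𝓞 K) (GroupRing K G) Y] {φ : X ≃+ Y} (hφ : IsSemilinear G γ φ)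
    (h : LocGenAll (𝓞 K) (GroupRing K G) X) : LocGenAll (𝓞 K) (GroupRing K G) Y := by
  intro v
  let f : 𝓞 K ≃+* 𝓞 K := MulSemiringAction.toRingEquiv Gal(K/k) (𝓞 K) γ
  have hf : ∀ a, f a = γ • a := fun a => rfl
  let w : HeightOneSpectrum (𝓞 K) :=
    ⟨v.asIdeal.comap (f : 𝓞 K →+* 𝓞 K), Ideal.comap_isPrime _ _, fun h0 => v.ne_bot (by
      rw [← Ideal.map_comap_of_surjective (f : 𝓞 K →+* 𝓞 K) f.surjective v.asIdeal, h0,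
        Ideal.map_bot])⟩
  obtain ⟨x, a, ha, hgen, hinj⟩ := h w
  refine ⟨φ x, γ • a, ha, fun y => ?_, fun r hr => ?_⟩
  · obtain ⟨y, rfl⟩ := φ.surjective y
    obtain ⟨r, hr⟩ := hgen y
    refine ⟨γ • r, ?_⟩
    rw [← hφ, ← hr, ← algebraMap_smul (GroupRing K G) a y, hφ, GroupRing.smul_algebraMap,
      algebraMap_smul]
  · have h1 : φ ((γ⁻¹ • r) • x) = 0 := by rw [hφ, smul_inv_smul, hr]
    have h2 := hinj _ ((map_eq_zero_iff φ φ.injective).1 h1)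
    rw [← smul_inv_smul γ r, h2, smul_zero]

end IsSemilinear

end Semilinear

section SigmaAction

variable {k K G : Type*} [Field k] [Field K] [NumberField K] [Algebra k K] [CommGroup G] [Finite G]
  [MulDistribMulAction Gal(K/k) G]

/-- The lattice `X_γ`. -/
noncomputable def LFLattice.twist (γ : Gal(K/k)) (X : LFLattice K G) : LFLattice K G :=
  LFLattice.ofLocGenAll (Twist γ X) ((Twist.isSemilinear_of G γ).locGenAll X.locGenAll)

theorem LFLattice.isSemilinear_twist (γ : Gal(K/k)) (X : LFLattice K G) :
    ∃ φ : X ≃+ X.twist γ, IsSemilinear G γ φ := ⟨Twist.of γ X, Twist.isSemilinear_of G γ⟩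

namespace ClassGp

/-- The action of `Gal(K/k)` on `Cl(𝓞_K G)` given by `γ · [X] = [X_γ]`. -/
noncomputable instance : SMul Gal(K/k) (ClassGp K G) where
  smul γ := Quotient.map (LFLattice.twist γ) fun X X' h => by
    obtain ⟨φ, hφ⟩ := X.isSemilinear_twist γ
    obtain ⟨ψ, hψ⟩ := X'.isSemilinear_twist γ
    exact hφ.stablyIso hψ h

/-- If there is a semilinear isomorphism `X → Y` having `γ` as a grading, then `γ · [X] = [Y]`. -/
theorem smul_mk {γ : Gal(K/k)} {X Y : LFLattice K G} {φ : X ≃+ Y} (hφ : IsSemilinear G γ φ) :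
    γ • mk X = mk Y := by
  obtain ⟨ψ, hψ⟩ := X.isSemilinear_twist γ
  exact mk_eq_mk.2 (hψ.stablyIso hφ (StablyIso.of_equiv (LinearEquiv.refl _ X)))

theorem exists_smul_mk (γ : Gal(K/k)) (X : LFLattice K G) :
    ∃ (Y : LFLattice K G) (φ : X ≃+ Y), IsSemilinear G γ φ :=
  ⟨X.twist γ, X.isSemilinear_twist γ⟩

noncomputable instance : MulDistribMulAction Gal(K/k) (ClassGp K G) where
  one_smul c := by
    obtain ⟨X, rfl⟩ := Quotient.exists_rep c
    exact smul_mk (IsSemilinear.of_linearEquiv (LinearEquiv.refl _ X))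
  mul_smul γ δ c := by
    obtain ⟨X, rfl⟩ := Quotient.exists_rep c
    obtain ⟨Y, φ, hφ⟩ := exists_smul_mk δ X
    obtain ⟨Z, ψ, hψ⟩ := exists_smul_mk γ Y
    change (γ * δ) • mk X = γ • δ • mk X
    rw [smul_mk (hφ.trans hψ), smul_mk hφ, smul_mk hψ]
  smul_one γ := smul_mk (X := LFLattice.unit) (Y := LFLattice.unit) IsSemilinear.groupRing
  smul_mul γ c c' := by
    obtain ⟨X, rfl⟩ := Quotient.exists_rep c
    obtain ⟨X', rfl⟩ := Quotient.exists_rep c'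
    obtain ⟨X'', hX⟩ := LFLattice.exists_isSum X X'
    obtain ⟨Y, φ, hφ⟩ := exists_smul_mk γ X
    obtain ⟨Y', φ', hφ'⟩ := exists_smul_mk γ X'
    obtain ⟨Y'', φ'', hφ''⟩ := exists_smul_mk γ X''
    change γ • (mk X * mk X') = γ • mk X * γ • mk X'
    obtain ⟨e⟩ := hX
    rw [mk_mul_mk ⟨e⟩, smul_mk hφ, smul_mk hφ', smul_mk hφ'']
    exact (mk_mul_mk ((hφ.prodCongr hφ').nonempty_linearEquiv
      (IsSemilinear.groupRing.prodCongr hφ'') e)).symm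

end ClassGp

variable (k K G) in
/-- The group `Cl(𝓞_K G)^Σ` of `Σ`-invariant classes, for `Σ = Gal(K/k)`. -/
noncomputable abbrev InvClassGp : Subgroup (ClassGp K G) :=
  FixedPoints.subgroup Gal(K/k) (ClassGp K G)

/-- The family `d` is `d_X` for the semilinear automorphisms `φ_γ` of `X`, that is,
`d(γ, δ) · x = (φ_γ φ_δ φ_{γδ}⁻¹)(x)` for all `γ`, `δ` and `x`. -/
def IsDefect {X : Type*} [AddCommGroup X] [Module (GroupRing K G) X] (φ : Gal(K/k) → X ≃+ X)
    (d : Gal(K/k) × Gal(K/k) → (GroupRing K G)ˣ) : Prop :=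
  ∀ (γ δ : Gal(K/k)) (x : X),
    (d (γ, δ) : GroupRing K G) • x = φ γ (φ δ ((φ (γ * δ)).symm x))

/-- The relation `ξ(c) = z`: there are a lattice `X` with `c = [X]` and, for every `γ`, a semilinear
automorphism `φ_γ` of `X` having `γ` as a grading, such that `z = [d_X]`. -/
def IsXi (c : ClassGp K G) (z : H2 Gal(K/k) (GroupRing K G)ˣ) : Prop :=
  ∃ (X : LFLattice K G) (φ : Gal(K/k) → X ≃+ X) (d : Gal(K/k) × Gal(K/k) → (GroupRing K G)ˣ)
    (hd : groupCohomology.IsMulCocycle₂ d), ClassGp.mk X = c ∧ (∀ γ, IsSemilinear G γ (φ γ)) ∧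
      IsDefect φ d ∧ H2.mk d hd = z

open Classical in
/-- The map `ξ : Cl(𝓞_K G)^Σ → H²(Σ, (𝓞_K G)ˣ)`, `[X] ↦ [d_X]`. -/
noncomputable def xi (c : InvClassGp k K G) : H2 Gal(K/k) (GroupRing K G)ˣ :=
  if h : ∃ z, IsXi c.1 z then h.choose else 1

variable (k K G) in
/-- The map `i* : H²(Σ, G) → H²(Σ, (𝓞_K G)ˣ)` induced by the inclusion `G → (𝓞_K G)ˣ`. -/
noncomputable def iStar : H2 Gal(K/k) G → H2 Gal(K/k) (GroupRing K G)ˣ :=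
  H2.map (GroupRing.ofUnits K G) GroupRing.ofUnits_smul

end SigmaAction

section GaloisAlgebra

variable {K G : Type*} [Field K] [NumberField K] [CommGroup G] [TopologicalSpace G]

/-- The homomorphism `ω ↦ h(ω|_{Kᵗ})` from `Gal(Kᶜ/K)` to `G`. -/
noncomputable def inflate (h : Gal((tameClosure K)/K) →ₜ* G) : Gal((AlgebraicClosure K)/K) →* G :=
  (h : Gal((tameClosure K)/K) →* G).comp (AlgEquiv.restrictNormalHom (tameClosure K))

/-- The ring of integers `𝓞_h = Map_{Ω_K}(ʰG, 𝓞_{Kʰ})` of the Galois algebra `K_h`, where `Kʰ` is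
the fixed field of `ker h` in `Kᶜ`: the maps `a : G → 𝓞_{Kʰ}` with `a(h(ω)s) = ω(a(s))` for all
`ω ∈ Ω_K = Gal(Kᶜ/K)`. -/
noncomputable def IntegralMaps (h : Gal((tameClosure K)/K) →ₜ* G) :
    Submodule (𝓞 K) (G → AlgebraicClosure K) where
  carrier := {a | (∀ s, a s ∈ IntermediateField.fixedField (inflate h).ker ∧ IsIntegral ℤ (a s)) ∧
    ∀ (ω : Gal((AlgebraicClosure K)/K)) (s : G), a (inflate h ω * s) = ω (a s)}
  zero_mem' := ⟨fun s => ⟨zero_mem _, isIntegral_zero⟩, fun ω s => (map_zero ω).symm⟩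
  add_mem' := by
    rintro a b ⟨ha, ha'⟩ ⟨hb, hb'⟩
    refine ⟨fun s => ⟨add_mem (ha s).1 (hb s).1, (ha s).2.add (hb s).2⟩, fun ω s => ?_⟩
    rw [Pi.add_apply, Pi.add_apply, ha', hb', map_add]
  smul_mem' := by
    rintro c a ⟨ha, ha'⟩
    refine ⟨fun s => ?_, fun ω s => ?_⟩
    · rw [Pi.smul_apply, Algebra.smul_def]
      exact ⟨mul_mem (IntermediateField.algebraMap_mem _ (c : K)) (ha s).1,
        ((NumberField.RingOfIntegers.isIntegral_coe c).algebraMap).mul (ha s).2⟩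
    · rw [Pi.smul_apply, Pi.smul_apply, Algebra.smul_def, Algebra.smul_def, ha', map_mul]
      exact congrArg (· * ω (a s)) (ω.commutes (c : K)).symm

namespace IntegralMaps

variable (h : Gal((tameClosure K)/K) →ₜ* G)

/-- The action of `G` on `𝓞_h` given by `(s · a)(t) = a(ts)`. -/
noncomputable def translate : G →* Module.End (𝓞 K) (IntegralMaps h) where
  toFun s :=
    { toFun := fun a => ⟨fun t => a.1 (t * s), fun t => a.2.1 (t * s), fun ω t =>
        (congrArg a.1 (mul_assoc _ t s)).trans (a.2.2 ω (t * s))⟩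
      map_add' := fun _ _ => rfl
      map_smul' := fun _ _ => rfl }
  map_one' := by
    ext a t
    exact congrArg a.1 (mul_one t)
  map_mul' s s' := by
    ext a t
    exact congrArg a.1 (mul_assoc t s s').symm

/-- The `𝓞_K G`-module structure of `𝓞_h`. -/
noncomputable instance : Module (GroupRing K G) (IntegralMaps h) :=
  Module.compHom _ (MonoidAlgebra.lift (𝓞 K) (Module.End (𝓞 K) (IntegralMaps h)) G
    (translate h) : MonoidAlgebra (𝓞 K) G →+* Module.End (𝓞 K) (IntegralMaps h))

theorem single_smul (s : G) (c : 𝓞 K) (a : IntegralMaps h) :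
    (GroupRing.single s c : GroupRing K G) • a = c • translate h s a := by
  change (MonoidAlgebra.lift (𝓞 K) (Module.End (𝓞 K) (IntegralMaps h)) G (translate h))
    (MonoidAlgebra.single s c) a = _
  rw [MonoidAlgebra.lift_single]
  rfl

instance : IsScalarTower (𝓞 K) (GroupRing K G) (IntegralMaps h) where
  smul_assoc c r a := by
    change (MonoidAlgebra.lift (𝓞 K) (Module.End (𝓞 K) (IntegralMaps h)) G (translate h))
      (c • (show MonoidAlgebra (𝓞 K) G from r)) a = _
    rw [map_smul]
    rfl

/-- The assertion that `𝓞_h` is an `𝓞_K G`-lattice which is locally free of rank one. -/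
def IsLFLattice : Prop :=
  Module.Finite (𝓞 K) (IntegralMaps h) ∧ Module.Projective (𝓞 K) (IntegralMaps h) ∧
    IsLocallyFree K G (IntegralMaps h)

end IntegralMaps

open Classical in
/-- The map `gal`, which sends `h` to the class `cl(𝓞_h)` in `Cl(𝓞_K G)`. -/
noncomputable def gal [Finite G] (h : Gal((tameClosure K)/K) →ₜ* G) : ClassGp K G :=
  if H : IntegralMaps.IsLFLattice h then
    ClassGp.mk { carrier := IntegralMaps h, finite := H.1, projective := H.2.1,
                 isLocallyFree := H.2.2 }
  else 1

end GaloisAlgebra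

end BasicDiagram

/-! Write `R` for the ring 𝓞_K G and `Frac` for its total ring of fractions. A locally free lattice
`X` of rank one embeds in `Frac` as an invertible fractional ideal (`isUnit_ideal`), and a
semilinear map with grading γ becomes z ↦ u · γ(z) for a unique u in `Frac` (`exists_coef`,
`coef_unique`). An element of `Frac` that preserves an invertible ideal lies in `R`, so the
automorphisms of `X` are the multiplications by units of `R`; hence d_X exists and is unique. In
`Frac` it reads d_X(γ, δ) = u_γ · γ(u_δ) / u_{γδ}. This is a coboundary of units of `Frac`,
therefore a cocycle; its class over `R` can still be nontrivial because the u_γ need not lie in `R`.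

Classes are only stable isomorphism classes, and determinants bridge the gap. A linear map between
finite sums of lattices is a matrix over `Frac`, and its determinant carries the product of the
source ideals into the product of the target ideals. Cancelling the invertible contribution of the
free summands shows that stably isomorphic lattices are isomorphic
(`nonempty_linearEquiv_of_stablyIso`), so a lattice with invariant class has genuine semilinear
automorphisms. The same determinant compares the multipliers u on two decompositions of one sum: up
to a coboundary, the product of the defects depends only on the sum
(`exists_coboundary_of_linearEquiv`). Applied to X ≅ Y this makes ξ well defined, and applied to X ⊕
X' ≅ R ⊕ X'' it makes ξ multiplicative.

Exactness of the top row is a direct cocycle computation. If tr(h) is the coboundary of x, then n γ̄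
↦ h(n) x(γ) is a continuous crossed homomorphism that restricts to h.

Local freeness of 𝓞_h rests on Noether's theorem for the abelian extension Kʰ/K. A finite
subextension of the compositum Kᵗ is tame because, at each prime, a subgroup of inertia has index
prime to p exactly when it contains the wild inertia group, a condition stable under intersection.
Tameness yields an integer of trace one, which makes 𝓞_{Kʰ} projective over 𝓞_K[Gal(Kʰ/K)]; the
normal basis theorem makes the rank one; a projective module of rank one is free over the Artinian
reduction at v, and Nakayama's lemma lifts a generator. Finally 𝓞_h is induced from 𝓞_{Kʰ} along the
injection Gal(Kʰ/K) → G.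

For the square, extend each γ̄ to an automorphism σ of Kᶜ. Then φ_γ(a)(s) = σ(a(γ⁻¹ s)) is a
semilinear automorphism of 𝓞_h. The defect φ_γ φ_δ φ_{γδ}⁻¹ applies to all values some ω in Ω_K that
restricts to γ̄ δ̄ (γδ)̄⁻¹, and the equivariance defining 𝓞_h turns this into translation by h(γ̄ δ̄
(γδ)̄⁻¹). Thus the two sides of the square agree already as cocycles. -/

namespace BasicDiagram

/-! ### Products of submodules under semilinear maps and determinants. -/

section ProductsOfSubmodules

variable {R A ι : Type*} [CommRing R] [CommRing A] [Algebra R A] [Fintype ι]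

/-- A product of submodules is additively generated by products of elements, on which the maps x ↦ u
i · σ x multiply factor by factor. The condition on σ is what the empty product, the image of `R`,
requires. -/
theorem prod_mul_map_mem_prod (σ : A →+* A) (hσ : ∀ r, ∃ r', σ (algebraMap R A r) = algebraMap R A r')
    (u : ι → A) (I J : ι → Submodule R A)
    (h : ∀ i, ∀ x ∈ I i, u i * σ x ∈ J i) {x : A} (hx : x ∈ ∏ i, I i) :
    (∏ i, u i) * σ x ∈ ∏ i, J i := by
  classical
  suffices ∀ (s : Finset ι) (x : A), x ∈ ∏ i ∈ s, I i → (∏ i ∈ s, u i) * σ x ∈ ∏ i ∈ s, J i from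
    this _ x hx
  intro s
  induction s using Finset.induction_on with
  | empty =>
    intro x hx
    rw [Finset.prod_empty, Submodule.mem_one] at hx ⊢
    obtain ⟨r, rfl⟩ := hx
    obtain ⟨r', hr'⟩ := hσ r
    exact ⟨r', by rw [hr', Finset.prod_empty, one_mul]⟩
  | insert a s ha ih =>
    intro x hx
    rw [Finset.prod_insert ha] at hx ⊢
    rw [Finset.prod_insert ha]
    induction hx using Submodule.mul_induction_on' with
    | mem_mul_mem m hm n hn =>
      rw [map_mul, mul_mul_mul_comm]
      exact Submodule.mul_mem_mul (h a m hm) (ih n hn)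
    | add x _ y _ hx hy =>
      rw [map_add, mul_add]
      exact add_mem hx hy

/-- If the matrix `M` maps `⨁ I i` into `⨁ J i`, then `det M` maps `∏ I i` into `∏ J i`. -/
theorem det_mul_mem_prod [DecidableEq ι] (M : Matrix ι ι A) (I J : ι → Submodule R A)
    (h : ∀ j i, ∀ x ∈ I i, M j i * x ∈ J j) {x : A} (hx : x ∈ ∏ i, I i) :
    M.det * x ∈ ∏ i, J i := by
  rw [Matrix.det_apply', Finset.sum_mul]
  refine Submodule.sum_mem _ fun σ _ => ?_
  -- The Leibniz term of the permutation σ lands in the product of the `J (σ i)`, which is the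
  -- product of the `J i` after reindexing.
  have h1 := prod_mul_map_mem_prod (R := R) (RingHom.id A) (fun r => ⟨r, rfl⟩)
    (fun i => M (σ i) i) I
    (fun i => J (σ i)) (fun i => h (σ i) i) hx
  rw [Equiv.prod_comp σ J, RingHom.id_apply] at h1
  rw [mul_assoc]
  rcases Int.units_eq_one_or (Equiv.Perm.sign σ) with hs | hs
  · rw [hs]; simpa using h1
  · rw [hs]; simpa using h1

end ProductsOfSubmodules

/-! ### Lattices of rank one as invertible fractional ideals. -/

section FractionalIdeals

variable {k K G : Type*} [Field k] [Field K] [Algebra k K] [CommGroup G]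

namespace GroupRing

variable (K G) in
/-- The total ring of fractions of `𝓞_K G`. -/
abbrev Frac : Type _ := FractionRing (GroupRing K G)

theorem algebraMap_mem_nonZeroDivisors {a : 𝓞 K} (ha : a ≠ 0) :
    algebraMap (𝓞 K) (GroupRing K G) a ∈ nonZeroDivisors (GroupRing K G) := by
  rw [mem_nonZeroDivisors_iff_right]
  intro r hr
  rw [mul_comm, ← Algebra.smul_def] at hr
  exact (smul_eq_zero.1 hr).resolve_left ha

variable [MulDistribMulAction Gal(K/k) G]

variable (k K G) in
/-- The action of `Gal(K/k)` on the total ring of fractions of `𝓞_K G`. -/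
noncomputable def sigmaFrac : Gal(K/k) →* (Frac K G ≃+* Frac K G) :=
  (IsFractionRing.ringEquivOfRingEquivHom (GroupRing K G) (Frac K G)).comp
    (MulSemiringAction.toRingAut Gal(K/k) (GroupRing K G))

theorem sigmaFrac_algebraMap (γ : Gal(K/k)) (r : GroupRing K G) :
    sigmaFrac k K G γ (algebraMap (GroupRing K G) (Frac K G) r) =
      algebraMap (GroupRing K G) (Frac K G) (γ • r) :=
  IsFractionRing.ringEquivOfRingEquiv_algebraMap _ r

theorem algebraMap_frac_injective :
    Function.Injective (algebraMap (GroupRing K G) (Frac K G)) :=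
  IsFractionRing.injective _ _

end GroupRing

open GroupRing

variable [NumberField K] [Finite G]

namespace LFLattice

/-- A local generator `x` at a single finite prime suffices: a • y = q(y) • x defines q, which is
injective because `X` is torsion-free over 𝓞_K, and q(x) = a is a nonzero scalar. -/
theorem exists_linearMap_injective (X : LFLattice K G) :
    ∃ q : X →ₗ[GroupRing K G] GroupRing K G, Function.Injective q ∧
      ∃ (x : X) (a : 𝓞 K), a ≠ 0 ∧ q x = algebraMap (𝓞 K) (GroupRing K G) a := by
  obtain ⟨v⟩ := (inferInstance : Nonempty (IsDedekindDomain.HeightOneSpectrum (𝓞 K)))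
  obtain ⟨x, a, ha, hgen, hinj⟩ := X.locGenAll v
  have ha0 : a ≠ 0 := fun h => ha (h ▸ zero_mem _)
  choose q hq using hgen
  have hq' : ∀ y r, a • y = r • x → q y = r := by
    intro y r h
    rw [← sub_eq_zero]
    apply hinj
    rw [sub_smul, ← h, hq, sub_self]
  have : Module.IsTorsionFree (𝓞 K) X := inferInstance
  refine ⟨{ toFun := q, map_add' := fun y z => hq' _ _ ?_, map_smul' := fun r y => hq' _ _ ?_ },
    fun y z hyz => ?_, x, a, ha0, hq' _ _ ?_⟩
  · rw [smul_add, add_smul, hq, hq]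
  · rw [smul_comm, hq, RingHom.id_apply, smul_smul, smul_eq_mul]
  · have h1 : a • y = a • z := by
      rw [hq, hq]
      exact congrArg (· • x) hyz
    exact smul_right_injective X ha0 h1
  · rw [algebraMap_smul]

/-- An embedding of a locally free lattice of rank one into the total ring of fractions. -/
noncomputable def emb (X : LFLattice K G) : X →ₗ[GroupRing K G] Frac K G :=
  (Algebra.linearMap _ _).comp X.exists_linearMap_injective.choose

theorem emb_injective (X : LFLattice K G) : Function.Injective X.emb :=
  algebraMap_frac_injective.comp X.exists_linearMap_injective.choose_spec.1

theorem exists_emb_mem_nonZeroDivisors (X : LFLattice K G) :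
    ∃ x : X, ∃ r ∈ nonZeroDivisors (GroupRing K G), X.emb x = algebraMap _ _ r := by
  obtain ⟨-, x, a, ha, hx⟩ := X.exists_linearMap_injective.choose_spec
  exact ⟨x, _, algebraMap_mem_nonZeroDivisors ha, congrArg (algebraMap _ (Frac K G)) hx⟩

theorem exists_isUnit_emb (X : LFLattice K G) : ∃ x : X, IsUnit (X.emb x) := by
  obtain ⟨x, r, hr, hx⟩ := X.exists_emb_mem_nonZeroDivisors
  exact ⟨x, hx ▸ IsLocalization.map_units (Frac K G) (⟨r, hr⟩ : nonZeroDivisors _)⟩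

theorem exists_algebraMap_eq_emb (X : LFLattice K G) (x : X) :
    ∃ r : GroupRing K G, X.emb x = algebraMap _ _ r := ⟨_, rfl⟩

/-- The fractional ideal which is the image of the embedding of a lattice. -/
noncomputable def ideal (X : LFLattice K G) : Submodule (GroupRing K G) (Frac K G) :=
  LinearMap.range X.emb

theorem emb_mem_ideal (X : LFLattice K G) (x : X) : X.emb x ∈ X.ideal := ⟨x, rfl⟩

/-- A rank-one argument: if `x₀` and `x` embed as `r₀` and `r`, then r₀ • x = r • x₀, so τ(r₀) F(x)
= τ(r) F(x₀), and τ(r₀) can be inverted. Taking for τ the inclusion, or the inclusion followed by γ,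
covers linear and semilinear maps together. -/
theorem exists_coef_of_map_smul (X : LFLattice K G) (τ : GroupRing K G →+* Frac K G)
    (hτ : ∀ r ∈ nonZeroDivisors (GroupRing K G), IsUnit (τ r)) (F : X → Frac K G)
    (hF : ∀ (r : GroupRing K G) (x : X), F (r • x) = τ r * F x) :
    ∃ c : Frac K G, ∀ x r, X.emb x = algebraMap _ _ r → F x = c * τ r := by
  obtain ⟨x₀, r₀, hr₀, hx₀⟩ := X.exists_emb_mem_nonZeroDivisors
  obtain ⟨u, hu⟩ := hτ r₀ hr₀
  refine ⟨F x₀ * ↑u⁻¹, fun x r hr => ?_⟩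
  have h1 : r₀ • x = r • x₀ := by
    apply X.emb_injective
    rw [map_smul, map_smul, hr, hx₀, Algebra.smul_def, Algebra.smul_def, mul_comm]
  have h2 := congrArg F h1
  rw [hF, hF, ← hu] at h2
  rw [mul_right_comm, mul_comm (F x₀), ← h2]
  rw [mul_right_comm, Units.mul_inv, one_mul]

theorem exists_coef_linear (X : LFLattice K G) (f : X →ₗ[GroupRing K G] Frac K G) :
    ∃ c : Frac K G, ∀ x, f x = c * X.emb x := by
  obtain ⟨c, hc⟩ := X.exists_coef_of_map_smul (algebraMap _ _)
    (fun r hr => IsLocalization.map_units (Frac K G) (⟨r, hr⟩ : nonZeroDivisors _)) f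
    fun r x => by rw [map_smul, Algebra.smul_def]
  refine ⟨c, fun x => ?_⟩
  obtain ⟨r, hr⟩ := X.exists_algebraMap_eq_emb x
  rw [hc x r hr, hr]

theorem coef_linear_unique (X : LFLattice K G) {c c' : Frac K G}
    (h : ∀ x : X, c * X.emb x = c' * X.emb x) : c = c' := by
  obtain ⟨x₀, hx₀⟩ := X.exists_isUnit_emb
  exact hx₀.mul_left_injective (h x₀)

/-- The linear forms of a finite dual basis are multiplications by elements `c i` of `Frac`. These
span the inverse ideal, and the dual basis identity becomes ∑ emb(x i) · c i = 1. -/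
theorem isUnit_ideal (X : LFLattice K G) : IsUnit X.ideal := by
  obtain ⟨s, x, f, h⟩ := X.locGenAll.exists_dual
  choose c hc using fun i => X.exists_coef_linear ((Algebra.linearMap _ (Frac K G)).comp (f i))
  refine IsUnit.of_mul_eq_one (Submodule.span _ (c '' s)) (le_antisymm ?_ ?_)
  · rw [Submodule.mul_le]
    rintro _ ⟨y, rfl⟩ n hn
    rw [mul_comm]
    induction hn using Submodule.span_induction with
    | mem z hz =>
      obtain ⟨i, -, rfl⟩ := hz
      rw [← hc]
      exact Submodule.algebraMap_mem _
    | zero => simp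
    | add a b _ _ ha hb => rw [add_mul]; exact add_mem ha hb
    | smul r a _ ha => rw [smul_mul_assoc]; exact Submodule.smul_mem _ _ ha
  · rw [Submodule.one_le]
    have h1 : ∑ i ∈ s, X.emb (x i) * c i = 1 := by
      refine X.coef_linear_unique fun y => ?_
      rw [one_mul]
      conv_rhs => rw [← h y]
      rw [map_sum, Finset.sum_mul]
      refine Finset.sum_congr rfl fun i _ => ?_
      rw [map_smul, Algebra.smul_def, mul_assoc, ← hc, mul_comm]
      rfl
    rw [← h1]
    exact Submodule.sum_mem _ fun i hi => Submodule.mul_mem_mul (X.emb_mem_ideal _)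
      (Submodule.subset_span ⟨i, hi, rfl⟩)

variable [MulDistribMulAction Gal(K/k) G]

theorem isUnit_sigmaFrac (γ : Gal(K/k)) {r : GroupRing K G}
    (hr : r ∈ nonZeroDivisors (GroupRing K G)) :
    IsUnit (sigmaFrac k K G γ (algebraMap _ _ r)) :=
  (IsLocalization.map_units (Frac K G) (⟨r, hr⟩ : nonZeroDivisors _)).map _

/-- A semilinear map between lattices is given by multiplication on fractional ideals. -/
theorem exists_coef {X Y : LFLattice K G} (γ : Gal(K/k)) (f : X → Y)
    (hf : ∀ (β : GroupRing K G) (x : X), f (β • x) = (γ • β) • f x) :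
    ∃ c : Frac K G, ∀ x, Y.emb (f x) = c * sigmaFrac k K G γ (X.emb x) := by
  obtain ⟨c, hc⟩ := X.exists_coef_of_map_smul
    ((sigmaFrac k K G γ : Frac K G →+* Frac K G).comp (algebraMap _ _))
    (fun r hr => isUnit_sigmaFrac γ hr) (fun x => Y.emb (f x)) fun r x => by
      rw [hf, map_smul, Algebra.smul_def, ← sigmaFrac_algebraMap]
      rfl
  refine ⟨c, fun x => ?_⟩
  obtain ⟨r, hr⟩ := X.exists_algebraMap_eq_emb x
  rw [hc x r hr, hr]
  rfl

theorem coef_unique {X : LFLattice K G} (γ : Gal(K/k)) {c c' : Frac K G}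
    (h : ∀ x : X, c * sigmaFrac k K G γ (X.emb x) = c' * sigmaFrac k K G γ (X.emb x)) :
    c = c' := by
  obtain ⟨x₀, hx₀⟩ := X.exists_isUnit_emb
  exact (hx₀.map (sigmaFrac k K G γ)).mul_left_injective (h x₀)

/-- A semilinear isomorphism of lattices is given by multiplication with a unit. -/
theorem exists_unit_coef {X Y : LFLattice K G} {γ : Gal(K/k)} {φ : X ≃+ Y}
    (hφ : IsSemilinear G γ φ) :
    ∃ u : (Frac K G)ˣ, (∀ x, Y.emb (φ x) = u * sigmaFrac k K G γ (X.emb x)) ∧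
      ∀ z, z ∈ X.ideal ↔ u * sigmaFrac k K G γ z ∈ Y.ideal := by
  obtain ⟨c, hc⟩ := exists_coef γ φ hφ
  obtain ⟨c', hc'⟩ := exists_coef γ⁻¹ φ.symm hφ.symm
  have hinv : ∀ z, sigmaFrac k K G γ (sigmaFrac k K G γ⁻¹ z) = z := fun z => by
    rw [← RingAut.mul_apply, ← map_mul, mul_inv_cancel, map_one]; rfl
  have h1 : c * sigmaFrac k K G γ c' = 1 := by
    obtain ⟨y, hy⟩ := Y.exists_isUnit_emb
    have := hc (φ.symm y)
    rw [hc', map_mul, hinv, φ.apply_symm_apply, ← mul_assoc] at this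
    exact hy.mul_left_injective (by simpa using this.symm)
  refine ⟨⟨c, _, h1, (mul_comm _ _).trans h1⟩, hc, fun z => ⟨?_, ?_⟩⟩
  · rintro ⟨x, rfl⟩
    exact ⟨φ x, hc x⟩
  · rintro ⟨y, hy⟩
    obtain ⟨x, rfl⟩ := φ.surjective y
    rw [hc] at hy
    refine ⟨x, (sigmaFrac k K G γ).injective ?_⟩
    exact (Units.isUnit ⟨c, _, h1, (mul_comm _ _).trans h1⟩).mul_right_injective hy

end LFLattice

end FractionalIdeals

/-! ### Determinants of maps between sums of lattices, and cancellation. -/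

section Determinant

variable {k K G : Type*} [Field k] [Field K] [NumberField K] [Algebra k K] [CommGroup G] [Finite G]
  {ι : Type*} [Fintype ι] [DecidableEq ι] {X Y Z : ι → LFLattice K G}

open GroupRing

namespace LFLattice

theorem exists_matrix_entry (f : (∀ i, X i) →ₗ[GroupRing K G] (∀ i, Y i)) (j i : ι) :
    ∃ c : Frac K G, ∀ x : X i, (Y j).emb (f (Pi.single i x) j) = c * (X i).emb x :=
  (X i).exists_coef_linear ((Y j).emb ∘ₗ LinearMap.proj j ∘ₗ f ∘ₗ
    LinearMap.single (GroupRing K G) (fun i => X i) i)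

/-- The matrix over the total ring of fractions of a linear map between sums of lattices. -/
noncomputable def toMatrix (f : (∀ i, X i) →ₗ[GroupRing K G] (∀ i, Y i)) :
    Matrix ι ι (Frac K G) := fun j i => (exists_matrix_entry f j i).choose

theorem toMatrix_mul_emb (f : (∀ i, X i) →ₗ[GroupRing K G] (∀ i, Y i)) (j i : ι) (x : X i) :
    toMatrix f j i * (X i).emb x = (Y j).emb (f (Pi.single i x) j) :=
  ((exists_matrix_entry f j i).choose_spec x).symm

theorem emb_apply_eq_sum (f : (∀ i, X i) →ₗ[GroupRing K G] (∀ i, Y i)) (j : ι) (x : ∀ i, X i) :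
    (Y j).emb (f x j) = ∑ i, toMatrix f j i * (X i).emb (x i) := by
  have h : x = ∑ i, Pi.single i (x i) := (Finset.univ_sum_single x).symm
  conv_lhs => rw [h]
  rw [map_sum, Finset.sum_apply, map_sum]
  exact Finset.sum_congr rfl fun i _ => (toMatrix_mul_emb f j i (x i)).symm

theorem toMatrix_comp (g : (∀ i, Y i) →ₗ[GroupRing K G] (∀ i, Z i))
    (f : (∀ i, X i) →ₗ[GroupRing K G] (∀ i, Y i)) :
    toMatrix (g ∘ₗ f) = toMatrix g * toMatrix f := by
  ext j i
  refine (X i).coef_linear_unique fun x => ?_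
  rw [toMatrix_mul_emb, LinearMap.comp_apply, emb_apply_eq_sum, Matrix.mul_apply, Finset.sum_mul]
  refine Finset.sum_congr rfl fun l _ => ?_
  rw [mul_assoc, toMatrix_mul_emb f]

theorem toMatrix_id : toMatrix (LinearMap.id (M := ∀ i, X i) (R := GroupRing K G)) = 1 := by
  ext j i
  refine (X i).coef_linear_unique fun x => ?_
  rw [toMatrix_mul_emb, LinearMap.id_apply]
  by_cases h : j = i
  · subst h
    rw [Pi.single_eq_same, Matrix.one_apply_eq, one_mul]
  · rw [Pi.single_eq_of_ne h, Matrix.one_apply_ne h, map_zero, zero_mul]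

theorem det_toMatrix_mul_mem (f : (∀ i, X i) →ₗ[GroupRing K G] (∀ i, Y i)) {z : Frac K G}
    (hz : z ∈ ∏ i, (X i).ideal) : (toMatrix f).det * z ∈ ∏ i, (Y i).ideal := by
  refine det_mul_mem_prod _ _ _ (fun j i x hx => ?_) hz
  obtain ⟨x, rfl⟩ := hx
  rw [toMatrix_mul_emb]
  exact emb_mem_ideal _ _

/-- Isomorphic sums of lattices have isomorphic determinants. -/
theorem exists_unit_mul_mem_prod_iff (e : (∀ i, X i) ≃ₗ[GroupRing K G] (∀ i, Y i)) :
    ∃ c : (Frac K G)ˣ, ∀ z, z ∈ ∏ i, (X i).ideal ↔ c * z ∈ ∏ i, (Y i).ideal := by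
  have h1 : (toMatrix e.toLinearMap).det * (toMatrix e.symm.toLinearMap).det = 1 := by
    rw [← Matrix.det_mul, ← toMatrix_comp, LinearEquiv.comp_symm, toMatrix_id, Matrix.det_one]
  refine ⟨⟨_, _, h1, (mul_comm _ _).trans h1⟩, fun z =>
    ⟨det_toMatrix_mul_mem e.toLinearMap, fun h => ?_⟩⟩
  have h2 := det_toMatrix_mul_mem e.symm.toLinearMap h
  rwa [← mul_assoc, mul_comm (Matrix.det _), h1, one_mul] at h2

/-- Stably isomorphic locally free lattices of rank one are isomorphic. -/
theorem nonempty_linearEquiv_of_stablyIso {X Y : LFLattice K G}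
    (h : StablyIso (GroupRing K G) X Y) : Nonempty (X ≃ₗ[GroupRing K G] Y) := by
  obtain ⟨n, -, ⟨e⟩⟩ := h
  -- The index `none` carries the lattice and the `n` other indices carry the free summands.
  let F : LFLattice K G → Option (Fin n) → LFLattice K G := fun X o => o.elim X fun _ => unit
  have hF (X : LFLattice K G) : Nonempty ((∀ i, F X i) ≃ₗ[GroupRing K G] X × (Fin n → GroupRing K G)) :=
    ⟨LinearEquiv.piOptionEquivProd _⟩
  obtain ⟨f⟩ := hF X
  obtain ⟨g⟩ := hF Y
  obtain ⟨c, hc⟩ := exists_unit_mul_mem_prod_iff (f.trans (e.trans g.symm))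
  -- The embedding chosen for `unit` need not be the standard inclusion, so its ideal need not be
  -- `1`; invertibility is all that the cancellation uses.
  obtain ⟨P, hP⟩ : IsUnit (∏ _i : Fin n, (unit : LFLattice K G).ideal) :=
    (Finset.univ : Finset (Fin n)).prod_induction _ IsUnit (fun _ _ => IsUnit.mul) isUnit_one
      fun _ _ => isUnit_ideal _
  have hprod (X : LFLattice K G) : ∏ i, (F X i).ideal = X.ideal * P := by
    rw [Fintype.prod_option, hP]
    rfl
  rw [hprod, hprod] at hc
  have key (X Y : LFLattice K G) (c : Frac K G)
      (hc : ∀ z ∈ X.ideal * P, c * z ∈ Y.ideal * P) : ∀ z ∈ X.ideal, c * z ∈ Y.ideal := by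
    intro z hz
    have h1 : Submodule.span (GroupRing K G) {c} * (X.ideal * P) ≤ Y.ideal * P := by
      rw [Submodule.mul_le]
      intro m hm n hn
      obtain ⟨r, rfl⟩ := Submodule.mem_span_singleton.1 hm
      rw [smul_mul_assoc]
      exact Submodule.smul_mem _ _ (hc n hn)
    have h2 := mul_le_mul_left h1 (↑P⁻¹ : Submodule (GroupRing K G) (Frac K G))
    rw [← mul_assoc, mul_assoc, mul_assoc Y.ideal, Units.mul_inv, mul_one, mul_one] at h2
    exact h2 (Submodule.mul_mem_mul (Submodule.mem_span_singleton_self c) hz)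
  have h1 := key X Y c fun z hz => (hc z).1 hz
  have h2 := key Y X ↑c⁻¹ fun z hz => (hc _).2 (by rwa [Units.mul_inv_cancel_left])
  choose f hf using fun x => h1 _ (X.emb_mem_ideal x)
  choose g hg using fun y => h2 _ (Y.emb_mem_ideal y)
  exact ⟨{
    toFun := f
    invFun := g
    map_add' := fun x y => Y.emb_injective (by rw [map_add, hf, hf, hf, map_add, mul_add])
    map_smul' := fun r x => Y.emb_injective (by
      rw [RingHom.id_apply, map_smul, hf, hf, map_smul, mul_smul_comm])
    left_inv := fun x => X.emb_injective (by rw [hg, hf, Units.inv_mul_cancel_left])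
    right_inv := fun y => Y.emb_injective (by rw [hf, hg, Units.mul_inv_cancel_left]) }⟩

end LFLattice

end Determinant

/-! ### Defects of semilinear automorphisms and the map ξ. -/

section Defect

variable {k K G : Type*} [Field k] [Field K] [NumberField K] [Algebra k K] [CommGroup G] [Finite G]

open GroupRing

/-- Multiplying the inclusion (t) Q ⊆ Q by the inverse of `Q` gives (t) ⊆ 1, and the submodule `1`
is the image of `R`. -/
theorem exists_algebraMap_eq_of_mul_mem {R A : Type*} [CommRing R] [CommRing A] [Algebra R A]
    {Q : Submodule R A} (hQ : IsUnit Q) {t : A} (ht : ∀ z ∈ Q, t * z ∈ Q) :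
    ∃ r : R, algebraMap R A r = t := by
  obtain ⟨P, rfl⟩ := hQ
  have h1 : Submodule.span R {t} * P ≤ P := by
    rw [Submodule.mul_le]
    intro m hm n hn
    obtain ⟨r, rfl⟩ := Submodule.mem_span_singleton.1 hm
    rw [smul_mul_assoc]
    exact Submodule.smul_mem _ _ (ht n hn)
  have h2 := mul_le_mul_left h1 (↑P⁻¹ : Submodule R A)
  rw [mul_assoc, Units.mul_inv, mul_one] at h2
  exact Submodule.mem_one.1 (h2 (Submodule.mem_span_singleton_self t))

theorem exists_unit_map_eq_of_mul_mem_iff {R A : Type*} [CommRing R] [CommRing A] [Algebra R A]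
    (hinj : Function.Injective (algebraMap R A)) {Q : Submodule R A} (hQ : IsUnit Q) {t : Aˣ}
    (ht : ∀ z, z ∈ Q ↔ t * z ∈ Q) : ∃ r : Rˣ, Units.map (algebraMap R A : R →* A) r = t := by
  obtain ⟨a, ha⟩ := exists_algebraMap_eq_of_mul_mem hQ fun z => (ht z).1
  obtain ⟨b, hb⟩ := exists_algebraMap_eq_of_mul_mem (t := ↑t⁻¹) hQ fun z hz =>
    (ht _).2 (by rwa [Units.mul_inv_cancel_left])
  have hab : a * b = 1 := hinj (by rw [map_mul, ha, hb, Units.mul_inv, map_one])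
  exact ⟨⟨a, b, hab, (mul_comm _ _).trans hab⟩, Units.ext ha⟩

namespace LFLattice

/-- Automorphisms of locally free lattices of rank one are multiplications with units. -/
theorem exists_unit_smul (X : LFLattice K G) (e : X ≃ₗ[GroupRing K G] X) :
    ∃ r : (GroupRing K G)ˣ, ∀ x, (r : GroupRing K G) • x = e x := by
  obtain ⟨a, ha⟩ := X.exists_coef_linear (X.emb ∘ₗ e.toLinearMap)
  obtain ⟨b, hb⟩ := X.exists_coef_linear (X.emb ∘ₗ e.symm.toLinearMap)
  have ha' : ∀ x, X.emb (e x) = a * X.emb x := ha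
  have hb' : ∀ x, X.emb (e.symm x) = b * X.emb x := hb
  have hab : a * b = 1 := X.coef_linear_unique fun x => by
    rw [mul_assoc, ← hb', ← ha', e.apply_symm_apply, one_mul]
  obtain ⟨r, hr⟩ := exists_unit_map_eq_of_mul_mem_iff (t := ⟨a, b, hab, (mul_comm _ _).trans hab⟩)
    algebraMap_frac_injective X.isUnit_ideal fun z => ⟨by
      rintro ⟨x, rfl⟩
      exact ⟨e x, ha' x⟩, by
      rintro ⟨x, hx⟩
      refine ⟨e.symm x, ?_⟩
      rw [hb', hx, ← mul_assoc, mul_comm b, hab, one_mul]⟩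
  refine ⟨r, fun x => X.emb_injective ?_⟩
  rw [map_smul, Algebra.smul_def, ha']
  exact congrArg (· * X.emb x) (congrArg Units.val hr)

/-- Some element of `X` embeds as a nonzerodivisor, so the action is faithful. This is the
uniqueness of d_X. -/
theorem eq_of_smul_eq (X : LFLattice K G) {r r' : GroupRing K G} (h : ∀ x : X, r • x = r' • x) :
    r = r' := by
  obtain ⟨x, r₀, hr₀, hx⟩ := X.exists_emb_mem_nonZeroDivisors
  have h1 := congrArg X.emb (h x)
  rw [map_smul, map_smul, hx, Algebra.smul_def, Algebra.smul_def, ← map_mul, ← map_mul] at h1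
  exact (mul_cancel_right_mem_nonZeroDivisors hr₀).1 (algebraMap_frac_injective h1)

variable [MulDistribMulAction Gal(K/k) G]

/-- Invariance only says that the twist of `X` is stably isomorphic to `X`; cancellation makes this
an isomorphism, which is then composed with the tautological semilinear map to the twist. -/
theorem exists_isSemilinear_of_mk_mem (X : LFLattice K G)
    (hX : ClassGp.mk X ∈ InvClassGp k K G) (γ : Gal(K/k)) :
    ∃ φ : X ≃+ X, IsSemilinear G γ φ := by
  obtain ⟨φ, hφ⟩ := X.isSemilinear_twist γ
  have h1 : ClassGp.mk (X.twist γ) = ClassGp.mk X := by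
    rw [← ClassGp.smul_mk hφ]
    exact hX γ
  obtain ⟨e⟩ := nonempty_linearEquiv_of_stablyIso (ClassGp.mk_eq_mk.1 h1)
  have h2 := hφ.trans (IsSemilinear.of_linearEquiv (k := k) e)
  rw [one_mul] at h2
  exact ⟨_, h2⟩

/-- The gradings in φ_γ φ_δ φ_{γδ}⁻¹ cancel, so this composite is linear and hence multiplication by
a unit. -/
theorem existsUnique_isDefect (X : LFLattice K G) (φ : Gal(K/k) → X ≃+ X)
    (hφ : ∀ γ, IsSemilinear G γ (φ γ)) :
    ∃! d : Gal(K/k) × Gal(K/k) → (GroupRing K G)ˣ, IsDefect φ d := by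
  have h1 : ∀ p : Gal(K/k) × Gal(K/k), ∃ r : (GroupRing K G)ˣ, ∀ x : X,
      (r : GroupRing K G) • x = φ p.1 (φ p.2 ((φ (p.1 * p.2)).symm x)) := by
    rintro ⟨γ, δ⟩
    have h2 := (hφ (γ * δ)).symm.trans ((hφ δ).trans (hφ γ))
    rw [mul_inv_cancel] at h2
    exact X.exists_unit_smul h2.toLinearEquiv
  choose d hd using h1
  refine ⟨d, fun γ δ => hd (γ, δ), fun d' hd' => funext fun p => Units.ext ?_⟩
  exact X.eq_of_smul_eq fun x => (hd' p.1 p.2 x).trans (hd p x).symm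

/-- The action of `Gal(K/k)` on the units of the total ring of fractions. -/
noncomputable def _root_.BasicDiagram.GroupRing.sigmaFracUnits (γ : Gal(K/k)) :
    (Frac K G)ˣ →* (Frac K G)ˣ :=
  Units.map (sigmaFrac k K G γ : Frac K G →* Frac K G)

/-- The inclusion of `(𝓞_K G)ˣ` into the units of the total ring of fractions. -/
noncomputable def _root_.BasicDiagram.GroupRing.unitsToFrac : (GroupRing K G)ˣ →* (Frac K G)ˣ :=
  Units.map (algebraMap (GroupRing K G) (Frac K G) : GroupRing K G →* Frac K G)

theorem _root_.BasicDiagram.GroupRing.unitsToFrac_injective :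
    Function.Injective (unitsToFrac : (GroupRing K G)ˣ →* (Frac K G)ˣ) :=
  Units.map_injective algebraMap_frac_injective

theorem _root_.BasicDiagram.GroupRing.unitsToFrac_smul (γ : Gal(K/k)) (r : (GroupRing K G)ˣ) :
    unitsToFrac (γ • r) = sigmaFracUnits γ (unitsToFrac r) := by
  apply Units.ext
  change algebraMap (GroupRing K G) (Frac K G) (γ • (r : GroupRing K G)) =
    sigmaFrac k K G γ (algebraMap _ _ (r : GroupRing K G))
  rw [sigmaFrac_algebraMap]

theorem _root_.BasicDiagram.GroupRing.sigmaFracUnits_mul (γ δ : Gal(K/k)) (r : (Frac K G)ˣ) :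
    sigmaFracUnits (γ * δ) r = sigmaFracUnits γ (sigmaFracUnits δ r) := by
  apply Units.ext
  change sigmaFrac k K G (γ * δ) r = sigmaFrac k K G γ (sigmaFrac k K G δ r)
  rw [map_mul]
  rfl

/-- After extension to units of `Frac`, the defect is the formal coboundary of the multipliers `u`.
All later cocycle and coboundary identities reduce to this formula and to computation in an abelian
group. -/
theorem unitsToFrac_defect {X : LFLattice K G} {φ : Gal(K/k) → X ≃+ X}
    {d : Gal(K/k) × Gal(K/k) → (GroupRing K G)ˣ} (hd : IsDefect φ d) {u : Gal(K/k) → (Frac K G)ˣ}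
    (hu : ∀ γ x, X.emb (φ γ x) = u γ * sigmaFrac k K G γ (X.emb x)) (γ δ : Gal(K/k)) :
    unitsToFrac (d (γ, δ)) = u γ * sigmaFracUnits γ (u δ) / u (γ * δ) := by
  rw [eq_div_iff_mul_eq']
  apply Units.ext
  refine coef_unique (X := X) (γ * δ) fun x => ?_
  have h1 := congrArg X.emb (hd γ δ (φ (γ * δ) x))
  rw [AddEquiv.symm_apply_apply, map_smul, hu, hu, hu, Algebra.smul_def, map_mul] at h1
  rw [Units.val_mul, Units.val_mul, mul_assoc, mul_assoc, map_mul]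
  refine h1.trans ?_
  rw [map_mul]
  rfl

/-- Coboundaries are cocycles, and the cocycle identity descends from the units of `Frac` because
the units of 𝓞_K G inject there equivariantly. -/
theorem isMulCocycle_of_isDefect {X : LFLattice K G} {φ : Gal(K/k) → X ≃+ X}
    (hφ : ∀ γ, IsSemilinear G γ (φ γ)) {d : Gal(K/k) × Gal(K/k) → (GroupRing K G)ˣ}
    (hd : IsDefect φ d) : groupCohomology.IsMulCocycle₂ d := by
  choose u hu _ using fun γ => exists_unit_coef (hφ γ)
  intro γ δ ε
  apply unitsToFrac_injective
  rw [map_mul, map_mul, unitsToFrac_smul]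
  simp only [unitsToFrac_defect hd hu, map_mul, map_div, ← sigmaFracUnits_mul, mul_assoc γ δ ε]
  apply Additive.ofMul.injective
  simp only [ofMul_mul, ofMul_div]
  abel

/-- The product of the defects of semilinear automorphisms of lattices depends, up to a coboundary,
only on the direct sum of the lattices. -/
theorem exists_coboundary_of_linearEquiv {ι : Type*} [Fintype ι] [DecidableEq ι]
    {X Y : ι → LFLattice K G} (e : (∀ i, X i) ≃ₗ[GroupRing K G] (∀ i, Y i))
    {φ : ∀ i, Gal(K/k) → X i ≃+ X i} (hφ : ∀ i γ, IsSemilinear G γ (φ i γ))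
    {ψ : ∀ i, Gal(K/k) → Y i ≃+ Y i} (hψ : ∀ i γ, IsSemilinear G γ (ψ i γ))
    {c d : ι → Gal(K/k) × Gal(K/k) → (GroupRing K G)ˣ} (hc : ∀ i, IsDefect (φ i) (c i))
    (hd : ∀ i, IsDefect (ψ i) (d i)) :
    ∃ t : Gal(K/k) → (GroupRing K G)ˣ, ∀ γ δ,
      γ • t δ / t (γ * δ) * t γ = (∏ i, d i (γ, δ)) / ∏ i, c i (γ, δ) := by
  choose u hu hu' using fun i γ => exists_unit_coef (hφ i γ)
  choose w hw hw' using fun i γ => exists_unit_coef (hψ i γ)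
  obtain ⟨a, ha⟩ := exists_unit_mul_mem_prod_iff e
  have hprod (Z : ι → LFLattice K G) (γ : Gal(K/k)) (u : ι → (Frac K G)ˣ)
      (hu : ∀ i, ∀ z, z ∈ (Z i).ideal ↔ u i * sigmaFrac k K G γ z ∈ (Z i).ideal) (z : Frac K G) :
      z ∈ ∏ i, (Z i).ideal ↔ ((∏ i, u i : (Frac K G)ˣ) : Frac K G) * sigmaFrac k K G γ z ∈
        ∏ i, (Z i).ideal := by
    have hσ (γ : Gal(K/k)) (r : GroupRing K G) : ∃ r',
        sigmaFrac k K G γ (algebraMap _ _ r) = algebraMap _ _ r' := ⟨_, sigmaFrac_algebraMap γ r⟩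
    have hinv (z) : sigmaFrac k K G γ⁻¹ (sigmaFrac k K G γ z) = z := by
      rw [← RingAut.mul_apply, ← map_mul, inv_mul_cancel, map_one]
      rfl
    rw [Units.coe_prod]
    refine ⟨prod_mul_map_mem_prod (sigmaFrac k K G γ : Frac K G →+* Frac K G) (hσ γ) _ _ _
      fun i x hx => (hu i x).1 hx, fun hz => ?_⟩
    -- The inverse of z ↦ u · γ(z) is semilinear for γ⁻¹ with multiplier γ⁻¹(u⁻¹), so the converse
    -- follows from the same lemma.
    have h1 := prod_mul_map_mem_prod (sigmaFrac k K G γ⁻¹ : Frac K G →+* Frac K G) (hσ γ⁻¹)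
      (fun i => sigmaFrac k K G γ⁻¹ ((u i)⁻¹ : (Frac K G)ˣ)) (fun i => (Z i).ideal)
      (fun i => (Z i).ideal) (fun i x hx => (hu i _).2 ?_) hz
    · rw [RingHom.coe_coe, map_mul, hinv, map_prod, ← mul_assoc, ← Finset.prod_mul_distrib] at h1
      simpa only [← map_mul, Units.inv_mul, map_one, Finset.prod_const_one, one_mul] using h1
    · have hinv' (z) : sigmaFrac k K G γ (sigmaFrac k K G γ⁻¹ z) = z := by
        rw [← RingAut.mul_apply, ← map_mul, mul_inv_cancel, map_one]
        rfl
      rwa [RingHom.coe_coe, map_mul, hinv', hinv', Units.mul_inv_cancel_left]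
  let U : Gal(K/k) → (Frac K G)ˣ := fun γ => ∏ i, u i γ
  let W : Gal(K/k) → (Frac K G)ˣ := fun γ => ∏ i, w i γ
  have hQ : IsUnit (∏ i, (Y i).ideal) :=
    Finset.prod_induction _ IsUnit (fun _ _ => IsUnit.mul) isUnit_one fun _ _ => isUnit_ideal _
  -- On the determinant of the `Y i` there are two semilinear bijections with grading γ: z ↦ W γ ·
  -- γ(z), and z ↦ U γ · γ(z) transported along multiplication by `a`. Their quotient is
  -- multiplication by W γ · γ(a) / (a · U γ); it preserves an invertible ideal in both directions,
  -- so it is a unit of 𝓞_K G.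
  have ht : ∀ γ, ∃ t : (GroupRing K G)ˣ,
      unitsToFrac t = W γ * sigmaFracUnits γ a / (a * U γ) := by
    intro γ
    refine exists_unit_map_eq_of_mul_mem_iff algebraMap_frac_injective hQ fun y => ?_
    obtain ⟨z, hz⟩ := (sigmaFrac k K G γ).surjective (↑(a * U γ)⁻¹ * y)
    have hy : y = a * (U γ * sigmaFrac k K G γ z) := by
      rw [hz, ← mul_assoc, ← Units.val_mul, Units.mul_inv_cancel_left]
    have hy' : ((W γ * sigmaFracUnits γ a / (a * U γ) : (Frac K G)ˣ) : Frac K G) * y =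
        W γ * sigmaFrac k K G γ (a * z) := by
      rw [div_eq_mul_inv, Units.val_mul, mul_assoc, ← hz, map_mul, Units.val_mul, mul_assoc]
      rfl
    rw [hy', hy, ← ha, ← hprod Y γ _ (fun i => hw' i γ), ← ha, ← hprod X γ _ (fun i => hu' i γ)]
  choose t ht using ht
  refine ⟨t, fun γ δ => unitsToFrac_injective ?_⟩
  have h1 : unitsToFrac (∏ i, c i (γ, δ)) = U γ * sigmaFracUnits γ (U δ) / U (γ * δ) := by
    simp only [U, map_prod]
    rw [← Finset.prod_mul_distrib, ← Finset.prod_div_distrib]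
    exact Finset.prod_congr rfl fun i _ => unitsToFrac_defect (hc i) (hu i) γ δ
  have h2 : unitsToFrac (∏ i, d i (γ, δ)) = W γ * sigmaFracUnits γ (W δ) / W (γ * δ) := by
    simp only [W, map_prod]
    rw [← Finset.prod_mul_distrib, ← Finset.prod_div_distrib]
    exact Finset.prod_congr rfl fun i _ => unitsToFrac_defect (hd i) (hw i) γ δ
  rw [map_mul, map_div, map_div, h1, h2, unitsToFrac_smul, ht, ht, ht]
  simp only [map_mul, map_div, ← sigmaFracUnits_mul]
  apply Additive.ofMul.injective
  simp only [ofMul_mul, ofMul_div]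
  abel

end LFLattice

variable [MulDistribMulAction Gal(K/k) G]

theorem H2.mk_eq_mk {Γ M : Type*} [Group Γ] [CommGroup M] [MulDistribMulAction Γ M]
    {f g : Γ × Γ → M} {hf : groupCohomology.IsMulCocycle₂ f} {hg : groupCohomology.IsMulCocycle₂ g}
    (t : Γ → M) (ht : ∀ γ δ, γ • t δ / t (γ * δ) * t γ = g (γ, δ) / f (γ, δ)) :
    H2.mk f hf = H2.mk g hg := by
  refine QuotientGroup.eq.2 (Subgroup.mem_subgroupOf.2 ⟨t, fun γ δ => (ht γ δ).trans ?_⟩)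
  rw [div_eq_inv_mul]
  rfl

/-- The group Σ acts on 𝓞_K G by a genuine action, so the free summand in X ⊕ X' ≅ 𝓞_K G ⊕ X''
contributes nothing to the product of the defects. -/
theorem LFLattice.isDefect_smul : IsDefect (k := k) (K := K) (G := G) (X := (LFLattice.unit : LFLattice K G))
    (fun γ => (MulSemiringAction.toRingEquiv Gal(K/k) (GroupRing K G) γ).toAddEquiv) 1 := by
  intro γ δ x
  change (1 : GroupRing K G) • x = γ • δ • ((γ * δ)⁻¹ • (show GroupRing K G from x))
  rw [smul_smul, smul_inv_smul, one_smul]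

/-- Two representatives of a class are isomorphic by cancellation, and the comparison of defects for
sums with one summand removes both choices, of the lattice and of its automorphisms. -/
theorem isXi_unique {c : ClassGp K G} {z z' : H2 Gal(K/k) (GroupRing K G)ˣ} (h : IsXi c z)
    (h' : IsXi c z') : z = z' := by
  obtain ⟨X, φ, d, hd, hX, hφ, hdef, rfl⟩ := h
  obtain ⟨Y, ψ, d', hd', hY, hψ, hdef', rfl⟩ := h'
  obtain ⟨e⟩ := LFLattice.nonempty_linearEquiv_of_stablyIso (ClassGp.mk_eq_mk.1 (hX.trans hY.symm))
  obtain ⟨t, ht⟩ := LFLattice.exists_coboundary_of_linearEquiv (ι := Unit) (X := fun _ => X)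
    (Y := fun _ => Y) (LinearEquiv.piCongrRight fun _ => e) (φ := fun _ => φ) (fun _ => hφ)
    (ψ := fun _ => ψ) (fun _ => hψ) (c := fun _ => d) (d := fun _ => d') (fun _ => hdef)
    fun _ => hdef'
  exact H2.mk_eq_mk t (by simpa using ht)

theorem exists_isXi (c : InvClassGp k K G) : ∃ z : H2 Gal(K/k) (GroupRing K G)ˣ, IsXi c.1 z := by
  obtain ⟨c, hc⟩ := c
  obtain ⟨X, rfl⟩ := Quotient.exists_rep c
  choose φ hφ using X.exists_isSemilinear_of_mk_mem hc
  obtain ⟨d, hd, -⟩ := X.existsUnique_isDefect φ hφ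
  exact ⟨_, X, φ, d, LFLattice.isMulCocycle_of_isDefect hφ hd, rfl, hφ, hd, rfl⟩

theorem xi_spec (c : InvClassGp k K G) : IsXi c.1 (xi c) := by
  rw [xi, dif_pos (exists_isXi c)]
  exact (exists_isXi c).choose_spec

theorem xi_eq {c : InvClassGp k K G} {z : H2 Gal(K/k) (GroupRing K G)ˣ} (h : IsXi c.1 z) :
    xi c = z :=
  isXi_unique (xi_spec c) h

/-- The comparison of defects for the two-element index type `Option Unit`, written with binary
products as in the definition of the product of classes. -/
theorem LFLattice.exists_coboundary_of_prodEquiv {X X' Y Y' : LFLattice K G}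
    (e : (X × X') ≃ₗ[GroupRing K G] Y × Y') {φ : Gal(K/k) → X ≃+ X} {φ' : Gal(K/k) → X' ≃+ X'}
    {ψ : Gal(K/k) → Y ≃+ Y} {ψ' : Gal(K/k) → Y' ≃+ Y'} (hφ : ∀ γ, IsSemilinear G γ (φ γ))
    (hφ' : ∀ γ, IsSemilinear G γ (φ' γ)) (hψ : ∀ γ, IsSemilinear G γ (ψ γ))
    (hψ' : ∀ γ, IsSemilinear G γ (ψ' γ)) {c c' d d' : Gal(K/k) × Gal(K/k) → (GroupRing K G)ˣ}
    (hc : IsDefect φ c) (hc' : IsDefect φ' c') (hd : IsDefect ψ d) (hd' : IsDefect ψ' d') :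
    ∃ t : Gal(K/k) → (GroupRing K G)ˣ, ∀ γ δ,
      γ • t δ / t (γ * δ) * t γ = (d (γ, δ) * d' (γ, δ)) / (c (γ, δ) * c' (γ, δ)) := by
  let F (X Y : LFLattice K G) : Option Unit → LFLattice K G := fun o => o.elim X fun _ => Y
  let E (X Y : LFLattice K G) : (∀ i, F X Y i) ≃ₗ[GroupRing K G] X × Y :=
    (LinearEquiv.piOptionEquivProd _).trans
      ((LinearEquiv.refl _ X).prodCongr (LinearEquiv.funUnique Unit _ Y))
  let Φ : ∀ i, Gal(K/k) → F X X' i ≃+ F X X' i := fun i => match i with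
    | none => φ
    | some _ => φ'
  let Ψ : ∀ i, Gal(K/k) → F Y Y' i ≃+ F Y Y' i := fun i => match i with
    | none => ψ
    | some _ => ψ'
  obtain ⟨t, ht⟩ := exists_coboundary_of_linearEquiv ((E X X').trans (e.trans (E Y Y').symm))
    (φ := Φ) (fun i => match i with
      | none => hφ
      | some _ => hφ')
    (ψ := Ψ) (fun i => match i with
      | none => hψ
      | some _ => hψ')
    (c := fun o => o.elim c fun _ => c') (d := fun o => o.elim d fun _ => d')
    (fun i => match i with
      | none => hc
      | some _ => hc')
    (fun i => match i with
      | none => hd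
      | some _ => hd')
  exact ⟨t, fun γ δ => (ht γ δ).trans (by simp [Fintype.prod_option])⟩

/-- Cancellation replaces X'' by the given representative `Y` of the product class, so 𝓞_K G ⊕ Y ≅ X
⊕ X'; comparing the defects of the two sides gives the claim. -/
theorem isXi_mul {c c' : ClassGp K G} {z z' z'' : H2 Gal(K/k) (GroupRing K G)ˣ} (h : IsXi c z)
    (h' : IsXi c' z') (h'' : IsXi (c * c') z'') : z'' = z * z' := by
  obtain ⟨X, φ, d, hd, rfl, hφ, hdef, rfl⟩ := h
  obtain ⟨X', φ', d', hd', rfl, hφ', hdef', rfl⟩ := h'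
  obtain ⟨Y, ψ, e, he, hY, hψ, hdefY, rfl⟩ := h''
  obtain ⟨X'', hX⟩ := LFLattice.exists_isSum X X'
  rw [ClassGp.mk_mul_mk hX] at hY
  obtain ⟨f⟩ := LFLattice.nonempty_linearEquiv_of_stablyIso (ClassGp.mk_eq_mk.1 hY)
  obtain ⟨g⟩ := hX
  have E : ((LFLattice.unit : LFLattice K G).carrier × Y) ≃ₗ[GroupRing K G] (X × X') :=
    ((LinearEquiv.refl _ _).prodCongr f).trans g.symm
  obtain ⟨t, ht⟩ := LFLattice.exists_coboundary_of_prodEquiv E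
    (fun _ => IsSemilinear.groupRing) hψ hφ hφ' LFLattice.isDefect_smul hdefY hdef hdef'
  have ht' : ∀ γ δ, γ • t δ / t (γ * δ) * t γ = (d * d') (γ, δ) / e (γ, δ) := fun γ δ => by
    rw [ht, Pi.one_apply, one_mul, Pi.mul_apply]
  exact H2.mk_eq_mk (hg := (Z2 Gal(K/k) (GroupRing K G)ˣ).mul_mem hd hd') t ht'

theorem xi_mul (c c' : InvClassGp k K G) : xi (c * c') = xi c * xi c' :=
  isXi_mul (xi_spec c) (xi_spec c') (xi_spec (c * c'))

end Defect

/-! ### Homomorphism properties, and exactness of the top row. -/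

section TopRowExact

theorem H2.map_mul {Γ M N : Type*} [Group Γ] [CommGroup M] [MulDistribMulAction Γ M] [CommGroup N]
    [MulDistribMulAction Γ N] (φ : M →* N) (hφ : ∀ (γ : Γ) (m : M), φ (γ • m) = γ • φ m)
    (z z' : H2 Γ M) : H2.map φ hφ (z * z') = H2.map φ hφ z * H2.map φ hφ z' := by
  obtain ⟨a, rfl⟩ := QuotientGroup.mk_surjective z
  obtain ⟨b, rfl⟩ := QuotientGroup.mk_surjective z'
  refine congrArg (QuotientGroup.mk : Z2 Γ N → H2 Γ N) (Subtype.ext (funext fun p => ?_))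
  exact _root_.map_mul φ (a.1 p) (b.1 p)

theorem H2.mk_eq_one {Γ M : Type*} [Group Γ] [CommGroup M] [MulDistribMulAction Γ M]
    {f : Γ × Γ → M} {hf : groupCohomology.IsMulCocycle₂ f} :
    H2.mk f hf = 1 ↔ groupCohomology.IsMulCoboundary₂ f :=
  (QuotientGroup.eq_one_iff _).trans Subgroup.mem_subgroupOf

variable {k K G : Type*} [Field k] [Field K] [NumberField K] [Algebra k K] [IsGalois k K]
  [CommGroup G] [TopologicalSpace G] [DiscreteTopology G] [MulDistribMulAction Gal(K/k) G]

namespace Lifts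

variable (s : Lifts k K)

theorem tr_mul (h h' : s.invHom G) : s.tr (h * h') = s.tr h * s.tr h' := rfl

theorem res_mul (a b : H1 k K G) : s.res (a * b) = s.res a * s.res b := by
  obtain ⟨a, rfl⟩ := QuotientGroup.mk_surjective a
  obtain ⟨b, rfl⟩ := QuotientGroup.mk_surjective b
  rfl

/-- Evaluating a crossed homomorphism f on γ̄ δ̄ = `defect` · (γδ)̄ in two ways exhibits the
transgression cocycle as the coboundary of γ ↦ f(γ̄). -/
theorem tr_res (a : H1 k K G) : s.tr (s.res a) = 1 := by
  obtain ⟨f, rfl⟩ := QuotientGroup.mk_surjective a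
  refine H2.mk_eq_one.2 ⟨fun γ => f.1 (s.lift γ), fun γ δ => ?_⟩
  have h1 : f.1 (s.lift γ * s.lift δ) = f.1 (inclTame k K (s.defect γ δ) * s.lift (γ * δ)) := by
    rw [defect, inclTame_toGalTame, inv_mul_cancel_right]
  rw [f.2.2, f.2.2, s.toSigma_lift, toSigma_inclTame, one_smul] at h1
  change _ = f.1 (inclTame k K (s.defect γ δ))
  rw [div_mul_eq_mul_div, h1, mul_div_cancel_left]

/-- The component in `Gal(Kᵗ/K)` of an element of `Gal(Kᵗ/k)`. -/
noncomputable def kernelPart (τ : Gal((tameClosure K)/k)) : Gal((tameClosure K)/K) :=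
  toGalTame (τ * (s.lift (toSigma k K τ))⁻¹)
    (by rw [map_mul, map_inv, s.toSigma_lift, mul_inv_cancel])

/-- With σ = n γ̄ and τ = m δ̄, the product is n · (γ̄ m γ̄⁻¹) · (γ̄ δ̄ (γδ)̄⁻¹) · (γδ)̄. -/
theorem kernelPart_mul (σ τ : Gal((tameClosure K)/k)) :
    s.kernelPart (σ * τ) = s.kernelPart σ * s.conj (toSigma k K σ) (s.kernelPart τ) *
      s.defect (toSigma k K σ) (toSigma k K τ) := by
  apply inclTame_injective (k := k)
  simp only [map_mul, kernelPart, conj, defect, inclTame_toGalTame]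
  group

theorem kernelPart_inclTame (ω : Gal((tameClosure K)/K)) : s.kernelPart (inclTame k K ω) = ω := by
  apply inclTame_injective (k := k)
  rw [kernelPart, inclTame_toGalTame, toSigma_inclTame, s.lift_one, inv_one, mul_one]

theorem kernelPart_inclTame_mul (ω : Gal((tameClosure K)/K)) (τ : Gal((tameClosure K)/k)) :
    s.kernelPart (inclTame k K ω * τ) = ω * s.kernelPart τ := by
  apply inclTame_injective (k := k)
  simp only [map_mul, kernelPart, inclTame_toGalTame, toSigma_inclTame, one_mul, mul_assoc]

/-- As K/k is finite, a finite subextension of Kᵗ/K is finite over k, and an automorphism over k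
fixing it already fixes K. This gives the continuity of the crossed homomorphism built below. -/
theorem _root_.BasicDiagram.isOpenMap_inclTame [FiniteDimensional k K] :
    IsOpenMap (inclTame k K) := by
  refine IsTopologicalGroup.isOpenMap_iff_nhds_one.2 (Filter.le_map fun U hU => ?_)
  obtain ⟨E, hE, hEU⟩ := (krullTopology_mem_nhds_one_iff K (tameClosure K) U).1 hU
  have hfin : FiniteDimensional k (E.restrictScalars k) :=
    FiniteDimensional.trans k K E
  refine (krullTopology_mem_nhds_one_iff k (tameClosure K) _).2
    ⟨E.restrictScalars k, hfin, fun τ hτ => ?_⟩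
  have hτ' := (IntermediateField.mem_fixingSubgroup_iff _ _).1 hτ
  have h1 : toSigma k K τ = 1 := by
    ext x
    apply (algebraMap K (tameClosure K)).injective
    rw [toSigma_commutes]
    exact hτ' _ (E.algebraMap_mem x)
  exact ⟨toGalTame τ h1, hEU ((IntermediateField.mem_fixingSubgroup_iff _ _).2 hτ'), rfl⟩

/-- If the transgression cocycle is the coboundary of x, then f(n γ̄) = h(n) x(γ) works: the defect
term in `kernelPart_mul` is compensated by x, and the conjugation term by the invariance of h. -/
theorem exists_res_eq [FiniteDimensional k K] (h : s.invHom G) (hh : s.tr h = 1) :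
    ∃ a : H1 k K G, s.res a = h := by
  obtain ⟨x, hx⟩ := H2.mk_eq_one.1 hh
  have hconj : ∀ γ ω, h.1 (s.conj γ ω) = γ • h.1 ω := fun γ ω => by
    have := congrFun (h.2 γ) ω
    rw [← this, homAct, smul_inv_smul]
  let f : Gal((tameClosure K)/k) → G := fun τ => h.1 (s.kernelPart τ) * x (toSigma k K τ)
  -- The coboundary relation at (1, 1) gives x(1) = h(1̄ 1̄ 1̄⁻¹), which is trivial by the
  -- normalisation 1̄ = 1. Without it f would restrict to h only up to a constant.
  have hx1 : x 1 = 1 := by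
    have := hx 1 1
    rw [mul_one, one_smul, div_self', one_mul] at this
    rw [this]
    have h1 : s.defect (1 : Gal(K/k)) 1 = 1 := by
      apply inclTame_injective (k := k)
      rw [defect, inclTame_toGalTame, mul_one, s.lift_one, mul_one, inv_one, map_one, mul_one]
    exact (congrArg h.1 h1).trans (map_one _)
  have hf : f ∈ Z1 k K G := by
    refine ⟨?_, fun σ τ => ?_⟩
    · refine IsLocallyConstant.continuous ((IsLocallyConstant.iff_exists_open f).2 fun τ => ?_)
      -- The neighbourhood is the coset (ker h) τ, on which neither factor of f changes.
      refine ⟨(fun ρ => ρ * τ⁻¹) ⁻¹' (inclTame k K '' (h.1 ⁻¹' {1})), ?_, ?_, ?_⟩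
      · refine IsOpen.preimage (continuous_mul_const _) (isOpenMap_inclTame _ ?_)
        exact (isOpen_discrete _).preimage h.1.continuous_toFun
      · exact ⟨1, by simp, by simp⟩
      · rintro ρ ⟨ω, hω, hρ⟩
        have : ρ = inclTame k K ω * τ := by rw [hρ, inv_mul_cancel_right]
        simp only [f, this, kernelPart_inclTame_mul, map_mul, toSigma_inclTame, one_mul]
        rw [show h.1 ω = 1 from hω, one_mul]
    · simp only [f, kernelPart_mul, map_mul, hconj, smul_mul']
      have := hx (toSigma k K σ) (toSigma k K τ)
      dsimp only at this
      rw [← this]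
      apply Additive.ofMul.injective
      simp only [ofMul_mul, ofMul_div]
      abel
  refine ⟨QuotientGroup.mk ⟨f, hf⟩, Subtype.ext ?_⟩
  ext ω
  change h.1 (s.kernelPart (inclTame k K ω)) * x (toSigma k K (inclTame k K ω)) = h.1 ω
  rw [kernelPart_inclTame, toSigma_inclTame, hx1, mul_one]

theorem tr_eq_one_iff [FiniteDimensional k K] (h : s.invHom G) :
    s.tr h = 1 ↔ ∃ a : H1 k K G, s.res a = h :=
  ⟨s.exists_res_eq h, by rintro ⟨a, rfl⟩; exact s.tr_res a⟩

end Lifts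

end TopRowExact

/-! ### Projective modules of generic rank one over an order are locally free. -/

section Swan

open TensorProduct

variable {O R B : Type*} [CommRing O] [CommRing R] [Algebra O R]
  [AddCommGroup B] [Module O B] [Module R B] [IsScalarTower O R B]

/-- The rank at `p` equals the rank at a minimal prime `q` below it. A minimal prime contains no
nonzerodivisor, hence no nonzero element of `O`, so after localising at `q` the generic generator
`x₀` becomes a basis. -/
theorem rankAtStalk_eq_one_of_generic [IsDomain O] [Module.IsTorsionFree O R] [Module.Finite R B]
    [Module.Projective R B] {x₀ : B} (hinj : ∀ r : R, r • x₀ = 0 → r = 0)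
    (hgen : ∀ y : B, ∃ (d : O) (r : R), d ≠ 0 ∧ d • y = r • x₀) (p : PrimeSpectrum R) :
    Module.rankAtStalk B p = 1 := by
  obtain ⟨q, hq, hqp⟩ := Ideal.exists_minimalPrimes_le (I := (⊥ : Ideal R)) (J := p.asIdeal) bot_le
  have hq' : q.IsPrime := hq.1.1
  have : Nontrivial R := ⟨0, 1, fun h => hq'.ne_top ((Ideal.eq_top_iff_one q).2 (h ▸ zero_mem q))⟩
  have hd : ∀ d : O, d ≠ 0 → algebraMap O R d ∈ q.primeCompl := by
    intro d hd hdq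
    refine Set.disjoint_left.1 (Ideal.disjoint_nonZeroDivisors_of_mem_minimalPrimes hq) hdq ?_
    refine mem_nonZeroDivisors_iff_right.2 fun r hr => ?_
    rw [mul_comm, ← Algebra.smul_def] at hr
    exact (smul_eq_zero.1 hr).resolve_left hd
  have h1 : Module.rankAtStalk B ⟨q, hq'⟩ = Module.rankAtStalk R ⟨q, hq'⟩ := by
    have hbij : Function.Bijective
        (LocalizedModule.map q.primeCompl (LinearMap.toSpanSingleton R B x₀)) := by
      refine ⟨LocalizedModule.map_injective _ _ ((injective_iff_map_eq_zero _).2 fun r hr =>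
        hinj r hr), fun z => ?_⟩
      induction z using LocalizedModule.induction_on with
      | h y s =>
        obtain ⟨d, r, hd0, hdr⟩ := hgen y
        refine ⟨LocalizedModule.mk r (s * ⟨_, hd d hd0⟩), ?_⟩
        rw [LocalizedModule.map_mk, LocalizedModule.mk_eq]
        refine ⟨1, ?_⟩
        rw [one_smul, one_smul, LinearMap.toSpanSingleton_apply, ← hdr, mul_smul]
        congr 1
        exact (algebraMap_smul R d y).symm
    exact ((LinearEquiv.ofBijective _ hbij).finrank_eq).symm
  rw [← Module.rankAtStalk_eq_of_le_of_finite_of_flat B (p := ⟨q, hq'⟩) (q := p) hqp, h1,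
    Module.rankAtStalk_self, Pi.one_apply]

theorem finrank_tensorProduct_quotient_eq_one [Module.Finite R B] [Module.Projective R B]
    (h : ∀ p : PrimeSpectrum R, Module.rankAtStalk B p = 1) {S : Type*} [CommRing S] [Algebra R S]
    (P : MaximalSpectrum S) :
    Module.finrank (S ⧸ P.1) ((S ⧸ P.1) ⊗[S] (S ⊗[R] B)) = 1 := by
  let _ := Ideal.Quotient.field P.1
  have h1 := congrFun (Module.rankAtStalk_eq_finrank_of_free (R := S ⧸ P.1)
    (M := (S ⧸ P.1) ⊗[S] (S ⊗[R] B))) ⟨⊥, Ideal.isPrime_bot⟩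
  rw [Module.rankAtStalk_baseChange, Module.rankAtStalk_baseChange, h] at h1
  exact h1.symm

/-- A finite projective module over a commutative order which is generically free of rank one is
locally free of rank one. -/
theorem LocGen.of_projective [IsDomain O] [Module.IsTorsionFree O R] [Module.Finite O R]
    [Module.Finite O B] [Module.Projective R B] {x₀ : B}
    (hinj : ∀ r : R, r • x₀ = 0 → r = 0)
    (hgen : ∀ y : B, ∃ (d : O) (r : R), d ≠ 0 ∧ d • y = r • x₀) (v : Ideal O) [v.IsMaximal] :
    ∃ x : B, LocGen R v x := by
  have : Module.Finite R B := Module.Finite.of_restrictScalars_finite O R B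
  let I := v.map (algebraMap O R)
  let _ := Ideal.Quotient.field v
  have : Module.Finite (O ⧸ v) (R ⧸ I) := by
    have : Module.Finite O (R ⧸ I) := inferInstance
    exact Module.Finite.of_restrictScalars_finite O (O ⧸ v) (R ⧸ I)
  -- An Artinian ring is semilocal, so a finite projective module of constant rank one over it is
  -- free. The generator found there is then lifted to `B`.
  have : IsArtinianRing (R ⧸ I) := IsArtinianRing.of_finite (O ⧸ v) (R ⧸ I)
  obtain ⟨b⟩ := Module.nonempty_basis_of_flat_of_finrank_eq (R ⧸ I) ((R ⧸ I) ⊗[R] B) 1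
    (finrank_tensorProduct_quotient_eq_one (rankAtStalk_eq_one_of_generic hinj hgen))
  obtain ⟨x, hx⟩ := TensorProduct.mk_surjective R B (R ⧸ I) Ideal.Quotient.mk_surjective (b 0)
  rw [TensorProduct.mk_apply] at hx
  have hmod : ∀ y : B, ∃ r : R, y - r • x ∈ v • (⊤ : Submodule O B) := by
    intro y
    have h1 := b.sum_repr (1 ⊗ₜ y)
    rw [Fin.sum_univ_one, ← hx] at h1
    obtain ⟨r, hr⟩ := Ideal.Quotient.mk_surjective (b.repr (1 ⊗ₜ y) 0)
    refine ⟨r, ?_⟩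
    have h2 : (1 : R ⧸ I) ⊗ₜ[R] (y - r • x) = 0 := by
      rw [TensorProduct.tmul_sub, ← h1, ← hr, TensorProduct.tmul_smul]
      exact sub_self _
    have h3 := congrArg (TensorProduct.quotTensorEquivQuotSMul B I) h2
    rw [map_zero, ← map_one (Ideal.Quotient.mk I), TensorProduct.quotTensorEquivQuotSMul_mk_tmul,
      one_smul, Submodule.Quotient.mk_eq_zero] at h3
    have h4 := Ideal.smul_restrictScalars v (⊤ : Submodule R B)
    rw [Submodule.restrictScalars_top] at h4
    rw [← h4]
    exact h3
  let N : Submodule O B := (Submodule.span R {x}).restrictScalars O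
  have hle : (⊤ : Submodule O (B ⧸ N)) ≤ v • ⊤ := by
    intro n _
    obtain ⟨y, rfl⟩ := N.mkQ_surjective n
    obtain ⟨r, hr⟩ := hmod y
    have h6 : N.mkQ y = N.mkQ (y - r • x) := by
      rw [map_sub, eq_comm, sub_eq_self]
      exact (Submodule.Quotient.mk_eq_zero N).2
        (Submodule.smul_mem (Submodule.span R {x}) r (Submodule.mem_span_singleton_self x))
    rw [h6]
    have : Submodule.map N.mkQ (v • (⊤ : Submodule O B)) ≤ v • ⊤ := by
      rw [Submodule.map_smul'']
      exact Submodule.smul_mono le_rfl le_top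
    exact this ⟨_, hr, rfl⟩
  -- Nakayama's lemma: the quotient of `B` by R x is killed by some a ≡ 1 modulo v.
  obtain ⟨a, ha, ha0⟩ := Submodule.exists_sub_one_mem_and_smul_eq_zero_of_fg_of_le_smul v
    (⊤ : Submodule O (B ⧸ N)) Module.Finite.fg_top hle
  have hav : a ∉ v := fun hav => (Ideal.ne_top_iff_one _).1 (Ideal.IsMaximal.ne_top ‹_›)
    (by have := v.sub_mem hav ha; simpa using this)
  have hgen' : ∀ y : B, ∃ r : R, a • y = r • x := by
    intro y
    have h2 : a • y ∈ N := by
      rw [← Submodule.Quotient.mk_eq_zero, Submodule.Quotient.mk_smul]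
      exact ha0 _ trivial
    obtain ⟨r, hr⟩ := Submodule.mem_span_singleton.1 h2
    exact ⟨r, hr.symm⟩
  refine ⟨x, a, hav, hgen', fun r hr => ?_⟩
  -- Injectivity is inherited from `x₀`: since a • x₀ = s • x, the relation r • x = 0 forces (a • r)
  -- • x₀ = 0.
  obtain ⟨s, hs⟩ := hgen' x₀
  have h1 : (a • r) • x₀ = 0 := by
    rw [smul_assoc, smul_comm, hs, smul_comm, hr, smul_zero]
  have ha0 : a ≠ 0 := fun h => hav (h ▸ zero_mem _)
  exact (smul_eq_zero.1 (hinj _ h1)).resolve_left ha0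

end Swan

/-! ### Projectivity over a group ring from an endomorphism of trace one. -/

section RelativelyProjective

open TensorProduct

variable {O Γ B : Type*} [CommRing O] [CommGroup Γ] [Finite Γ] [AddCommGroup B] [Module O B]
  [Module (MonoidAlgebra O Γ) B] [IsScalarTower O (MonoidAlgebra O Γ) B]

/-- A module over a group ring with an endomorphism of trace one is projective if it is projective
over the ring of coefficients. -/
theorem projective_monoidAlgebra_of_sum_eq [Fintype Γ] [Module.Projective O B] (c : B →ₗ[O] B)
    (hc : ∀ b : B, ∑ g : Γ, (MonoidAlgebra.single g 1 : MonoidAlgebra O Γ) •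
      c ((MonoidAlgebra.single g⁻¹ 1 : MonoidAlgebra O Γ) • b) = b) :
    Module.Projective (MonoidAlgebra O Γ) B := by
  let R := MonoidAlgebra O Γ
  let act : Γ → B →ₗ[O] B := fun g => Algebra.lsmul O O B (MonoidAlgebra.single g 1 : R)
  -- The map b ↦ ∑ g ⊗ c(g⁻¹ b) is an equivariant section of the action map R ⊗ B → B, so `B` is a
  -- summand of the projective module R ⊗ B.
  let s₀ : B →ₗ[O] R ⊗[O] B := ∑ g : Γ, TensorProduct.mk O R B (MonoidAlgebra.single g 1) ∘ₗ c ∘ₗ act g⁻¹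
  have hs₀ (b : B) : s₀ b = ∑ g : Γ, (MonoidAlgebra.single g 1 : R) ⊗ₜ[O]
      c ((MonoidAlgebra.single g⁻¹ 1 : R) • b) := by
    simp only [s₀, LinearMap.sum_apply]
    rfl
  let s : B →ₗ[R] R ⊗[O] B := MonoidAlgebra.equivariantOfLinearOfComm s₀ (by
    intro h b
    rw [hs₀, hs₀, Finset.smul_sum]
    refine Fintype.sum_equiv (Equiv.mulLeft h⁻¹) _ _ fun g => ?_
    rw [TensorProduct.smul_tmul', smul_smul, smul_eq_mul, MonoidAlgebra.single_mul_single,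
      MonoidAlgebra.single_mul_single, one_mul]
    simp)
  let π : R ⊗[O] B →ₗ[R] B := TensorProduct.AlgebraTensorModule.lift
    ((LinearMap.lsmul R B).restrictScalars₁₂ R O)
  refine Module.Projective.of_split s π (LinearMap.ext fun b => ?_)
  change π (s₀ b) = b
  rw [hs₀, map_sum]
  exact hc b

end RelativelyProjective

/-! ### Integers of trace one, and Noether's theorem. -/

section TraceOne

/-- If the residue characteristic at a prime `Q` does not divide the order of the inertia group,
the trace is not contained in `Q`. -/
theorem exists_sum_smul_notMem {S Γ : Type*} [CommRing S] [Group Γ] [Fintype Γ]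
    [MulSemiringAction Γ S] (Q : Ideal S) [Q.IsPrime]
    (hQ : ¬ ringChar (S ⧸ Q) ∣ Nat.card (Q.inertia Γ)) : ∃ x : S, ∑ g : Γ, g • x ∉ Q := by
  classical
  by_contra! h
  -- Dedekind's independence of characters, applied to x ↦ g x mod Q. Two of them agree when they
  -- differ by inertia, so in the sum over `Γ` the coefficient of `χ 1` is the order of the inertia
  -- group, which is nonzero in S/Q.
  let χ : Γ → S →* S ⧸ Q := fun g =>
    (Ideal.Quotient.mk Q : S →* S ⧸ Q).comp (MulSemiringAction.toRingHom Γ S g : S →* S)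
  have hχ (g : Γ) (x : S) : χ g x = Ideal.Quotient.mk Q (g • x) := rfl
  have h1 := (linearIndependent_monoidHom S (S ⧸ Q))
  rw [linearIndependent_iff] at h1
  have h2 := h1 (∑ g : Γ, Finsupp.single (χ g) 1) (by
    ext x
    rw [map_sum]
    simp only [Finsupp.linearCombination_single, one_smul, Finset.sum_apply, hχ]
    rw [← map_sum]
    exact Ideal.Quotient.eq_zero_iff_mem.2 (h x))
  have h3 := DFunLike.congr_fun h2 (χ 1)
  simp only [Finsupp.coe_finsetSum, Finset.sum_apply, Finsupp.single_apply, Finsupp.coe_zero,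
    Pi.zero_apply, Finset.sum_boole] at h3
  refine hQ ((ringChar.spec _ _).1 ?_)
  rw [← h3, ← Fintype.card_subtype, ← Nat.card_eq_fintype_card]
  refine congrArg _ (Nat.card_congr (Equiv.subtypeEquivRight fun g => ?_))
  constructor
  · intro hg
    ext x
    rw [hχ, hχ, one_smul]
    exact Ideal.Quotient.eq.2 (hg x)
  · intro hg x
    have := DFunLike.congr_fun hg x
    rw [hχ, hχ, one_smul] at this
    exact Ideal.Quotient.eq.1 this

variable {K L : Type*} [Field K] [Field L] [NumberField K] [NumberField L] [Algebra K L]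
  [IsGalois K L]

/-- The traces form an ideal of 𝓞_K. At a maximal ideal `M`, a prime `Q` above it misses some trace,
so the ideal is not contained in `M`. -/
theorem exists_sum_smul_eq_one [Fintype Gal(L/K)]
    (hI : ∀ Q : Ideal (𝓞 L), Q.IsPrime → Q ≠ ⊥ →
      ¬ ringChar (𝓞 L ⧸ Q) ∣ Nat.card (Q.inertia Gal(L/K))) :
    ∃ c : 𝓞 L, ∑ g : Gal(L/K), g • c = 1 := by
  have hinv (x : 𝓞 L) : ∃ a : 𝓞 K, algebraMap (𝓞 K) (𝓞 L) a = ∑ g : Gal(L/K), g • x := by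
    refine Algebra.IsInvariant.isInvariant (G := Gal(L/K)) _ fun h => ?_
    rw [Finset.smul_sum]
    exact Fintype.sum_equiv (Equiv.mulLeft h) _ _ fun g => smul_smul h g x
  let I : Ideal (𝓞 K) :=
    { carrier := {a | ∃ c : 𝓞 L, ∑ g : Gal(L/K), g • c = algebraMap (𝓞 K) (𝓞 L) a}
      zero_mem' := ⟨0, by simp⟩
      add_mem' := by
        rintro a b ⟨x, hx⟩ ⟨y, hy⟩
        exact ⟨x + y, by simp only [smul_add, Finset.sum_add_distrib, hx, hy, map_add]⟩
      smul_mem' := by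
        rintro r a ⟨x, hx⟩
        exact ⟨r • x, by
          simp only [smul_comm _ r x]
          rw [← Finset.smul_sum, hx, smul_eq_mul, map_mul, Algebra.smul_def]⟩ }
  suffices I = ⊤ by
    obtain ⟨c, hc⟩ := (Ideal.eq_top_iff_one I).1 this
    exact ⟨c, by rw [hc, map_one]⟩
  by_contra hne
  obtain ⟨M, hM, hle⟩ := Ideal.exists_le_maximal _ hne
  have hM0 : M ≠ ⊥ := by
    rintro rfl
    -- The trace of 1 is the order of the group, nonzero in characteristic zero; this excludes M =
    -- 0, to which the inertia hypothesis does not apply.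
    have : (Fintype.card Gal(L/K) : 𝓞 K) ∈ I := ⟨1, by simp⟩
    exact (Nat.cast_ne_zero (R := 𝓞 K)).2 (Fintype.card_ne_zero (α := Gal(L/K))) (by simpa using hle this)
  obtain ⟨Q, hQ, hQM⟩ := Ideal.exists_maximal_ideal_liesOver_of_isIntegral (S := 𝓞 L) M
  have hQ0 : Q ≠ ⊥ := Ideal.ne_bot_of_liesOver_of_ne_bot hM0 Q
  obtain ⟨x, hx⟩ := exists_sum_smul_notMem (Γ := Gal(L/K)) Q (hI Q hQ.isPrime hQ0)
  obtain ⟨a, ha⟩ := hinv x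
  refine hx ?_
  have h1 : a ∈ M := hle ⟨x, ha.symm⟩
  rw [← ha]
  rw [Q.over_def M] at h1
  exact h1

/-- A generator of a normal basis of L/K becomes integral after multiplication by a nonzero integer;
coordinates then exist after clearing denominators. -/
theorem exists_generic_basis [Fintype Gal(L/K)] :
    ∃ y : 𝓞 L, (∀ c : Gal(L/K) → 𝓞 K, ∑ g, c g • g • y = 0 → c = 0) ∧
      ∀ b : 𝓞 L, ∃ (d : 𝓞 K) (c : Gal(L/K) → 𝓞 K), d ≠ 0 ∧ d • b = ∑ g, c g • g • y := by
  have halg : IsAlgebraic ℤ (IsGalois.normalBasis K L 1) :=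
    (IsFractionRing.isAlgebraic_iff ℤ ℚ L).2 (IsAlgebraic.of_finite ℚ _)
  obtain ⟨m, hm, hint⟩ := halg.exists_integral_multiple
  let y : 𝓞 L := ⟨m • IsGalois.normalBasis K L 1, hint⟩
  have hcoe (c : Gal(L/K) → 𝓞 K) : algebraMap (𝓞 L) L (∑ g, c g • g • y) =
      m • ∑ g, (c g : K) • IsGalois.normalBasis K L g := by
    rw [Finset.smul_sum, map_sum]
    refine Finset.sum_congr rfl fun g _ => ?_
    rw [IsGalois.normalBasis_apply, smul_comm m, ← map_zsmul, Algebra.smul_def, map_mul,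
      Algebra.smul_def]
    rfl
  refine ⟨y, fun c hc => ?_, fun b => ?_⟩
  · have h1 := (hcoe c).symm.trans (congrArg (algebraMap (𝓞 L) L) hc)
    rw [map_zero, smul_eq_zero_iff_right hm] at h1
    have h2 := Fintype.linearIndependent_iff.1 (IsGalois.normalBasis K L).linearIndependent _ h1
    exact funext fun g => NumberField.RingOfIntegers.ext (h2 g)
  · obtain ⟨d, hd⟩ := IsLocalization.exist_integer_multiples_of_finite (nonZeroDivisors (𝓞 K))
      fun g => (IsGalois.normalBasis K L).repr b g
    choose c hc using hd
    -- Here `d` clears the denominators of the coordinates of `b`, and `m` accounts for `y` being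
    -- `m` times the normal basis generator.
    refine ⟨d * m, c, mul_ne_zero (nonZeroDivisors.ne_zero d.2) (by exact_mod_cast hm), ?_⟩
    apply NumberField.RingOfIntegers.ext
    change algebraMap (𝓞 L) L _ = algebraMap (𝓞 L) L _
    rw [hcoe]
    have h3 : ∀ g, ((c g : 𝓞 K) : K) • IsGalois.normalBasis K L g =
        ((d : 𝓞 K) : K) • (IsGalois.normalBasis K L).repr b g • IsGalois.normalBasis K L g := by
      intro g
      rw [smul_smul]
      congr 1
      exact (hc g).trans (Algebra.smul_def _ _)
    simp only [h3]
    rw [← Finset.smul_sum, Module.Basis.sum_repr, Algebra.smul_def (d * m : 𝓞 K), map_mul,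
      zsmul_eq_mul, map_mul, map_mul, map_intCast, map_intCast, mul_comm _ (m : L), mul_assoc,
      Algebra.smul_def]
    rfl

/-- **Noether's theorem**: the ring of integers of an abelian extension of number fields with tame
inertia groups is locally free over the group ring. -/
theorem exists_local_normal_basis [Fintype Gal(L/K)] (hcomm : ∀ σ τ : Gal(L/K), σ * τ = τ * σ)
    (hI : ∀ Q : Ideal (𝓞 L), Q.IsPrime → Q ≠ ⊥ →
      ¬ ringChar (𝓞 L ⧸ Q) ∣ Nat.card (Q.inertia Gal(L/K)))
    (v : IsDedekindDomain.HeightOneSpectrum (𝓞 K)) :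
    ∃ (y : 𝓞 L) (a : 𝓞 K), a ∉ v.asIdeal ∧
      (∀ b : 𝓞 L, ∃ c : Gal(L/K) → 𝓞 K, a • b = ∑ g, c g • g • y) ∧
      ∀ c : Gal(L/K) → 𝓞 K, ∑ g, c g • g • y = 0 → c = 0 := by
  let _ : CommGroup Gal(L/K) := { (inferInstance : Group Gal(L/K)) with mul_comm := hcomm }
  let R := MonoidAlgebra (𝓞 K) Gal(L/K)
  let _ : Module R (𝓞 L) := Module.compHom _ (MonoidAlgebra.lift (𝓞 K) (Module.End (𝓞 K) (𝓞 L))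
    Gal(L/K) (DistribMulAction.toModuleEnd (𝓞 K) (𝓞 L)) : R →+* Module.End (𝓞 K) (𝓞 L))
  have hsmul (r : R) (x : 𝓞 L) : r • x = ∑ g, r.coeff g • g • x := by
    change (MonoidAlgebra.lift (𝓞 K) (Module.End (𝓞 K) (𝓞 L)) Gal(L/K)
      (DistribMulAction.toModuleEnd (𝓞 K) (𝓞 L))) r x = _
    rw [MonoidAlgebra.lift_apply, Finsupp.sum_fintype _ _ fun g => ?_, LinearMap.sum_apply]
    · rfl
    · exact zero_smul _ _
  have hsingle (g : Gal(L/K)) (x : 𝓞 L) : (MonoidAlgebra.single g 1 : R) • x = g • x := by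
    change (MonoidAlgebra.lift (𝓞 K) (Module.End (𝓞 K) (𝓞 L)) Gal(L/K)
      (DistribMulAction.toModuleEnd (𝓞 K) (𝓞 L))) (MonoidAlgebra.single g 1) x = _
    rw [MonoidAlgebra.lift_single, one_smul]
    rfl
  have : IsScalarTower (𝓞 K) R (𝓞 L) := ⟨fun a r x => by
    change (MonoidAlgebra.lift (𝓞 K) (Module.End (𝓞 K) (𝓞 L)) Gal(L/K)
      (DistribMulAction.toModuleEnd (𝓞 K) (𝓞 L))) (a • r) x = _
    rw [map_smul]
    rfl⟩
  obtain ⟨c, hc⟩ := exists_sum_smul_eq_one hI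
  have := Module.finitePresentation_of_finite (𝓞 K) (𝓞 L)
  have : Module.Projective (𝓞 K) (𝓞 L) := Module.Flat.projective_of_finitePresentation
  -- For c of trace one, ∑ g(c · g⁻¹ b) = (∑ g c) · b = b, so multiplication by c is an endomorphism
  -- of trace one.
  have : Module.Projective R (𝓞 L) :=
    projective_monoidAlgebra_of_sum_eq (LinearMap.mulLeft (𝓞 K) c) fun b => by
      simp only [hsingle, LinearMap.mulLeft_apply, smul_mul', smul_inv_smul]
      rw [← Finset.sum_mul, hc, one_mul]
  obtain ⟨x₀, hx₀, hgen⟩ := exists_generic_basis (K := K) (L := L)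
  have hzero (r : R) (h : ⇑r.coeff = 0) : r = 0 :=
    MonoidAlgebra.coeff_inj.1 (DFunLike.coe_injective h)
  have hmax : v.asIdeal.IsMaximal := v.isMaximal
  have hfin : Module.Finite (𝓞 K) R := inferInstance
  have htf : Module.IsTorsionFree (𝓞 K) R := inferInstance
  obtain ⟨y, hy⟩ := LocGen.of_projective (O := 𝓞 K) (R := R) (B := 𝓞 L) (x₀ := x₀)
    (fun r hr => hzero r (hx₀ _ ((hsmul r x₀).symm.trans hr)))
    (fun b => by
      obtain ⟨d, c, hd, h⟩ := hgen b
      exact ⟨d, MonoidAlgebra.ofCoeff (Finsupp.equivFunOnFinite.symm c), hd, by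
        rw [h, hsmul]
        rfl⟩) v.asIdeal
  obtain ⟨a, ha, h1, h2⟩ := hy
  refine ⟨y, a, ha, fun b => ?_, fun c hc => ?_⟩
  · obtain ⟨r, hr⟩ := h1 b
    exact ⟨r.coeff, hr.trans (hsmul r y)⟩
  · have h3 := h2 (MonoidAlgebra.ofCoeff (Finsupp.equivFunOnFinite.symm c)) ((hsmul _ y).trans hc)
    exact congrArg (fun r : R => ⇑r.coeff) h3

end TraceOne

/-! ### The wild inertia group as the Sylow p-subgroup of inertia. -/

section WildInertia

variable {S Γ : Type*} [CommRing S] [Group Γ] [MulSemiringAction Γ S] (Q : Ideal S)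

variable {Q} in
theorem smul_mem_of_mem_inertia {σ : Γ} (hσ : σ ∈ Q.inertia Γ) {x : S} (hx : x ∈ Q) : σ • x ∈ Q := by
  rw [← sub_add_cancel (σ • x) x]
  exact Q.add_mem (hσ x) hx

variable {Q} in
theorem smul_mem_sq_of_mem_inertia {σ : Γ} (hσ : σ ∈ Q.inertia Γ) {x : S} (hx : x ∈ Q ^ 2) :
    σ • x ∈ Q ^ 2 := by
  rw [pow_two] at hx ⊢
  induction hx using Submodule.mul_induction_on' with
  | mem_mul_mem x hx y hy =>
    rw [smul_mul']
    exact Ideal.mul_mem_mul (smul_mem_of_mem_inertia hσ hx) (smul_mem_of_mem_inertia hσ hy)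
  | add x _ y _ hx hy =>
    rw [smul_add]
    exact add_mem hx hy

variable (Γ) in
/-- The subgroup of the inertia group of `Q` acting trivially on `Q / Q ^ 2`. -/
def wildInertia : Subgroup Γ where
  carrier := {σ | σ ∈ Q.inertia Γ ∧ ∀ x ∈ Q, σ • x - x ∈ Q ^ 2}
  one_mem' := ⟨one_mem _, fun x _ => by simp⟩
  mul_mem' := by
    rintro σ τ ⟨hσ, hσ'⟩ ⟨hτ, hτ'⟩
    refine ⟨mul_mem hσ hτ, fun x hx => ?_⟩
    have h1 := add_mem (hσ' _ (smul_mem_of_mem_inertia hτ hx)) (hτ' x hx)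
    rwa [sub_add_sub_cancel, smul_smul] at h1
  inv_mem' := by
    rintro σ ⟨hσ, hσ'⟩
    refine ⟨inv_mem hσ, fun x hx => ?_⟩
    have h1 := hσ' _ (smul_mem_of_mem_inertia (inv_mem hσ) hx)
    rw [smul_inv_smul] at h1
    rw [← neg_sub]
    exact neg_mem h1

theorem conj_mem_wildInertia {σ τ : Γ} (hσ : σ ∈ wildInertia Γ Q) (hτ : τ ∈ Q.inertia Γ) :
    τ * σ * τ⁻¹ ∈ wildInertia Γ Q := by
  refine ⟨mul_mem (mul_mem hτ hσ.1) (inv_mem hτ), fun x hx => ?_⟩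
  have h1 := smul_mem_sq_of_mem_inertia hτ (hσ.2 _ (smul_mem_of_mem_inertia (inv_mem hτ) hx))
  rwa [smul_sub, smul_inv_smul, smul_smul, smul_smul] at h1

variable {Q}

/-- Trivial action on Q/Q² propagates to all higher graded pieces by σ(xy) − xy = σx · (σy − y) +
(σx − x) · y. -/
theorem smul_sub_mem_pow_succ {σ : Γ} (hσ : σ ∈ wildInertia Γ Q) (n : ℕ) {x : S}
    (hx : x ∈ Q ^ (n + 1)) : σ • x - x ∈ Q ^ (n + 2) := by
  induction n generalizing x with
  | zero =>
    rw [zero_add, pow_one] at hx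
    exact hσ.2 x hx
  | succ n ih =>
    rw [pow_succ'] at hx
    induction hx using Submodule.mul_induction_on' with
    | mem_mul_mem x hx y hy =>
      have h1 : σ • (x * y) - x * y = σ • x * (σ • y - y) + (σ • x - x) * y := by
        rw [smul_mul']
        ring
      rw [h1]
      refine add_mem ?_ ?_
      · rw [show n + 1 + 2 = (n + 2) + 1 by rfl, pow_succ']
        exact Ideal.mul_mem_mul (smul_mem_of_mem_inertia hσ.1 hx) (ih hy)
      · rw [show n + 1 + 2 = 2 + (n + 1) by ring, pow_add]
        exact Ideal.mul_mem_mul (hσ.2 x hx) hy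
    | add x _ y _ hx hy =>
      rw [smul_add, add_sub_add_comm]
      exact add_mem hx hy

/-- The difference σx − x lies in a graded piece on which σ is trivial, so iterating σ adds the same
difference each time. -/
theorem pow_smul_sub_sub_mem {σ : Γ} (hσ : σ ∈ wildInertia Γ Q) {j : ℕ}
    (h : ∀ x : S, σ • x - x ∈ Q ^ (j + 1)) (n : ℕ) (x : S) :
    σ ^ n • x - x - (n : S) * (σ • x - x) ∈ Q ^ (j + 2) := by
  induction n with
  | zero => simp
  | succ n ih =>
    have h1 : σ ^ (n + 1) • x - x - ((n + 1 : ℕ) : S) * (σ • x - x) =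
        (σ ^ n • x - x - (n : S) * (σ • x - x)) +
          (σ • (σ ^ n • x - x) - (σ ^ n • x - x)) := by
      rw [pow_succ', mul_smul, smul_sub]
      push_cast
      ring
    rw [h1]
    refine add_mem ih (smul_sub_mem_pow_succ hσ j ?_)
    have h2 := add_mem (Ideal.pow_le_pow_right (Nat.le_succ (j + 1)) ih)
      (Ideal.mul_mem_left _ (n : S) (h x))
    rwa [sub_add_cancel] at h2

/-- An element of `wildInertia Γ Q` of order prime to the residue characteristic is trivial. -/
theorem eq_one_of_mem_wildInertia [IsDedekindDomain S] [FaithfulSMul Γ S]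
    [Q.IsPrime] {σ : Γ} (hσ : σ ∈ wildInertia Γ Q) {n : ℕ} (hn : σ ^ n = 1) (hnQ : (n : S) ∉ Q) :
    σ = 1 := by
  have h1 (j : ℕ) : ∀ x : S, σ • x - x ∈ Q ^ (j + 1) := by
    induction j with
    | zero =>
      intro x
      rw [zero_add, pow_one]
      exact hσ.1 x
    | succ j ih =>
      intro x
      -- Since σⁿ = 1, this puts n(σx − x) in the next power of Q, and n is prime to Q. Hence σx − x
      -- lies in every power of Q, whose intersection is zero.
      have h2 := pow_smul_sub_sub_mem hσ ih n x
      rw [hn, one_smul, sub_self, zero_sub, neg_mem_iff] at h2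
      exact (Ideal.IsPrime.mul_mem_pow Q h2).resolve_left hnQ
  refine FaithfulSMul.eq_of_smul_eq_smul (α := S) fun x => ?_
  rw [one_smul, ← sub_eq_zero, ← Ideal.mem_bot, ← Ideal.iInf_pow_eq_bot_of_isDomain Q
    (Ideal.IsPrime.ne_top inferInstance), Ideal.mem_iInf]
  intro j
  exact Ideal.pow_le_pow_right (Nat.le_succ j) (h1 j x)

theorem pow_smul_sub_mul_mem_sq {σ : Γ} (hσ : σ ∈ Q.inertia Γ) {π u : S} (hπ : π ∈ Q)
    (hu : σ • π - u * π ∈ Q ^ 2) (n : ℕ) : σ ^ n • π - u ^ n * π ∈ Q ^ 2 := by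
  induction n with
  | zero => simp
  | succ n ih =>
    have h1 : σ ^ (n + 1) • π - u ^ (n + 1) * π = σ • (σ ^ n • π - u ^ n * π) +
        ((σ • u ^ n - u ^ n) * σ • π + u ^ n * (σ • π - u * π)) := by
      rw [pow_succ', mul_smul, smul_sub, smul_mul']
      ring
    rw [h1]
    refine add_mem (smul_mem_sq_of_mem_inertia hσ ih) (add_mem ?_ (Ideal.mul_mem_left _ _ hu))
    rw [pow_two]
    exact Ideal.mul_mem_mul (hσ _) (smul_mem_of_mem_inertia hσ hπ)

/-- An element of the inertia group whose order is a power of the residue characteristic acts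
trivially on `Q / Q ^ 2`. -/
theorem mem_wildInertia_of_pow_eq_one [IsDedekindDomain S] [Q.IsPrime] (hQ : Q ≠ ⊥) {p : ℕ}
    (hp : p.Prime) [CharP (S ⧸ Q) p] {σ : Γ} (hσ : σ ∈ Q.inertia Γ) {m : ℕ} (hm : σ ^ p ^ m = 1) :
    σ ∈ wildInertia Γ Q := by
  have : Fact p.Prime := ⟨hp⟩
  -- Such a π generates Q modulo Q², so σ acts on Q/Q² through one multiplier u, determined by σπ ≡
  -- uπ.
  obtain ⟨π, hπ, hπ2⟩ : ∃ π ∈ Q, π ∉ Q ^ 2 := by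
    by_contra! h
    exact (Ideal.pow_lt_self Q hQ (Ideal.IsPrime.ne_top inferInstance) 2 le_rfl).not_ge h
  have key (c : S) (hc : c ∈ Q) : ∃ d, c - d * π ∈ Q ^ 2 := by
    obtain ⟨d, e, he, h⟩ := Ideal.exists_mul_add_mem_pow_succ (P := Q) hQ (i := 1) π c
      (by rwa [pow_one]) hπ2 (by rwa [pow_one])
    refine ⟨d, ?_⟩
    rw [← h, mul_comm, add_sub_cancel_left]
    exact he
  obtain ⟨u, hu⟩ := key _ (smul_mem_of_mem_inertia hσ hπ)
  have h1 := pow_smul_sub_mul_mem_sq hσ hπ hu (p ^ m)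
  rw [hm, one_smul] at h1
  have h2 : 1 - u ^ p ^ m ∈ Q := by
    refine (Ideal.IsPrime.mul_mem_pow Q (n := 2) (a := 1 - u ^ p ^ m) (b := π) ?_).resolve_right hπ2
    rwa [sub_mul, one_mul]
  -- In characteristic p the only root of unity of p-power order is 1, as (1 − u)^(p^m) = 1 −
  -- u^(p^m).
  have h3 : 1 - u ∈ Q := by
    rw [← Ideal.Quotient.eq_zero_iff_mem] at h2 ⊢
    rw [map_sub, map_pow, map_one] at h2
    rw [map_sub, map_one]
    refine pow_eq_zero_iff (pow_ne_zero m hp.ne_zero) |>.1 ?_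
    rw [sub_pow_char_pow, one_pow, h2]
  refine ⟨hσ, fun x hx => ?_⟩
  obtain ⟨d, hd⟩ := key x hx
  have h4 : σ • x - x = σ • (x - d * π) - (x - d * π) + ((σ • d - d) * σ • π +
      d * ((σ • π - u * π) - (1 - u) * π)) := by
    rw [smul_sub, smul_mul']
    ring
  rw [h4]
  refine add_mem (sub_mem (smul_mem_sq_of_mem_inertia hσ hd) hd) (add_mem ?_
    (Ideal.mul_mem_left _ _ (sub_mem hu ?_)))
  · rw [pow_two]
    exact Ideal.mul_mem_mul (hσ _) (smul_mem_of_mem_inertia hσ hπ)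
  · rw [pow_two]
    exact Ideal.mul_mem_mul h3 hπ

/-- The power of σ by the p-part of its order has order prime to p, so it is trivial by
`eq_one_of_mem_wildInertia`. -/
theorem isPGroup_wildInertia [IsDedekindDomain S] [FaithfulSMul Γ S] [Finite Γ]
    [Q.IsPrime] {p : ℕ} (hp : p.Prime) [CharP (S ⧸ Q) p] : IsPGroup p (wildInertia Γ Q) := by
  rintro ⟨σ, hσ⟩
  obtain ⟨k, m, hm, h⟩ := Nat.exists_eq_pow_mul_and_not_dvd (orderOf_pos σ).ne' p hp.ne_one
  refine ⟨k, Subtype.ext ?_⟩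
  refine eq_one_of_mem_wildInertia (Q := Q) (n := m) (pow_mem hσ _) ?_ ?_
  · rw [SubgroupClass.coe_pow, ← pow_mul, ← h, pow_orderOf_eq_one]
  · rw [← Ideal.Quotient.eq_zero_iff_mem, map_natCast, CharP.cast_eq_zero_iff (S ⧸ Q) p]
    exact hm

/-- Elements of p-power order in inertia are wild, so a Sylow p-subgroup containing the wild inertia
group coincides with it. -/
theorem not_dvd_relIndex_wildInertia [IsDedekindDomain S] [FaithfulSMul Γ S] [Finite Γ]
    [Q.IsPrime] (hQ : Q ≠ ⊥) {p : ℕ} (hp : p.Prime) [CharP (S ⧸ Q) p] :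
    ¬ p ∣ (wildInertia Γ Q).relIndex (Q.inertia Γ) := by
  have : Fact p.Prime := ⟨hp⟩
  have hV : IsPGroup p ((wildInertia Γ Q).subgroupOf (Q.inertia Γ)) :=
    (isPGroup_wildInertia hp).comap_subtype
  obtain ⟨P, hP⟩ := hV.exists_le_sylow
  have hle : (P : Subgroup (Q.inertia Γ)) ≤ (wildInertia Γ Q).subgroupOf (Q.inertia Γ) := by
    intro σ hσ
    obtain ⟨m, hm⟩ := P.2 ⟨σ, hσ⟩
    refine Subgroup.mem_subgroupOf.2
      (mem_wildInertia_of_pow_eq_one (σ := (σ : Γ)) hQ hp σ.2 (m := m) ?_)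
    simpa using congrArg (fun x : P => ((x : Q.inertia Γ) : Γ)) hm
  rw [Subgroup.relIndex, le_antisymm hP hle]
  exact P.not_dvd_index

/-- A subgroup of the inertia group of index prime to the residue characteristic contains the wild
inertia group. -/
theorem wildInertia_le [IsDedekindDomain S] [FaithfulSMul Γ S] [Finite Γ]
    [Q.IsPrime] {p : ℕ} (hp : p.Prime) [CharP (S ⧸ Q) p] {H : Subgroup Γ}
    (hH : ¬ p ∣ H.relIndex (Q.inertia Γ)) : wildInertia Γ Q ≤ H := by
  have : Fact p.Prime := ⟨hp⟩
  let H' := H.subgroupOf (Q.inertia Γ)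
  let V := (wildInertia Γ Q).subgroupOf (Q.inertia Γ)
  have hV : IsPGroup p V := (isPGroup_wildInertia hp).comap_subtype
  -- A p-group acting on a set of cardinality prime to p fixes a point gH', so g⁻¹Vg ⊆ H'; normality
  -- of V in inertia then removes g.
  obtain ⟨x, hx⟩ := hV.nonempty_fixed_point_of_prime_not_dvd_card (Q.inertia Γ ⧸ H') hH
  obtain ⟨g, rfl⟩ := QuotientGroup.mk_surjective x
  intro σ hσ
  have h1 : (g : Γ) * σ * (g : Γ)⁻¹ ∈ wildInertia Γ Q := conj_mem_wildInertia Q hσ g.2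
  have h2 := hx ⟨⟨_, h1.1⟩, h1⟩
  have h3 := QuotientGroup.eq.1 h2.symm
  have h4 : (g : Γ)⁻¹ * (g * σ * (g : Γ)⁻¹ * g) ∈ H := h3
  rwa [inv_mul_cancel_right, inv_mul_cancel_left] at h4

/-- The wild inertia group lies in every `H i`, hence in `H₀`, whose index in inertia therefore
divides the prime-to-p index of the wild inertia group. -/
theorem not_dvd_relIndex_of_iInf_le [IsDedekindDomain S] [FaithfulSMul Γ S] [Finite Γ]
    [Q.IsPrime] (hQ : Q ≠ ⊥) {p : ℕ} (hp : p.Prime) [CharP (S ⧸ Q) p] {ι : Type*}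
    {H : ι → Subgroup Γ} (hH : ∀ i, ¬ p ∣ (H i).relIndex (Q.inertia Γ)) {H₀ : Subgroup Γ}
    (hle : ⨅ i, H i ≤ H₀) : ¬ p ∣ H₀.relIndex (Q.inertia Γ) := fun h =>
  not_dvd_relIndex_wildInertia hQ hp (h.trans (Subgroup.relIndex_dvd_of_le_left _
    ((le_iInf fun i => wildInertia_le hp (hH i)).trans hle)))

end WildInertia

/-! ### Composita of tame extensions inside a finite Galois extension. -/

section TameCompositum

theorem perfectField_residueField {K : Type*} [Field K] [NumberField K] {v : Ideal (𝓞 K)}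
    [v.IsPrime] (hv : v ≠ ⊥) : PerfectField v.ResidueField := by
  have : v.IsMaximal := Ideal.IsPrime.isMaximal inferInstance hv
  have : Finite (𝓞 K ⧸ v) := Ideal.finiteQuotientOfFreeOfNeBot v hv
  have : Finite v.ResidueField :=
    Finite.of_surjective _ (Ideal.bijective_algebraMap_quotient_residueField v).2
  infer_instance

/-- The order of the inertia group is the ramification index. -/
theorem card_inertia_eq_ramificationIdx {K L : Type*} [Field K] [Field L] [NumberField K]
    [NumberField L] [Algebra K L] [IsGalois K L] (Q : Ideal (𝓞 L)) [Q.IsPrime] (hQ : Q ≠ ⊥) :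
    Nat.card (Q.inertia Gal(L/K)) = Q.ramificationIdx (𝓞 K) := by
  have h0 : Q.under (𝓞 K) ≠ ⊥ := Ideal.under_ne_bot _ hQ
  have := perfectField_residueField h0
  rw [Ideal.card_inertia_eq_ramificationIdxIn (Q.under (𝓞 K)) Q,
    Ideal.ramificationIdxIn_eq_ramificationIdx (Q.under (𝓞 K)) Q Gal(L/K)]

variable {K M : Type*} [Field K] [Field M] [NumberField K] [NumberField M] [Algebra K M]
  [IsGalois K M]

/-- The ramification index of the prime of `L` below `Q` is the index of the inertia group of `Q`
over `L` in the inertia group of `Q` over `K`. -/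
theorem relIndex_fixingSubgroup_inertia (L : IntermediateField K M) (Q : Ideal (𝓞 M)) [Q.IsPrime]
    (hQ : Q ≠ ⊥) : L.fixingSubgroup.relIndex (Q.inertia Gal(M/K)) =
      (Q.under (𝓞 L)).ramificationIdx (𝓞 K) := by
  have : FiniteDimensional K M := inferInstance
  have : NumberField L := NumberField.of_module_finite K L
  -- Lagrange's theorem for inertia over L inside inertia over K is compared with multiplicativity
  -- of ramification indices in the tower.
  have h1 := Subgroup.card_mul_index (L.fixingSubgroup.subgroupOf (Q.inertia Gal(M/K)))
  have h2 : Nat.card (L.fixingSubgroup.subgroupOf (Q.inertia Gal(M/K))) =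
      Nat.card (Q.inertia Gal(M/L)) := by
    refine Nat.card_congr
      { toFun := fun σ => ⟨L.fixingSubgroupEquiv ⟨σ.1.1, σ.2⟩, fun x => σ.1.2 x⟩
        invFun := fun τ => ⟨⟨(L.fixingSubgroupEquiv.symm τ.1).1, fun x => τ.2 x⟩,
          (L.fixingSubgroupEquiv.symm τ.1).2⟩
        left_inv := fun σ => rfl
        right_inv := fun τ => rfl }
  rw [h2, card_inertia_eq_ramificationIdx Q hQ, card_inertia_eq_ramificationIdx Q hQ,
    Ideal.ramificationIdx_tower (R := 𝓞 K) (Q.under (𝓞 L)) Q, mul_comm] at h1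
  refine Nat.eq_of_mul_eq_mul_right ?_ h1
  rw [← card_inertia_eq_ramificationIdx Q hQ]
  exact Nat.card_pos

/-- At a prime `Q` of the Galois extension M, all residue characteristics agree and tameness of a
subfield says that its fixing group has prime-to-p index in inertia. Composita correspond to
intersections, so the group-theoretic lemma applies. -/
theorem IsTame.of_le_iSup {ι : Type*} {F : ι → IntermediateField K M} (hF : ∀ i, IsTame K (F i))
    {L : IntermediateField K M} (hL : L ≤ ⨆ i, F i) : IsTame K L := by
  intro P hP hP0
  have : NumberField L := NumberField.of_module_finite K L
  have hPmax : P.IsMaximal := Ideal.IsPrime.isMaximal hP hP0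
  obtain ⟨Q, hQ, hQP⟩ := Ideal.exists_maximal_ideal_liesOver_of_isIntegral (S := 𝓞 M) P
  have hQ0 : Q ≠ ⊥ := Ideal.ne_bot_of_liesOver_of_ne_bot hP0 Q
  have hchar (E : IntermediateField K M) :
      ringChar (𝓞 E ⧸ Q.under (𝓞 E)) = ringChar (𝓞 M ⧸ Q) := by
    have : CharP (𝓞 M ⧸ Q) (ringChar (𝓞 E ⧸ Q.under (𝓞 E))) :=
      charP_of_injective_ringHom (f := Ideal.quotientMap Q (algebraMap (𝓞 E) (𝓞 M)) le_rfl)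
        Ideal.quotientMap_injective _
    exact (ringChar.eq (𝓞 M ⧸ Q) _).symm
  have hp : (ringChar (𝓞 M ⧸ Q)).Prime := by
    have : Finite (𝓞 M ⧸ Q) := Ideal.finiteQuotientOfFreeOfNeBot Q hQ0
    exact (CharP.char_is_prime_or_zero (𝓞 M ⧸ Q) _).resolve_right
      (CharP.char_ne_zero_of_finite (𝓞 M ⧸ Q) _)
  have hP' : P = Q.under (𝓞 L) := Q.over_def P
  rw [hP', hchar, ← relIndex_fixingSubgroup_inertia L Q hQ0]
  have : FaithfulSMul Gal(M/K) (𝓞 M) := IsGaloisGroup.faithful (𝓞 K)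
  refine not_dvd_relIndex_of_iInf_le (H := fun i => (F i).fixingSubgroup) hQ0 hp (fun i => ?_) ?_
  · have : NumberField (F i) := NumberField.of_module_finite K (F i)
    rw [relIndex_fixingSubgroup_inertia (F i) Q hQ0, ← hchar (F i)]
    exact hF i _ inferInstance (Ideal.under_ne_bot _ hQ0)
  · rw [← IntermediateField.le_iff_le]
    refine hL.trans (iSup_le fun i => ?_)
    rw [IntermediateField.le_iff_le]
    exact iInf_le _ i

end TameCompositum

/-! ### Finite subextensions of the tame closure. -/

section TameClosure

variable {K : Type*} [Field K] [NumberField K]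

/-- A finite extension of `K` contained in the tame closure is tame. -/
theorem IsTame.of_le_tameClosure {L : IntermediateField K (AlgebraicClosure K)}
    [FiniteDimensional K L] (hL : L ≤ tameClosure K) : IsTame K L := by
  have hfg : L.FG := IntermediateField.essFiniteType_iff.1 inferInstance
  obtain ⟨s, rfl⟩ := hfg
  -- A finitely generated field is a compact element of the lattice of intermediate fields, so
  -- finitely many tame fields contain L in their compositum. Their normal closure is the finite
  -- Galois extension in which the argument takes place.
  obtain ⟨t, ht, hle⟩ := (CompleteLattice.isCompactElement_iff_exists_le_sSup_of_le_sSup _ _).1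
    (IntermediateField.adjoin_finset_isCompactElement (F := K) s) _ hL
  let N := IntermediateField.normalClosure K
    (⨆ E : t, (E : IntermediateField K (AlgebraicClosure K)) : IntermediateField K _)
    (AlgebraicClosure K)
  have hfin (E : t) : FiniteDimensional K (E : IntermediateField K (AlgebraicClosure K)) :=
    (ht E.2).1
  have : NumberField N := NumberField.of_module_finite K N
  have hN : (⨆ E : t, (E : IntermediateField K (AlgebraicClosure K))) ≤ N :=
    IntermediateField.le_normalClosure _
  have htN (E : t) : (E : IntermediateField K (AlgebraicClosure K)) ≤ N := (le_iSup _ E).trans hN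
  have hle' : IntermediateField.adjoin K (s : Set (AlgebraicClosure K)) ≤
      ⨆ E : t, (E : IntermediateField K (AlgebraicClosure K)) := by
    rw [Finset.sup_id_eq_sSup, sSup_eq_iSup'] at hle
    exact hle
  have hsN := hle'.trans hN
  have hNF (E : IntermediateField K (AlgebraicClosure K)) [FiniteDimensional K E] :
      NumberField E := NumberField.of_module_finite K E
  have htame : IsTame K (IntermediateField.restrict hsN) := by
    refine IsTame.of_le_iSup (F := fun E : t => IntermediateField.restrict (htN E)) (fun E => ?_) ?_
    · have := hNF E
      exact (ht E.2).2.of_ringEquiv (RingEquiv.refl K)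
        (IntermediateField.restrictAlgEquiv (htN E) : _ ≃+* _)
        fun x => AlgEquiv.commutes (IntermediateField.restrictAlgEquiv (htN E)) x
    · intro x hx
      have h1 := hle' ((IntermediateField.mem_restrict hsN x).1 hx)
      have h2 : (⨆ E : t, (E : IntermediateField K (AlgebraicClosure K))) ≤
          (⨆ E : t, IntermediateField.restrict (htN E)).map N.val := by
        refine iSup_le fun E y hy => ?_
        refine ⟨⟨y, htN E hy⟩, ?_, rfl⟩
        exact le_iSup (fun E : t => IntermediateField.restrict (htN E)) E
          ((IntermediateField.mem_restrict (htN E) _).2 hy)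
      obtain ⟨y, hy, hyx⟩ := h2 h1
      rwa [← Subtype.ext hyx]
  exact htame.of_ringEquiv (RingEquiv.refl K)
    ((IntermediateField.restrictAlgEquiv hsN).symm : _ ≃+* _)
    fun x => AlgEquiv.commutes (IntermediateField.restrictAlgEquiv hsN).symm x

theorem not_dvd_card_inertia_of_le_tameClosure {L : IntermediateField K (AlgebraicClosure K)}
    [FiniteDimensional K L] [IsGalois K L] (hL : L ≤ tameClosure K) (Q : Ideal (𝓞 L))
    (hQ : Q.IsPrime) (hQ0 : Q ≠ ⊥) : ¬ ringChar (𝓞 L ⧸ Q) ∣ Nat.card (Q.inertia Gal(L/K)) := by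
  have : NumberField L := NumberField.of_module_finite K L
  rw [card_inertia_eq_ramificationIdx Q hQ0]
  exact IsTame.of_le_tameClosure hL Q hQ hQ0

end TameClosure

/-! ### The field Kʰ and its Galois group. -/

section KernelField

variable {K G : Type*} [Field K] [NumberField K] [CommGroup G] [TopologicalSpace G]
  [DiscreteTopology G] (h : Gal((tameClosure K)/K) →ₜ* G)

theorem continuous_inflate : Continuous (inflate h) :=
  h.continuous_toFun.comp (InfiniteGalois.restrictNormalHom_continuous (tameClosure K))

/-- The field `Kʰ`, the fixed field of the kernel of `h` in `Kᶜ`. -/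
noncomputable abbrev kerField : IntermediateField K (AlgebraicClosure K) :=
  IntermediateField.fixedField (inflate h).ker

theorem isOpen_ker_inflate : IsOpen ((inflate h).ker : Set Gal((AlgebraicClosure K)/K)) :=
  (isOpen_discrete ({1} : Set G)).preimage (continuous_inflate h)

theorem fixingSubgroup_kerField : (kerField h).fixingSubgroup = (inflate h).ker :=
  InfiniteGalois.fixingSubgroup_fixedField
    ⟨(inflate h).ker, Subgroup.isClosed_of_isOpen _ (isOpen_ker_inflate h)⟩

instance finiteDimensional_kerField : FiniteDimensional K (kerField h) := by
  rw [← InfiniteGalois.isOpen_iff_finite, fixingSubgroup_kerField]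
  exact isOpen_ker_inflate h

instance isGalois_kerField : IsGalois K (kerField h) := by
  rw [← InfiniteGalois.normal_iff_isGalois, fixingSubgroup_kerField]
  infer_instance

instance numberField_kerField : NumberField (kerField h) :=
  NumberField.of_module_finite K (kerField h)

/-- The inflation of h is trivial on the automorphisms fixing Kᵗ, so the Galois correspondence
applies. -/
theorem kerField_le_tameClosure : kerField h ≤ tameClosure K := by
  rw [← InfiniteGalois.fixedField_fixingSubgroup (tameClosure K)]
  refine IntermediateField.fixedField_antitone fun ω hω => ?_
  rw [← IntermediateField.restrictNormalHom_ker] at hω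
  rw [MonoidHom.mem_ker, inflate, MonoidHom.comp_apply, MonoidHom.mem_ker.1 hω, map_one]

theorem restrictNormalHom_eq_iff (ω ω' : Gal((AlgebraicClosure K)/K)) :
    AlgEquiv.restrictNormalHom (kerField h) ω = AlgEquiv.restrictNormalHom (kerField h) ω' ↔
      inflate h ω = inflate h ω' := by
  rw [← div_eq_one, ← map_div, ← MonoidHom.mem_ker, IntermediateField.restrictNormalHom_ker,
    fixingSubgroup_kerField, MonoidHom.mem_ker, map_div, div_eq_one]

theorem exists_galKerField_hom : ∃ η : Gal((kerField h)/K) →* G, Function.Injective η ∧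
    ∀ ω, η (AlgEquiv.restrictNormalHom (kerField h) ω) = inflate h ω := by
  have hs : Function.Surjective (AlgEquiv.restrictNormalHom (kerField h) :
      Gal((AlgebraicClosure K)/K) →* Gal((kerField h)/K)) := AlgEquiv.restrictNormalHom_surjective _
  choose t ht using hs
  have hη (ω) : inflate h (t (AlgEquiv.restrictNormalHom (kerField h) ω)) = inflate h ω := by
    rw [← restrictNormalHom_eq_iff, ht]
  refine ⟨{ toFun := fun γ => inflate h (t γ), map_one' := ?_, map_mul' := fun γ δ => ?_ }, ?_, hη⟩
  · rw [← map_one (AlgEquiv.restrictNormalHom (K₁ := AlgebraicClosure K) (kerField h)), hη, map_one]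
  · rw [← map_mul, ← restrictNormalHom_eq_iff, ht, map_mul, ht, ht]
  · intro γ δ hγδ
    rw [← ht γ, ← ht δ, restrictNormalHom_eq_iff]
    exact hγδ

theorem galKerField_mul_comm (σ τ : Gal((kerField h)/K)) : σ * τ = τ * σ := by
  obtain ⟨η, hη, -⟩ := exists_galKerField_hom h
  exact hη (by rw [map_mul, map_mul, mul_comm])

/-- The inclusion of the ring of integers of `Kʰ` in `Kᶜ`. -/
noncomputable def intEmb : 𝓞 (kerField h) →ₗ[𝓞 K] AlgebraicClosure K :=
  { toFun := fun x => ((x : kerField h) : AlgebraicClosure K)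
    map_add' := fun _ _ => rfl
    map_smul' := fun r x => by
      rw [Algebra.smul_def, Algebra.smul_def]
      rfl }

theorem intEmb_injective : Function.Injective (intEmb h) := fun _ _ hxy =>
  NumberField.RingOfIntegers.ext (Subtype.ext hxy)

theorem isIntegral_intEmb (x : 𝓞 (kerField h)) : IsIntegral ℤ (intEmb h x) :=
  (NumberField.RingOfIntegers.isIntegral_coe x).algebraMap

theorem intEmb_mem (x : 𝓞 (kerField h)) : intEmb h x ∈ kerField h := (x : kerField h).2

theorem exists_intEmb_eq {x : AlgebraicClosure K} (hx : x ∈ kerField h) (hx' : IsIntegral ℤ x) :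
    ∃ y, intEmb h y = x :=
  ⟨⟨⟨x, hx⟩, (isIntegral_algebraMap_iff (R := ℤ) (A := kerField h)
    (algebraMap (kerField h) (AlgebraicClosure K)).injective).1 hx'⟩, rfl⟩

theorem apply_intEmb (ω : Gal((AlgebraicClosure K)/K)) (x : 𝓞 (kerField h)) :
    ω (intEmb h x) = intEmb h (AlgEquiv.restrictNormalHom (kerField h) ω • x) :=
  (AlgEquiv.restrictNormal_commutes ω (kerField h) (x : kerField h)).symm

end KernelField

/-! ### Local freeness of 𝓞_h. -/

namespace IntegralMaps

variable {K G : Type*} [Field K] [NumberField K] [CommGroup G] [TopologicalSpace G]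
  (h : Gal((tameClosure K)/K) →ₜ* G)

theorem smul_apply [Fintype G] (r : G → 𝓞 K) (a : IntegralMaps h) (t : G) :
    ((∑ s, GroupRing.single s (r s) : GroupRing K G) • a).1 t = ∑ s, r s • a.1 (t * s) := by
  rw [Finset.sum_smul, AddSubmonoidClass.coe_finsetSum, Finset.sum_apply]
  exact Finset.sum_congr rfl fun s _ => by rw [single_smul]; rfl

variable [DiscreteTopology G]

-- The module 𝓞_h is induced from 𝓞_{Kʰ} along η : Gal(Kʰ/K) → G. A local normal basis generator y
-- of 𝓞_{Kʰ}, spread equivariantly over the image of η, is a local generator of 𝓞_h.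
open Classical in
theorem locGenAll [Finite G] : LocGenAll (𝓞 K) (GroupRing K G) (IntegralMaps h) := by
  intro v
  have : Fintype G := Fintype.ofFinite G
  have : Fintype Gal((kerField h)/K) := Fintype.ofFinite _
  obtain ⟨η, hη, hηr⟩ := exists_galKerField_hom h
  have hs : Function.Surjective (AlgEquiv.restrictNormalHom (kerField h) :
      Gal((AlgebraicClosure K)/K) →* Gal((kerField h)/K)) := AlgEquiv.restrictNormalHom_surjective _
  obtain ⟨y, a, ha, hgen, hinj⟩ := exists_local_normal_basis (galKerField_mul_comm h)
    (not_dvd_card_inertia_of_le_tameClosure (kerField_le_tameClosure h)) v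
  -- The value at η(γ) is γy, and 0 off the image of η. The other cosets of the image are reached by
  -- translation with elements of G.
  let y' : G → 𝓞 (kerField h) := fun s => if H : ∃ γ, η γ = s then H.choose • y else 0
  have hy' (γ) : y' (η γ) = γ • y := by
    have H : ∃ δ, η δ = η γ := ⟨γ, rfl⟩
    simp only [y', dif_pos H]
    rw [hη H.choose_spec]
  have hy0 (s) (hs : s ∉ Set.range η) : y' s = 0 := dif_neg hs
  have hmem : (fun s => intEmb h (y' s)) ∈ IntegralMaps h := by
    refine ⟨fun s => ⟨intEmb_mem h _, isIntegral_intEmb h _⟩, fun ω s => ?_⟩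
    change intEmb h (y' (inflate h ω * s)) = ω (intEmb h (y' s))
    rw [apply_intEmb, ← hηr]
    refine congrArg _ ?_
    by_cases hsr : s ∈ Set.range η
    · obtain ⟨γ, rfl⟩ := hsr
      rw [← map_mul, hy', hy', mul_smul]
    · rw [hy0 s hsr, hy0, smul_zero]
      rintro ⟨γ, hγ⟩
      exact hsr ⟨(AlgEquiv.restrictNormalHom (kerField h) ω)⁻¹ * γ, by
        rw [map_mul, hγ, map_inv, inv_mul_cancel_left]⟩
  let x : IntegralMaps h := ⟨_, hmem⟩
  have hx (r : G → 𝓞 K) (t : G) : ((∑ s, GroupRing.single s (r s) : GroupRing K G) • x).1 t =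
      intEmb h (∑ γ, r (t⁻¹ * η γ) • γ • y) := by
    rw [smul_apply, map_sum, ← Equiv.sum_comp (Equiv.mulLeft t⁻¹)]
    symm
    refine Fintype.sum_of_injective η hη _ _ (fun u hu => ?_) fun γ => ?_
    · change r (t⁻¹ * u) • intEmb h (y' (t * (t⁻¹ * u))) = 0
      rw [mul_inv_cancel_left, hy0 u hu, map_zero]
      exact smul_zero _
    · change _ = r (t⁻¹ * η γ) • intEmb h (y' (t * (t⁻¹ * η γ)))
      rw [mul_inv_cancel_left, hy', LinearMap.map_smul]
      rfl
  have hrep (r : GroupRing K G) : ∃ f : G → 𝓞 K, r = ∑ s, GroupRing.single s (f s) := by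
    refine ⟨fun s => MonoidAlgebra.coeff (show MonoidAlgebra (𝓞 K) G from r) s, ?_⟩
    have h1 := MonoidAlgebra.sum_coeff_single (show MonoidAlgebra (𝓞 K) G from r)
    rw [Finsupp.sum_fintype _ _ fun s => MonoidAlgebra.single_zero s] at h1
    exact h1.symm
  refine ⟨x, a, ha, fun b => ?_, fun r hr => ?_⟩
  · choose b' hb' using fun t => exists_intEmb_eq h (b.2.1 t).1 (b.2.1 t).2
    choose c hc using fun t => hgen (b' t)
    -- Uniqueness of coordinates in the local normal basis turns the equivariance of b into
    -- equivariance of its coordinates, so those at γ = 1 determine all others.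
    have hcη (γ : Gal((kerField h)/K)) (t : G) (δ) : c (η γ * t) (γ * δ) = c t δ := by
      obtain ⟨ω, rfl⟩ := hs γ
      set γ := AlgEquiv.restrictNormalHom (kerField h) ω
      have h1 : b' (η γ * t) = γ • b' t := by
        apply intEmb_injective h
        rw [hb', ← apply_intEmb, hb', hηr]
        exact b.2.2 ω t
      have h2 : ∑ δ, (c (η γ * t) (γ * δ) - c t δ) • δ • y = 0 := by
        have h3 : ∑ δ, c (η γ * t) (γ * δ) • (γ * δ) • y = ∑ δ, c t δ • (γ * δ) • y := by
          refine (Equiv.sum_comp (Equiv.mulLeft γ) fun δ => c (η γ * t) δ • δ • y).trans ?_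
          rw [← hc, h1, ← smul_comm γ a, hc, Finset.smul_sum]
          exact Finset.sum_congr rfl fun δ _ => by rw [smul_comm γ, mul_smul]
        have h4 := sub_eq_zero.2 h3
        rw [← Finset.sum_sub_distrib] at h4
        rw [← smul_eq_zero_iff_eq γ, Finset.smul_sum, ← h4]
        exact Finset.sum_congr rfl fun δ _ => by
          rw [smul_comm γ, sub_smul, mul_smul]
      exact sub_eq_zero.1 (congrFun (hinj _ h2) δ)
    -- By `hx` the coefficient r must satisfy r(t⁻¹ η(γ)) = c t γ; taking t = s⁻¹ and γ = 1 forces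
    -- r(s) = c s⁻¹ 1, and `hcη` gives the remaining equations.
    refine ⟨∑ s, GroupRing.single s (c s⁻¹ 1), Subtype.ext (funext fun t => ?_)⟩
    rw [hx]
    change a • b.1 t = _
    rw [← hb', ← map_smul, hc]
    congr 1
    refine Finset.sum_congr rfl fun γ _ => ?_
    rw [← hcη γ _ 1, mul_one, mul_inv_rev, inv_inv, mul_inv_cancel_left]
  · obtain ⟨f, rfl⟩ := hrep r
    refine Finset.sum_eq_zero fun s _ => ?_
    have h1 : intEmb h (∑ γ, f ((s⁻¹)⁻¹ * η γ) • γ • y) = 0 := by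
      rw [← hx, hr]
      rfl
    have h2 := congrFun (hinj (fun γ => f ((s⁻¹)⁻¹ * η γ))
      ((map_eq_zero_iff _ (intEmb_injective h)).1 h1)) 1
    simp only [inv_inv, map_one, mul_one] at h2
    rw [h2]
    exact MonoidAlgebra.single_zero s

/-- The module `𝓞_h` is a locally free lattice. -/
theorem isLFLattice [Finite G] : IsLFLattice h :=
  let X := LFLattice.ofLocGenAll (IntegralMaps h) (locGenAll h)
  ⟨X.finite, X.projective, X.isLocallyFree⟩

end IntegralMaps

/-! ### Semilinear automorphisms of 𝓞_h from automorphisms of Kᶜ over k. -/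

section Conjugation

variable {k K : Type*} [Field k] [Field K] [NumberField K] [Algebra k K] [IsGalois k K]

theorem normal_algebraicClosure : Normal k (AlgebraicClosure K) := by
  have : Algebra.IsAlgebraic k (AlgebraicClosure K) := Algebra.IsAlgebraic.trans k K _
  exact normal_iff.2 fun x =>
    ⟨(Algebra.IsAlgebraic.isAlgebraic x).isIntegral, IsAlgClosed.splits _⟩

/-- The automorphism `σ⁻¹ ω σ` of `Kᶜ/K`, for an automorphism `σ` of `Kᶜ/k`. -/
noncomputable def conjAut (σ : Gal((AlgebraicClosure K)/k)) (ω : Gal((AlgebraicClosure K)/K)) :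
    Gal((AlgebraicClosure K)/K) :=
  { σ⁻¹ * ω.restrictScalars k * σ with
    commutes' := fun x => by
      change σ.symm (ω (σ (algebraMap K _ x))) = _
      rw [← AlgEquiv.restrictNormal_commutes σ K x, ω.commutes,
        AlgEquiv.restrictNormal_commutes σ K x, AlgEquiv.symm_apply_apply] }

theorem apply_conjAut (σ : Gal((AlgebraicClosure K)/k)) (ω : Gal((AlgebraicClosure K)/K))
    (x : AlgebraicClosure K) : σ (conjAut σ ω x) = ω (σ x) :=
  AlgEquiv.apply_symm_apply σ _

variable {G : Type*} [CommGroup G] [TopologicalSpace G] [MulDistribMulAction Gal(K/k) G]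

/-- The automorphism `σ` of `Kᶜ/k` extends `γ ∈ Gal(K/k)` and is compatible with `h` under
conjugation. -/
structure IsCompatible (h : Gal((tameClosure K)/K) →ₜ* G) (σ : Gal((AlgebraicClosure K)/k))
    (γ : Gal(K/k)) : Prop where
  apply_algebraMap (x : K) : σ (algebraMap K _ x) = algebraMap K _ (γ x)
  inflate_conjAut (ω : Gal((AlgebraicClosure K)/K)) :
    inflate h (conjAut σ ω) = γ⁻¹ • inflate h ω

namespace IsCompatible

variable {h : Gal((tameClosure K)/K) →ₜ* G} {σ : Gal((AlgebraicClosure K)/k)} {γ : Gal(K/k)}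

theorem inv (H : IsCompatible h σ γ) : IsCompatible h σ⁻¹ γ⁻¹ where
  apply_algebraMap x := by
    apply σ.injective
    rw [H.apply_algebraMap]
    exact (AlgEquiv.apply_symm_apply σ _).trans
      (congrArg _ (AlgEquiv.apply_symm_apply γ x).symm)
  inflate_conjAut ω := by
    have h1 := H.inflate_conjAut (conjAut σ⁻¹ ω)
    have h2 : conjAut σ (conjAut σ⁻¹ ω) = ω := by
      ext x
      apply σ.injective
      rw [apply_conjAut]
      apply σ⁻¹.injective
      rw [apply_conjAut]
      exact (congrArg ω (AlgEquiv.symm_apply_apply σ x)).trans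
        (AlgEquiv.symm_apply_apply σ _).symm
    rw [h2] at h1
    rw [h1, smul_smul, inv_inv, mul_inv_cancel, one_smul]

/-- Moving ω past σ replaces it by σ⁻¹ωσ, and acting by γ⁻¹ on the argument replaces h(ω) by γ⁻¹ •
h(ω). Compatibility says precisely that the two changes match. -/
theorem map_mem (H : IsCompatible h σ γ) {a : G → AlgebraicClosure K} (ha : a ∈ IntegralMaps h) :
    (fun s => σ (a (γ⁻¹ • s))) ∈ IntegralMaps h := by
  refine ⟨fun s => ⟨?_, ?_⟩, fun ω s => ?_⟩
  · rw [IntermediateField.mem_fixedField_iff]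
    intro ω hω
    have h1 : conjAut σ ω ∈ (inflate h).ker := by
      rw [MonoidHom.mem_ker, H.inflate_conjAut, MonoidHom.mem_ker.1 hω, smul_one]
    rw [← apply_conjAut]
    exact congrArg σ ((IntermediateField.mem_fixedField_iff _ _).1 (ha.1 (γ⁻¹ • s)).1 _ h1)
  · exact (ha.1 (γ⁻¹ • s)).2.map (σ : AlgebraicClosure K →+* AlgebraicClosure K).toIntAlgHom
  · change σ (a (γ⁻¹ • (inflate h ω * s))) = ω (σ (a (γ⁻¹ • s)))
    rw [smul_mul', ← H.inflate_conjAut, ha.2, apply_conjAut]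

/-- The additive map `a ↦ (s ↦ σ(a(γ⁻¹ s)))` of `𝓞_h` to itself. -/
noncomputable def mapHom (H : IsCompatible h σ γ) : IntegralMaps h →+ IntegralMaps h where
  toFun a := ⟨fun s => σ (a.1 (γ⁻¹ • s)), H.map_mem a.2⟩
  map_zero' := Subtype.ext (funext fun _ => map_zero σ)
  map_add' a b := Subtype.ext (funext fun s => map_add σ (a.1 (γ⁻¹ • s)) (b.1 (γ⁻¹ • s)))

/-- The additive automorphism `a ↦ (s ↦ σ(a(γ⁻¹ s)))` of `𝓞_h`. -/
noncomputable def mapEquiv (H : IsCompatible h σ γ) : IntegralMaps h ≃+ IntegralMaps h :=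
  { H.mapHom with
    invFun := H.inv.mapHom
    left_inv := fun a => Subtype.ext (funext fun s => by
      change σ⁻¹ (σ (a.1 (γ⁻¹ • γ⁻¹⁻¹ • s))) = a.1 s
      rw [smul_inv_smul]
      exact AlgEquiv.symm_apply_apply σ _)
    right_inv := fun a => Subtype.ext (funext fun s => by
      change σ (σ⁻¹ (a.1 (γ⁻¹⁻¹ • γ⁻¹ • s))) = a.1 s
      rw [inv_smul_smul]
      exact AlgEquiv.apply_symm_apply σ _) }

theorem mapEquiv_apply (H : IsCompatible h σ γ) (a : IntegralMaps h) (s : G) :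
    (H.mapEquiv a).1 s = σ (a.1 (γ⁻¹ • s)) := rfl

theorem isSemilinear (H : IsCompatible h σ γ) : IsSemilinear G γ H.mapEquiv := by
  intro r a
  induction r using GroupRing.induction with
  | h0 => rw [zero_smul, smul_zero, zero_smul, map_zero]
  | hadd r r' hr hr' => rw [add_smul, map_add, hr, hr', smul_add, add_smul]
  | hs g c =>
    rw [GroupRing.smul_single, IntegralMaps.single_smul, IntegralMaps.single_smul]
    refine Subtype.ext (funext fun t => ?_)
    rw [mapEquiv_apply]
    change σ (c • a.1 (γ⁻¹ • t * g)) = (γ • c) • σ (a.1 (γ⁻¹ • (t * γ • g)))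
    have hsmul (c : 𝓞 K) (x : AlgebraicClosure K) : c • x = algebraMap K _ (c : K) * x :=
      Algebra.smul_def (R := 𝓞 K) c x
    rw [smul_mul', inv_smul_smul, hsmul, hsmul, map_mul]
    exact congrArg (· * _) (H.apply_algebraMap (c : K))

end IsCompatible

end Conjugation

/-! ### Commutativity of the square. -/

section Square

variable {k K G : Type*} [Field k] [NumberField k] [Field K] [NumberField K] [Algebra k K]
  [IsGalois k K] [CommGroup G] [Finite G] [TopologicalSpace G] [DiscreteTopology G]
  [MulDistribMulAction Gal(K/k) G] (s : Lifts k K)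

theorem Lifts.exists_extension (γ : Gal(K/k)) : ∃ σ : Gal((AlgebraicClosure K)/k),
    ∀ x : tameClosure K, σ x = s.lift γ x := by
  have := normal_algebraicClosure (k := k) (K := K)
  have : IsScalarTower k (tameClosure K) (AlgebraicClosure K) :=
    IsScalarTower.of_algebraMap_eq fun _ => rfl
  obtain ⟨σ, hσ⟩ := AlgEquiv.restrictNormalHom_surjective (F := k) (K₁ := tameClosure K)
    (AlgebraicClosure K) (s.lift γ)
  refine ⟨σ, fun x => ?_⟩
  rw [← hσ]
  exact (AlgEquiv.restrictNormal_commutes σ (tameClosure K) x).symm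

variable {s}

/-- On Kᵗ, conjugating σ⁻¹ωσ by γ̄ gives back ω, so the invariance of h under γ is exactly the
compatibility condition. -/
theorem Lifts.isCompatible (h : s.invHom G) {γ : Gal(K/k)} {σ : Gal((AlgebraicClosure K)/k)}
    (hσ : ∀ x : tameClosure K, σ x = s.lift γ x) : IsCompatible h.1 σ γ where
  apply_algebraMap x := by
    have h1 := toSigma_commutes (s.lift γ) x
    rw [s.toSigma_lift] at h1
    exact (hσ (algebraMap K _ x)).trans (congrArg Subtype.val h1.symm)
  inflate_conjAut ω := by
    have h1 := congrFun (h.2 γ) (AlgEquiv.restrictNormalHom (tameClosure K) (conjAut σ ω))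
    have h2 : s.conj γ (AlgEquiv.restrictNormalHom (tameClosure K) (conjAut σ ω)) =
        AlgEquiv.restrictNormalHom (tameClosure K) ω := by
      ext x
      obtain ⟨y, rfl⟩ := (s.lift γ).surjective x
      have h3 : s.conj γ (AlgEquiv.restrictNormalHom (tameClosure K) (conjAut σ ω)) (s.lift γ y) =
          s.lift γ (AlgEquiv.restrictNormalHom (tameClosure K) (conjAut σ ω) y) :=
        congrArg (fun z => s.lift γ (AlgEquiv.restrictNormalHom (tameClosure K) (conjAut σ ω) z))
          (AlgEquiv.symm_apply_apply (s.lift γ) y)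
      have h4 : ((AlgEquiv.restrictNormalHom (tameClosure K) (conjAut σ ω) y : tameClosure K) :
          AlgebraicClosure K) = conjAut σ ω y :=
        AlgEquiv.restrictNormal_commutes (conjAut σ ω) (tameClosure K) y
      have h5 : ((AlgEquiv.restrictNormalHom (tameClosure K) ω (s.lift γ y) : tameClosure K) :
          AlgebraicClosure K) = ω (s.lift γ y : tameClosure K) :=
        AlgEquiv.restrictNormal_commutes ω (tameClosure K) (s.lift γ y)
      rw [h3, h5, ← hσ, ← hσ, h4, apply_conjAut]
    rw [Lifts.homAct, h2] at h1
    exact h1.symm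

/-- The element is ω = σ τ ρ⁻¹: it is trivial on K because the gradings cancel, and it restricts to
γ̄ δ̄ (γδ)̄⁻¹ on Kᵗ. -/
theorem Lifts.exists_apply_eq (h : s.invHom G) {γ δ : Gal(K/k)}
    {σ τ ρ : Gal((AlgebraicClosure K)/k)} (hσ : ∀ x : tameClosure K, σ x = s.lift γ x)
    (hτ : ∀ x : tameClosure K, τ x = s.lift δ x)
    (hρ : ∀ x : tameClosure K, ρ x = s.lift (γ * δ) x) :
    ∃ ω : Gal((AlgebraicClosure K)/K), (∀ x, ω (ρ x) = σ (τ x)) ∧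
      inflate h.1 ω = h.1 (s.defect γ δ) := by
  have hcomm (x : K) : σ (τ (ρ⁻¹ (algebraMap K _ x))) = algebraMap K _ x := by
    rw [(isCompatible h hρ).inv.apply_algebraMap x, (isCompatible h hτ).apply_algebraMap,
      (isCompatible h hσ).apply_algebraMap]
    exact congrArg _ (AlgEquiv.apply_symm_apply (γ * δ) x)
  let ω : Gal((AlgebraicClosure K)/K) := { σ * τ * ρ⁻¹ with commutes' := hcomm }
  have hω (x : AlgebraicClosure K) : ω (ρ x) = σ (τ x) :=
    congrArg (fun y => σ (τ y)) (AlgEquiv.symm_apply_apply ρ x)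
  have h1 : AlgEquiv.restrictNormalHom (tameClosure K) ω = s.defect γ δ := by
    ext x
    obtain ⟨y, rfl⟩ := (s.lift (γ * δ)).surjective x
    have h2 : s.defect γ δ (s.lift (γ * δ) y) = s.lift γ (s.lift δ y) :=
      congrArg (fun z => s.lift γ (s.lift δ z)) (AlgEquiv.symm_apply_apply (s.lift (γ * δ)) y)
    have h3 : ((AlgEquiv.restrictNormalHom (tameClosure K) ω (s.lift (γ * δ) y) :
        tameClosure K) : AlgebraicClosure K) = ω (s.lift (γ * δ) y : tameClosure K) :=
      AlgEquiv.restrictNormal_commutes ω (tameClosure K) (s.lift (γ * δ) y)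
    rw [h3, h2, ← hρ, hω, ← hσ, ← hτ]
  exact ⟨ω, hω, congrArg h.1 h1⟩

theorem Lifts.single_defect_smul (h : s.invHom G) {γ δ : Gal(K/k)}
    {σ τ ρ : Gal((AlgebraicClosure K)/k)} (hσ : ∀ x : tameClosure K, σ x = s.lift γ x)
    (hτ : ∀ x : tameClosure K, τ x = s.lift δ x)
    (hρ : ∀ x : tameClosure K, ρ x = s.lift (γ * δ) x) (a : IntegralMaps h.1) :
    (GroupRing.single (h.1 (s.defect γ δ)) 1 : GroupRing K G) • (isCompatible h hρ).mapEquiv a =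
      (isCompatible h hσ).mapEquiv ((isCompatible h hτ).mapEquiv a) := by
  obtain ⟨ω, hω, hωh⟩ := exists_apply_eq h hσ hτ hρ
  rw [IntegralMaps.single_smul, one_smul]
  refine Subtype.ext (funext fun t => ?_)
  -- Here Galois action becomes translation: a map b in 𝓞_h satisfies b(h(ω) t) = ω(b(t)), used for
  -- b = φ_{γδ}(a).
  have h4 := ((isCompatible h hρ).mapEquiv a).2.2 ω t
  rw [hωh, mul_comm, IsCompatible.mapEquiv_apply (a := a) (s := t), hω] at h4
  rw [IsCompatible.mapEquiv_apply, IsCompatible.mapEquiv_apply, smul_smul, ← mul_inv_rev, ← h4]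
  rfl

theorem Lifts.exists_isDefect (h : s.invHom G) :
    ∃ φ : Gal(K/k) → IntegralMaps h.1 ≃+ IntegralMaps h.1, (∀ γ, IsSemilinear G γ (φ γ)) ∧
      IsDefect φ fun p => GroupRing.ofUnits K G (h.1 (s.defect p.1 p.2)) := by
  choose σ hσ using s.exists_extension
  refine ⟨fun γ => (isCompatible h (hσ γ)).mapEquiv,
    fun γ => (isCompatible h (hσ γ)).isSemilinear, fun γ δ x => ?_⟩
  have h1 := single_defect_smul h (hσ γ) (hσ δ) (hσ (γ * δ))
    ((isCompatible h (hσ (γ * δ))).mapEquiv.symm x)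
  rw [AddEquiv.apply_symm_apply] at h1
  exact h1

/-- The semilinear automorphisms of 𝓞_h show at once that its class is invariant, and their defect
is the image of the transgression cocycle itself, so no coboundary has to be found. -/
theorem exists_gal_mem (h : s.invHom G) : ∃ hg : gal h.1 ∈ InvClassGp k K G,
    iStar k K G (s.tr h) = xi ⟨gal h.1, hg⟩ := by
  obtain ⟨φ, hφ, hd⟩ := Lifts.exists_isDefect h
  have hL := IntegralMaps.isLFLattice h.1
  let X : LFLattice K G := { carrier := IntegralMaps h.1, finite := hL.1, projective := hL.2.1,
                             isLocallyFree := hL.2.2 }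
  have hX : gal h.1 = ClassGp.mk X := dif_pos hL
  have hg : gal h.1 ∈ InvClassGp k K G := fun γ => by
    rw [hX]
    exact ClassGp.smul_mk (X := X) (Y := X) (hφ γ)
  exact ⟨hg, (xi_eq ⟨X, φ, _, LFLattice.isMulCocycle_of_isDefect (X := X) hφ hd, hX.symm, hφ, hd,
    rfl⟩).symm⟩

end Square

end BasicDiagram

theorem mainTheorem2 {k K G : Type*} [Field k] [NumberField k] [Field K] [NumberField K]
    [Algebra k K] [IsGalois k K] [CommGroup G] [Finite G] [TopologicalSpace G] [DiscreteTopology G]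
    [MulDistribMulAction Gal(K/k) G] (s : BasicDiagram.Lifts k K) :
    -- `gal` is well defined: `𝓞_h` is a locally free lattice for every `h`
    (∀ h : Gal((BasicDiagram.tameClosure K)/K) →ₜ* G,
      BasicDiagram.IntegralMaps.IsLFLattice h) ∧
    -- `ξ` is well defined
    (∀ (X : BasicDiagram.LFLattice K G)
        (hX : BasicDiagram.ClassGp.mk X ∈ BasicDiagram.InvClassGp k K G),
      (∀ γ : Gal(K/k), ∃ φ : X ≃+ X, BasicDiagram.IsSemilinear G γ φ) ∧
      ∀ φ : Gal(K/k) → X ≃+ X, (∀ γ, BasicDiagram.IsSemilinear G γ (φ γ)) →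
        (∃! d : Gal(K/k) × Gal(K/k) → (BasicDiagram.GroupRing K G)ˣ, BasicDiagram.IsDefect φ d) ∧
        ∀ d : Gal(K/k) × Gal(K/k) → (BasicDiagram.GroupRing K G)ˣ,
          BasicDiagram.IsDefect φ d → ∃ hd : groupCohomology.IsMulCocycle₂ d,
          BasicDiagram.xi ⟨BasicDiagram.ClassGp.mk X, hX⟩ = BasicDiagram.H2.mk d hd) ∧
    -- the maps `res`, `tr`, `i*` and `ξ` are homomorphisms
    (∀ a b : BasicDiagram.H1 k K G, s.res (a * b) = s.res a * s.res b) ∧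
    (∀ h h' : s.invHom G, s.tr (h * h') = s.tr h * s.tr h') ∧
    (∀ z z' : BasicDiagram.H2 Gal(K/k) G, BasicDiagram.iStar k K G (z * z') =
      BasicDiagram.iStar k K G z * BasicDiagram.iStar k K G z') ∧
    (∀ c c' : BasicDiagram.InvClassGp k K G,
      BasicDiagram.xi (c * c') = BasicDiagram.xi c * BasicDiagram.xi c') ∧
    -- the top row is exact
    (∀ h : s.invHom G, s.tr h = 1 ↔ ∃ a : BasicDiagram.H1 k K G, s.res a = h) ∧
    -- `gal` maps invariant homomorphisms to invariant classes, and the square commutes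
    (∀ h : s.invHom G, ∃ hg : BasicDiagram.gal h.1 ∈ BasicDiagram.InvClassGp k K G,
      BasicDiagram.iStar k K G (s.tr h) = BasicDiagram.xi ⟨BasicDiagram.gal h.1, hg⟩) := by
  
  refine ⟨fun h => BasicDiagram.IntegralMaps.isLFLattice h, fun X hX =>
    ⟨X.exists_isSemilinear_of_mk_mem hX, fun φ hφ => ⟨X.existsUnique_isDefect φ hφ, fun d hd =>
      ⟨BasicDiagram.LFLattice.isMulCocycle_of_isDefect hφ hd, ?_⟩⟩⟩,
    s.res_mul, s.tr_mul, BasicDiagram.H2.map_mul _ _, BasicDiagram.xi_mul, s.tr_eq_one_iff,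
    BasicDiagram.exists_gal_mem⟩
  exact BasicDiagram.xi_eq ⟨X, φ, d, _, rfl, hφ, hd, rfl⟩
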